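/- **Notation.** Let $d\ge 0$ be an integer. For a nonzero window $g\in\mathcal S(\mathbb R^n)$ and $f\in\mathcal S'(\mathbb R^n)$ let $V_gf(x,\omega)=\langle f, M_\omega T_x g\rangle$ be the short-time Fourier transform, where $M_\omega T_xg(t)=e^{2\pi i\omega\cdot t}g(t-x)$ and $\langle\cdot,\cdot\rangle$ is conjugate-linear in the second argument. For $1\le p,q<\infty$ and positive weights $m$ on $\mathbb R^{2n}$, $w$ on $\mathbb R^n$ put $$\|f\|_{M^{p,q}_m}=\Big(\int_{\mathbb R^n}\Big(\int_{\mathbb R^n}|V_gf(x,\omega)|^p m(x,\omega)^p\,dx\Big)^{q/p}d\omega\Big)^{1/q},$$ $$\|f\|_{W(\mathcal FL^p,L^q_w)}=\Big(\int_{\mathbb R^n}\Big(\int_{\mathbb R^n}|V_gf(x,\omega)|^p\,d\omega\Big)^{q/p}w(x)^q\,dx\Big)^{1/q},$$ and let $M^{p,q}_m(\mathbb R^n)$ and $W(\mathcal FL^p,L^q_w)(\mathbb R^n)$ be the spaces of all $f\in\mathcal S'(\mathbb R^n)$ for which the respective norm is finite. Let $v_s(z)=(1+|z|^2)^{s/2}$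 for $s\in\mathbb R$ and $z\in\mathbb R^{2d}$, and $(1\otimes v_s)(z,\zeta)=v_s(\zeta)$ for $z,\zeta\in\mathbb R^{2d}$. For $A\in\mathrm{GL}(2d,\mathbb R)$ and $f,g\in\mathcal S'(\mathbb R^d)$ the matrix-Wigner distribution is $\mathcal B_A(f,g)=\mathcal F_2\mathfrak T_A(f\otimes\overline g)\in\mathcal S'(\mathbb R^{2d})$, where $\mathfrak T_AF(z)=F(Az)$ and $\mathcal F_2$ is the partial Fourier transform (with kernel $e^{-2\pi i\omega\cdot y}$) in the second group of $d$ variables. For $M\in\mathbb R^{d\times d}$ the associated Cohen-type matrix is $$A_M=\begin{pmatrix} I & M+\tfrac12 I\\ I & M-\tfrac12 I\end{pmatrix}\in\mathrm{GL}(2d,\mathbb R),$$ so that, formally, $\mathcal B_{A_M}(f,g)(x,\omega)=\int_{\mathbb R^d}e^{-2\pi i\omega\cdot y}f\big(x+(M+\tfrac12I)y\big)\overline{g\big(x+(M-\tfrac12I)y\big)}\,dy$. Put $$P_M=\begin{pmatrix}-(M+\tfrac12 I)&0\\0&M-\tfrac12 I\end{pmatrix},\qquad C_M=\left|\det\left(M+\tfrac12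 I\right)\det\left(M-\tfrac12 I\right)\right|.$$ A $2\times2$ block matrix with $d\times d$ blocks is called right-regular if both blocks of its second column are invertible. **Theorem.** Let $M\in\mathbb R^{d\times d}$, $A=A_M$, $s\in\mathbb R$, and let $1\le p_1,p_2,q_1,q_2,p,q<\infty$ satisfy $$p_i,q_i\le q\ (i=1,2),\qquad \frac1{p_1}+\frac1{p_2}\ge\frac1p+\frac1q,\qquad \frac1{q_1}+\frac1{q_2}\ge\frac1p+\frac1q .$$ Fix nonzero Schwartz windows $g_1,g_2$ on $\mathbb R^d$ (used for the norms of $f_1$, $f_2$ respectively) and $\Phi$ on $\mathbb R^{2d}$ (used for the norms of $\mathcal B_A(f_1,f_2)$). Below, $C$ denotes a finite constant that depends only on $d$, $M$, $s$, the exponents and the windows, and not on $f_1,f_2$. (i) There is such a $C$ that, for all $f_1\in M^{p_1,q_1}_{v_{|s|}}(\mathbb R^d)$ and $f_2\in M^{p_2,q_2}_{v_s}(\mathbb R^d)$, one has $\mathcal B_A(f_1,f_2)\in M^{p,q}_{1\otimes v_s}(\mathbb R^{2d})$ and $$\|\mathcal B_A(f_1,f_2)\|_{M^{p,q}_{1\otimes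 v_s}}\le C\,\|f_1\|_{M^{p_1,q_1}_{v_{|s|}}}\|f_2\|_{M^{p_2,q_2}_{v_s}} .$$ (ii) The matrices $M-\tfrac12I$ and $M+\tfrac12I$ are both invertible if and only if $A_M$ is right-regular, and if and only if $P_M$ is invertible. Suppose they are. Then $I+P_M^{-1}$ is invertible and $C_M>0$; put $v_s^M=v_s\circ(I+P_M^{-1})^{-1}$. There is such a $C$ that, for all $f_1\in M^{p_1,q_1}_{v_{|s|}}(\mathbb R^d)$ and $f_2\in M^{p_2,q_2}_{v_s^M}(\mathbb R^d)$, one has $\mathcal B_A(f_1,f_2)\in W(\mathcal FL^p,L^q_{v_s^M})(\mathbb R^{2d})$ and $$\|\mathcal B_A(f_1,f_2)\|_{W(\mathcal FL^p,L^q_{v_s^M})}\le C\,(C_M)^{1/q-1/p}\,\|f_1\|_{M^{p_1,q_1}_{v_{|s|}}}\|f_2\|_{M^{p_2,q_2}_{v_s^M}} .$$ -/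

import Mathlib

open scoped SchwartzMap FourierTransform LineDeriv ENNReal NNReal
open MeasureTheory
namespace MWD
noncomputable section

section Abstract

variable {V : Type*} [NormedAddCommGroup V] [NormedSpace ℝ V] {κ : Type*} [Fintype κ]

/-- Continuous seminorms on the Schwartz space that dominate a family of operators can be
summed. -/
theorem exists_seminorm_sum {α : Type*} {N : κ → 𝓢(V, ℂ) → α → ℝ}
    (h : ∀ i, ∃ q : Seminorm ℂ 𝓢(V, ℂ), Continuous q ∧ ∀ Φ a, N i Φ a ≤ q Φ) :
    ∃ q : Seminorm ℂ 𝓢(V, ℂ), Continuous q ∧ ∀ Φ a, ∑ i, N i Φ a ≤ q Φ := by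
  choose q hq hN using h
  refine ⟨∑ i, q i, ?_, fun Φ a => ?_⟩
  · exact Seminorm.continuous_finsetSum fun i _ => hq i
  · have : (∑ i, q i) Φ = ∑ i, q i Φ := by
      change FunLike.coeAddMonoidHom _ _ _ (∑ i, q i) Φ = _
      simp_rw [map_sum, Finset.sum_apply]; rfl
    rw [this]
    exact Finset.sum_le_sum fun i _ => hN i Φ a

variable (U : 𝓢(V, ℂ) →ₗ[ℂ] (EuclideanSpace ℝ κ → ℂ)) (D Q : κ → 𝓢(V, ℂ) →L[ℂ] 𝓢(V, ℂ))

theorem exists_bound_pow (hQ : ∀ i Φ x, (x i : ℂ) * U Φ x = U (Q i Φ) x)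
    (h0 : ∃ q : Seminorm ℂ 𝓢(V, ℂ), Continuous q ∧ ∀ Φ x, ‖U Φ x‖ ≤ q Φ) (k : ℕ) :
    ∃ q : Seminorm ℂ 𝓢(V, ℂ), Continuous q ∧ ∀ Φ x, ‖x‖ ^ k * ‖U Φ x‖ ≤ q Φ := by
  induction k with
  | zero => simpa using h0
  | succ k ih =>
    obtain ⟨q, hq, h⟩ := ih
    obtain ⟨q', hq', h'⟩ := exists_seminorm_sum
      (N := fun i Φ x => ‖x‖ ^ k * ‖U (Q i Φ) x‖) (κ := κ)
      fun i => ⟨q.comp (Q i).toLinearMap, hq.comp (Q i).continuous, fun Φ x => h (Q i Φ) x⟩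
    refine ⟨q', hq', fun Φ x => le_trans ?_ (h' Φ x)⟩
    have hx : ‖x‖ ≤ ∑ i, ‖x i‖ := by
      conv_lhs => rw [← (EuclideanSpace.basisFun κ ℝ).sum_repr x]
      refine (norm_sum_le _ _).trans (Finset.sum_le_sum fun i _ => ?_)
      rw [norm_smul, (EuclideanSpace.basisFun κ ℝ).norm_eq_one]; simp
    calc ‖x‖ ^ (k + 1) * ‖U Φ x‖ = ‖x‖ * (‖x‖ ^ k * ‖U Φ x‖) := by ring
      _ ≤ (∑ i, ‖x i‖) * (‖x‖ ^ k * ‖U Φ x‖) := by gcongr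
      _ = ∑ i, ‖x‖ ^ k * ‖U (Q i Φ) x‖ := by
        rw [Finset.sum_mul]
        refine Finset.sum_congr rfl fun i _ => ?_
        rw [← hQ, norm_mul, Complex.norm_real]; ring

theorem fderiv_operator
    (hD : ∀ Φ x, HasFDerivAt (U Φ)
      (∑ i, (EuclideanSpace.proj i : EuclideanSpace ℝ κ →L[ℝ] ℝ).smulRight (U (D i Φ) x)) x)
    (Φ : 𝓢(V, ℂ)) :
    fderiv ℝ (U Φ) = fun x => ∑ i, (ContinuousLinearMap.smulRightL ℝ (EuclideanSpace ℝ κ) ℂ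
      (EuclideanSpace.proj i) ∘ U (D i Φ)) x := by
  ext1 x
  rw [(hD Φ x).fderiv]; rfl

theorem contDiff_operator
    (hD : ∀ Φ x, HasFDerivAt (U Φ)
      (∑ i, (EuclideanSpace.proj i : EuclideanSpace ℝ κ →L[ℝ] ℝ).smulRight (U (D i Φ) x)) x)
    (Φ : 𝓢(V, ℂ)) (n : ℕ) : ContDiff ℝ n (U Φ) := by
  induction n generalizing Φ with
  | zero =>
    exact contDiff_zero.2 (continuous_iff_continuousAt.2 fun x => (hD Φ x).continuousAt)
  | succ n ih =>
    rw [show ((n + 1 : ℕ) : WithTop ℕ∞) = (n : WithTop ℕ∞) + 1 by push_cast; rfl,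
      contDiff_succ_iff_fderiv]
    refine ⟨fun x => (hD Φ x).differentiableAt, by simp, ?_⟩
    rw [fderiv_operator U D hD]
    exact ContDiff.sum fun i _ => (ContinuousLinearMap.contDiff _).comp (ih _)

set_option synthInstance.maxHeartbeats 200000 in
theorem exists_bound_iteratedFDeriv
    (hD : ∀ Φ x, HasFDerivAt (U Φ)
      (∑ i, (EuclideanSpace.proj i : EuclideanSpace ℝ κ →L[ℝ] ℝ).smulRight (U (D i Φ) x)) x)
    (hQ : ∀ i Φ x, (x i : ℂ) * U Φ x = U (Q i Φ) x)
    (h0 : ∃ q : Seminorm ℂ 𝓢(V, ℂ), Continuous q ∧ ∀ Φ x, ‖U Φ x‖ ≤ q Φ) (k n : ℕ) :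
    ∃ q : Seminorm ℂ 𝓢(V, ℂ), Continuous q ∧
      ∀ Φ x, ‖x‖ ^ k * ‖iteratedFDeriv ℝ n (U Φ) x‖ ≤ q Φ := by
  induction n with
  | zero => simpa using exists_bound_pow U Q hQ h0 k
  | succ n ih =>
    obtain ⟨q, hq, h⟩ := ih
    let R : κ → (ℂ →L[ℝ] (EuclideanSpace ℝ κ →L[ℝ] ℂ)) := fun i =>
      ContinuousLinearMap.smulRightL ℝ (EuclideanSpace ℝ κ) ℂ (EuclideanSpace.proj i)
    obtain ⟨q', hq', h'⟩ := exists_seminorm_sum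
      (N := fun i Φ x => ‖R i‖ * (‖x‖ ^ k * ‖iteratedFDeriv ℝ n (U (D i Φ)) x‖)) (κ := κ)
      fun i => ⟨‖R i‖₊ • q.comp (D i).toLinearMap,
        continuous_const.mul (hq.comp (D i).continuous), fun Φ x =>
          mul_le_mul_of_nonneg_left (h (D i Φ) x) (norm_nonneg (R i))⟩
    refine ⟨q', hq', fun Φ x => le_trans ?_ (h' Φ x)⟩
    have hc : ∀ i, ContDiff ℝ n (R i ∘ U (D i Φ)) := fun i =>
      (R i).contDiff.comp (contDiff_operator U D hD _ n)
    rw [← norm_iteratedFDeriv_fderiv, fderiv_operator U D hD, iteratedFDeriv_sum fun i _ => hc i,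
      Finset.sum_apply]
    calc _ ≤ ‖x‖ ^ k * ∑ i, ‖R i‖ * ‖iteratedFDeriv ℝ n (U (D i Φ)) x‖ := by
          gcongr
          refine (norm_sum_le _ _).trans (Finset.sum_le_sum fun i _ => ?_)
          exact (R i).norm_iteratedFDeriv_comp_left
            (contDiff_operator U D hD _ n).contDiffAt le_rfl
      _ = _ := by
          rw [Finset.mul_sum]
          exact Finset.sum_congr rfl fun i _ => by ring

/-- A linear map from Schwartz functions to functions that intertwines partial derivatives and
multiplication by coordinates with continuous operators, and is bounded in sup norm by a continuous
seminorm, is a continuous linear map between Schwartz spaces. -/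
def operatorCLM
    (hD : ∀ Φ x, HasFDerivAt (U Φ)
      (∑ i, (EuclideanSpace.proj i : EuclideanSpace ℝ κ →L[ℝ] ℝ).smulRight (U (D i Φ) x)) x)
    (hQ : ∀ i Φ x, (x i : ℂ) * U Φ x = U (Q i Φ) x)
    (h0 : ∃ q : Seminorm ℂ 𝓢(V, ℂ), Continuous q ∧ ∀ Φ x, ‖U Φ x‖ ≤ q Φ) :
    𝓢(V, ℂ) →L[ℂ] 𝓢(EuclideanSpace ℝ κ, ℂ) :=
  SchwartzMap.mkCLM (fun Φ => U Φ) (fun Φ Ψ x => by simp) (fun a Φ x => by simp)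
    (fun Φ => contDiff_infty.2 (contDiff_operator U D hD Φ))
    (fun n => by
      obtain ⟨q, hq, h⟩ := exists_bound_iteratedFDeriv U D Q hD hQ h0 n.1 n.2
      obtain ⟨t, C, -, h'⟩ := Seminorm.bound_of_continuous (schwartz_withSeminorms ℂ V ℂ) q hq
      exact ⟨t, C, C.2, fun Φ x => (h Φ x).trans (h' Φ)⟩)

end Abstract

section Translation

variable {V : Type*} [NormedAddCommGroup V] [NormedSpace ℝ V]

theorem lineDerivOp_comm (Φ : 𝓢(V, ℂ)) (v w : V) :
    (∂_{v} (∂_{w} Φ) : 𝓢(V, ℂ)) = ∂_{w} (∂_{v} Φ) := by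
  ext x
  have hd : DifferentiableAt ℝ (fderiv ℝ Φ) x :=
    ((Φ.smooth 2).fderiv_right (m := 1) (by norm_num)).differentiable (by norm_num) x
  have key : ∀ a b : V, (∂_{a} (∂_{b} Φ) : 𝓢(V, ℂ)) x = fderiv ℝ (fderiv ℝ Φ) x a b :=
    fun a b => by
    rw [SchwartzMap.lineDerivOp_apply_eq_fderiv,
      show ⇑(∂_{b} Φ : 𝓢(V, ℂ)) = fun y => fderiv ℝ Φ y b from
        funext fun y => SchwartzMap.lineDerivOp_apply_eq_fderiv b Φ y]
    rw [fderiv_clm_apply hd (by fun_prop)]; simp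
  rw [key, key]
  exact (((Φ.smooth 2).contDiffAt (x := x)).isSymmSndFDerivAt (by simp)).eq v w

theorem iteratedLineDerivOp_lineDerivOp_comm (Φ : 𝓢(V, ℂ)) (h : V) {n : ℕ} (m : Fin n → V) :
    (∂^{m} (∂_{h} Φ) : 𝓢(V, ℂ)) = ∂_{h} (∂^{m} Φ) := by
  induction n with
  | zero => simp
  | succ n ih =>
    rw [LineDeriv.iteratedLineDerivOp_succ_left, LineDeriv.iteratedLineDerivOp_succ_left, ih,
      lineDerivOp_comm]

theorem iteratedFDeriv_lineDerivOp (Φ : 𝓢(V, ℂ)) (h : V) (n : ℕ) (z : V) :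
    iteratedFDeriv ℝ n (∂_{h} Φ : 𝓢(V, ℂ)) z = fderiv ℝ (iteratedFDeriv ℝ n Φ) z h := by
  ext m
  have h1 := iteratedFDeriv_succ_apply_left (𝕜 := ℝ) (f := Φ) (x := z) (Fin.cons h m : Fin (n + 1) → V)
  rw [Fin.tail_cons, Fin.cons_zero] at h1
  rw [← SchwartzMap.iteratedLineDerivOp_eq_iteratedFDeriv, iteratedLineDerivOp_lineDerivOp_comm,
    ← h1, ← SchwartzMap.iteratedLineDerivOp_eq_iteratedFDeriv,
    LineDeriv.iteratedLineDerivOp_succ_left]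
  simp

/-- Second order remainder of a translation, in a Schwartz seminorm. -/
theorem exists_seminorm_translation_le (Φ : 𝓢(V, ℂ)) (k l : ℕ) :
    ∃ C : ℝ, 0 ≤ C ∧ ∀ h : V, ‖h‖ ≤ 1 →
      SchwartzMap.seminorm ℂ k l (Φ.compSubConstCLM ℂ (-h) - Φ - ∂_{h} Φ) ≤ C * ‖h‖ ^ 2 := by
  let q := (Finset.Iic (k, l + 2)).sup (fun m : ℕ × ℕ => SchwartzMap.seminorm ℂ m.1 m.2 (E := V) (F := ℂ))
  refine ⟨2 ^ k * (2 ^ k * q Φ), by positivity, fun h hh => ?_⟩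
  refine SchwartzMap.seminorm_le_bound ℂ k l _ (by positivity) fun z => ?_
  have hG : ∀ n : ℕ, Differentiable ℝ (iteratedFDeriv ℝ n Φ) := fun n =>
    (Φ.smooth ⊤).differentiable_iteratedFDeriv (by exact_mod_cast WithTop.coe_lt_top _)
  -- the segment from `z` to `z + h`
  have hseg : ∀ w ∈ segment ℝ z (z + h), 1 + ‖z‖ ≤ 2 * (1 + ‖w‖) ∧ ‖w - z‖ ≤ ‖h‖ := by
    intro w hw
    obtain ⟨t, ht, rfl⟩ := (segment_eq_image' ℝ z (z + h)) ▸ hw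
    have h1 : ‖t • h‖ ≤ ‖h‖ := by
      rw [norm_smul, Real.norm_of_nonneg ht.1]
      exact mul_le_of_le_one_left (norm_nonneg _) ht.2
    have h2 : ‖z‖ ≤ ‖z + t • h‖ + ‖t • h‖ := by
      simpa using norm_sub_le (z + t • h) (t • h)
    simp only [add_sub_cancel_left]
    exact ⟨by linarith [norm_nonneg (z + t • h)], h1⟩
  have hB : ∀ w ∈ segment ℝ z (z + h),
      ‖iteratedFDeriv ℝ (l + 2) Φ w‖ ≤ 2 ^ k * (2 ^ k * q Φ) / (1 + ‖z‖) ^ k := by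
    intro w hw
    have h1 := SchwartzMap.one_add_le_sup_seminorm_apply (𝕜 := ℂ) (m := (k, l + 2)) (k := k)
      (n := l + 2) le_rfl le_rfl Φ w
    rw [le_div_iff₀ (by positivity)]
    calc _ ≤ ‖iteratedFDeriv ℝ (l + 2) Φ w‖ * (2 * (1 + ‖w‖)) ^ k := by
          gcongr; exact (hseg w hw).1
      _ = 2 ^ k * ((1 + ‖w‖) ^ k * ‖iteratedFDeriv ℝ (l + 2) Φ w‖) := by rw [mul_pow]; ring
      _ ≤ _ := by gcongr
  set B := 2 ^ k * (2 ^ k * q Φ) / (1 + ‖z‖) ^ k with hBdef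
  have hB0 : 0 ≤ B := by positivity
  have hz : z ∈ segment ℝ z (z + h) := left_mem_segment ..
  have hzh : z + h ∈ segment ℝ z (z + h) := right_mem_segment ..
  have h1 : ∀ w ∈ segment ℝ z (z + h),
      ‖fderiv ℝ (iteratedFDeriv ℝ l Φ) w - fderiv ℝ (iteratedFDeriv ℝ l Φ) z‖ ≤ B * ‖h‖ := by
    intro w hw
    have e := (continuousMultilinearCurryLeftEquiv ℝ (fun _ : Fin (l + 1) => V) ℂ).dist_map
      (iteratedFDeriv ℝ (l + 1) Φ w) (iteratedFDeriv ℝ (l + 1) Φ z)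
    rw [fderiv_iteratedFDeriv]
    refine le_trans (le_of_eq ((dist_eq_norm _ _).symm.trans (e.trans (dist_eq_norm _ _)))) ?_
    refine ((convex_segment z (z + h)).norm_image_sub_le_of_norm_fderiv_le (𝕜 := ℝ)
      (fun x _ => hG (l + 1) x) (fun x hx => ?_) hz hw).trans
      (mul_le_mul_of_nonneg_left (hseg w hw).2 hB0)
    rw [norm_fderiv_iteratedFDeriv]; exact hB x hx
  have h2 := (convex_segment z (z + h)).norm_image_sub_le_of_norm_fderiv_le' (𝕜 := ℝ)
      (fun x _ => hG l x) h1 hz hzh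
  rw [add_sub_cancel_left] at h2
  have h3 : iteratedFDeriv ℝ l (Φ.compSubConstCLM ℂ (-h) - Φ - ∂_{h} Φ : 𝓢(V, ℂ)) z =
      iteratedFDeriv ℝ l Φ (z + h) - iteratedFDeriv ℝ l Φ z
        - fderiv ℝ (iteratedFDeriv ℝ l Φ) z h := by
    rw [← iteratedFDeriv_lineDerivOp, ← iteratedFDeriv_comp_add_right]
    have e : ⇑(Φ.compSubConstCLM ℂ (-h) - Φ - ∂_{h} Φ : 𝓢(V, ℂ)) =
        (fun z => Φ (z + h)) - ⇑Φ - ⇑(∂_{h} Φ : 𝓢(V, ℂ)) := by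
      ext y; simp
    have c0 : ContDiff ℝ l (fun z => Φ (z + h)) := (Φ.smooth l).comp (by fun_prop)
    have c1 : ContDiff ℝ l ((fun z => Φ (z + h)) - ⇑Φ) := c0.sub (Φ.smooth l)
    rw [e, iteratedFDeriv_sub_apply c1.contDiffAt
      (SchwartzMap.smooth _ l).contDiffAt, iteratedFDeriv_sub_apply c0.contDiffAt
      (Φ.smooth l).contDiffAt]
  rw [h3]
  calc _ ≤ (1 + ‖z‖) ^ k * (B * ‖h‖ * ‖h‖) := by
        gcongr; linarith [norm_nonneg z]
    _ = _ := by rw [hBdef]; field_simp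

/-- A tempered distribution applied to translates of a Schwartz function is differentiable in the
translation parameter. -/
theorem hasFDerivAt_apply_translation (T : 𝓢(V, ℂ) →L[ℂ] ℂ) (Φ : 𝓢(V, ℂ)) (L : V →L[ℝ] ℂ)
    (hL : ∀ h, L h = T (∂_{h} Φ)) :
    HasFDerivAt (fun h => T (Φ.compSubConstCLM ℂ (-h))) L 0 := by
  obtain ⟨s, C, -, hC⟩ := Seminorm.bound_of_continuous (schwartz_withSeminorms ℂ V ℂ)
    ((normSeminorm ℂ ℂ).comp T.toLinearMap) (continuous_norm.comp T.continuous)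
  choose c hc0 hc using fun m : ℕ × ℕ => exists_seminorm_translation_le Φ m.1 m.2
  have hbd : ∀ h : V, ‖h‖ ≤ 1 →
      ‖T (Φ.compSubConstCLM ℂ (-h)) - T Φ - L h‖ ≤ C * (∑ m ∈ s, c m) * ‖h‖ ^ 2 := by
    intro h hh
    rw [hL, ← map_sub, ← map_sub]
    refine (hC _).trans ?_
    rw [mul_assoc]
    refine mul_le_mul_of_nonneg_left ?_ C.2
    refine Seminorm.finset_sup_apply_le (mul_nonneg (Finset.sum_nonneg fun m _ => hc0 m)
      (by positivity)) fun m hm => (hc m h hh).trans ?_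
    gcongr
    exact Finset.single_le_sum (f := c) (fun m _ => hc0 m) hm
  rw [hasFDerivAt_iff_isLittleO_nhds_zero]
  refine Asymptotics.IsBigO.trans_isLittleO (g := fun h : V => ‖h‖ ^ 2) ?_
    (Asymptotics.isLittleO_norm_pow_id one_lt_two)
  refine Asymptotics.IsBigO.of_bound (C * ∑ m ∈ s, c m) ?_
  filter_upwards [Metric.closedBall_mem_nhds (0 : V) one_pos] with h hh
  have := hbd h (by simpa using hh)
  simpa using this

end Translation

section Product

variable {ι κ : Type*}

/-- The point `(x, y)` of `ℝ^(ι ⊕ κ) = ℝ^ι × ℝ^κ`, with the Euclidean norm. -/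
def join (x : EuclideanSpace ℝ ι) (y : EuclideanSpace ℝ κ) : EuclideanSpace ℝ (ι ⊕ κ) :=
  WithLp.toLp 2 (Sum.elim x y)

@[simp] theorem join_inl (x : EuclideanSpace ℝ ι) (y : EuclideanSpace ℝ κ) (i : ι) :
    join x y (Sum.inl i) = x i := rfl

@[simp] theorem join_inr (x : EuclideanSpace ℝ ι) (y : EuclideanSpace ℝ κ) (i : κ) :
    join x y (Sum.inr i) = y i := rfl

variable [Fintype ι] [Fintype κ]

/-- The first component of a point of `ℝ^(ι ⊕ κ) = ℝ^ι × ℝ^κ`. -/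
def fstL : EuclideanSpace ℝ (ι ⊕ κ) →L[ℝ] EuclideanSpace ℝ ι :=
  LinearMap.toContinuousLinearMap
    { toFun := fun z => WithLp.toLp 2 fun i => z (Sum.inl i)
      map_add' := fun _ _ => by ext; simp
      map_smul' := fun _ _ => by ext; simp }

/-- The second component of a point of `ℝ^(ι ⊕ κ) = ℝ^ι × ℝ^κ`. -/
def sndL : EuclideanSpace ℝ (ι ⊕ κ) →L[ℝ] EuclideanSpace ℝ κ :=
  LinearMap.toContinuousLinearMap
    { toFun := fun z => WithLp.toLp 2 fun i => z (Sum.inr i)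
      map_add' := fun _ _ => by ext; simp
      map_smul' := fun _ _ => by ext; simp }

/-- The inclusion `x ↦ (x, 0)`. -/
def inlL : EuclideanSpace ℝ ι →L[ℝ] EuclideanSpace ℝ (ι ⊕ κ) :=
  LinearMap.toContinuousLinearMap
    { toFun := fun x => join x 0
      map_add' := fun _ _ => by ext i; cases i <;> simp [join]
      map_smul' := fun _ _ => by ext i; cases i <;> simp [join] }

/-- The inclusion `y ↦ (0, y)`. -/
def inrL : EuclideanSpace ℝ κ →L[ℝ] EuclideanSpace ℝ (ι ⊕ κ) :=
  LinearMap.toContinuousLinearMap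
    { toFun := fun y => join 0 y
      map_add' := fun _ _ => by ext i; cases i <;> simp [join]
      map_smul' := fun _ _ => by ext i; cases i <;> simp [join] }

@[simp] theorem fstL_apply (z : EuclideanSpace ℝ (ι ⊕ κ)) (i : ι) : fstL z i = z (Sum.inl i) := rfl

@[simp] theorem sndL_apply (z : EuclideanSpace ℝ (ι ⊕ κ)) (i : κ) : sndL z i = z (Sum.inr i) := rfl

theorem inlL_apply (x : EuclideanSpace ℝ ι) :
    (inlL x : EuclideanSpace ℝ (ι ⊕ κ)) = join x 0 := rfl

theorem inrL_apply (y : EuclideanSpace ℝ κ) :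
    (inrL y : EuclideanSpace ℝ (ι ⊕ κ)) = join 0 y := rfl

theorem join_eq (x : EuclideanSpace ℝ ι) (y : EuclideanSpace ℝ κ) :
    join x y = inrL y + inlL x := by
  ext i; cases i <;> simp [inlL_apply, inrL_apply]

theorem norm_join_sq (x : EuclideanSpace ℝ ι) (y : EuclideanSpace ℝ κ) :
    ‖join x y‖ ^ 2 = ‖x‖ ^ 2 + ‖y‖ ^ 2 := by
  simp [EuclideanSpace.norm_sq_eq]

theorem norm_snd_le (x : EuclideanSpace ℝ ι) (y : EuclideanSpace ℝ κ) : ‖y‖ ≤ ‖join x y‖ := by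
  refine le_of_sq_le_sq ?_ (norm_nonneg _)
  rw [norm_join_sq]; nlinarith [norm_nonneg x]

theorem norm_inrL_le : ‖(inrL : EuclideanSpace ℝ κ →L[ℝ] EuclideanSpace ℝ (ι ⊕ κ))‖ ≤ 1 :=
  ContinuousLinearMap.opNorm_le_bound _ zero_le_one fun y => by
    rw [one_mul]
    refine le_of_sq_le_sq ?_ (norm_nonneg _)
    rw [inrL_apply, norm_join_sq]; simp

/-- The section `Φ_x = Φ(x, ·)` of a Schwartz function. -/
def sectionCLM (x : EuclideanSpace ℝ ι) :
    𝓢(EuclideanSpace ℝ (ι ⊕ κ), ℂ) →L[ℂ] 𝓢(EuclideanSpace ℝ κ, ℂ) :=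
  SchwartzMap.compCLMOfAntilipschitz (K := 1) ℂ (g := fun y => join x y)
    (by simp_rw [join_eq]; fun_prop)
    (AntilipschitzWith.of_le_mul_dist fun y y' => by
      rw [NNReal.coe_one, one_mul, dist_eq_norm, dist_eq_norm]
      have : join x y - join x y' = join 0 (y - y') := by
        ext i; cases i <;> simp
      rw [this]
      exact norm_snd_le _ _)

@[simp] theorem sectionCLM_apply (x : EuclideanSpace ℝ ι) (Φ : 𝓢(EuclideanSpace ℝ (ι ⊕ κ), ℂ))
    (y : EuclideanSpace ℝ κ) : sectionCLM x Φ y = Φ (join x y) := rfl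

theorem seminorm_sectionCLM_le (x : EuclideanSpace ℝ ι) (Φ : 𝓢(EuclideanSpace ℝ (ι ⊕ κ), ℂ))
    (k l : ℕ) :
    SchwartzMap.seminorm ℂ k l (sectionCLM x Φ) ≤ SchwartzMap.seminorm ℂ k l Φ := by
  refine SchwartzMap.seminorm_le_bound ℂ k l _ (by positivity) fun y => ?_
  have e : ⇑(sectionCLM x Φ) = (fun z => Φ (z + inlL x)) ∘ ⇑(inrL (ι := ι) (κ := κ)) := by
    ext y; simp [join_eq]
  have c0 : ContDiff ℝ l (fun z => Φ (z + inlL x)) := (Φ.smooth l).comp (by fun_prop)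
  have hn : ‖iteratedFDeriv ℝ l (sectionCLM x Φ) y‖ ≤ ‖iteratedFDeriv ℝ l Φ (join x y)‖ := by
    rw [e, ContinuousLinearMap.iteratedFDeriv_comp_right _ c0 _ le_rfl,
      iteratedFDeriv_comp_add_right, ← join_eq]
    refine (ContinuousMultilinearMap.norm_compContinuousLinearMap_le _ _).trans ?_
    refine mul_le_of_le_one_right (norm_nonneg _) ?_
    exact Finset.prod_le_one (fun _ _ => norm_nonneg _) fun _ _ => norm_inrL_le
  calc _ ≤ ‖join x y‖ ^ k * ‖iteratedFDeriv ℝ l Φ (join x y)‖ := by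
        gcongr; exact norm_snd_le x y
    _ ≤ _ := SchwartzMap.le_seminorm ℂ k l Φ _

theorem exists_seminorm_section (p : Seminorm ℂ 𝓢(EuclideanSpace ℝ κ, ℂ)) (hp : Continuous p) :
    ∃ q : Seminorm ℂ 𝓢(EuclideanSpace ℝ (ι ⊕ κ), ℂ), Continuous q ∧
      ∀ Φ (x : EuclideanSpace ℝ ι), p (sectionCLM x Φ) ≤ q Φ := by
  obtain ⟨s, C, -, hC⟩ := Seminorm.bound_of_continuous
    (schwartz_withSeminorms ℂ (EuclideanSpace ℝ κ) ℂ) p hp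
  refine ⟨C • s.sup (schwartzSeminormFamily ℂ _ ℂ), ?_, fun Φ x => (hC _).trans ?_⟩
  · exact continuous_const.mul (Seminorm.continuous_finsetSup fun i _ =>
      (schwartz_withSeminorms ℂ (EuclideanSpace ℝ (ι ⊕ κ)) ℂ).continuous_seminorm i)
  · refine mul_le_mul_of_nonneg_left ?_ C.2
    refine Seminorm.finset_sup_apply_le (apply_nonneg _ _) fun m hm => ?_
    exact (seminorm_sectionCLM_le x Φ m.1 m.2).trans
      (Seminorm.le_finset_sup_apply (p := schwartzSeminormFamily ℂ _ ℂ) hm)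

theorem hasTemperateGrowth_coord (i : ι) :
    (fun z : EuclideanSpace ℝ ι => ((z i : ℝ) : ℂ)).HasTemperateGrowth :=
  (Complex.ofRealCLM.comp (EuclideanSpace.proj i : EuclideanSpace ℝ ι →L[ℝ] ℝ)).hasTemperateGrowth

/-- The function `x ↦ g(Φ(x, ·))`. -/
def sliceLM (g : 𝓢'(EuclideanSpace ℝ κ, ℂ)) :
    𝓢(EuclideanSpace ℝ (ι ⊕ κ), ℂ) →ₗ[ℂ] (EuclideanSpace ℝ ι → ℂ) where
  toFun Φ x := g (sectionCLM x Φ)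
  map_add' _ _ := by ext; simp
  map_smul' _ _ := by ext; simp

theorem hasFDerivAt_sliceLM (g : 𝓢'(EuclideanSpace ℝ κ, ℂ))
    (Φ : 𝓢(EuclideanSpace ℝ (ι ⊕ κ), ℂ)) (x : EuclideanSpace ℝ ι) :
    HasFDerivAt (sliceLM g Φ)
      (∑ i, (EuclideanSpace.proj i : EuclideanSpace ℝ ι →L[ℝ] ℝ).smulRight
        (sliceLM g (LineDeriv.lineDerivOpCLM ℂ 𝓢(EuclideanSpace ℝ (ι ⊕ κ), ℂ)
          (inlL (κ := κ) (EuclideanSpace.basisFun ι ℝ i)) Φ) x)) x := by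
  let T : 𝓢(EuclideanSpace ℝ (ι ⊕ κ), ℂ) →L[ℂ] ℂ :=
    ContinuousLinearMap.comp (g : 𝓢(EuclideanSpace ℝ κ, ℂ) →L[ℂ] ℂ) (sectionCLM x)
  have hTa : ∀ Ψ, T Ψ = g (sectionCLM x Ψ) := fun Ψ => rfl
  let L : EuclideanSpace ℝ (ι ⊕ κ) →L[ℝ] ℂ := LinearMap.toContinuousLinearMap
    { toFun := fun h => T (∂_{h} Φ)
      map_add' := fun a b => by rw [LineDeriv.lineDerivOp_left_add, map_add]
      map_smul' := fun c a => by
        rw [LineDeriv.lineDerivOp_left_smul]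
        exact map_real_smul T.toLinearMap.toAddMonoidHom T.continuous c _ }
  have h1 := hasFDerivAt_apply_translation T Φ L (fun h => rfl)
  have h2 : HasFDerivAt (fun x' => inlL (κ := κ) (x' - x)) inlL x := by
    simp_rw [map_sub]
    exact (inlL (κ := κ)).hasFDerivAt.sub_const _
  have h1' : HasFDerivAt (fun h => T (Φ.compSubConstCLM ℂ (-h))) L (inlL (κ := κ) (x - x)) := by
    simpa using h1
  have h3 := h1'.comp x h2
  have hfun : (fun h => T (Φ.compSubConstCLM ℂ (-h))) ∘ (fun x' => inlL (κ := κ) (x' - x)) =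
      sliceLM g Φ := by
    ext x'
    simp only [Function.comp_apply, hTa, sliceLM, LinearMap.coe_mk, AddHom.coe_mk]
    congr 1
    ext y
    simp only [sectionCLM_apply, SchwartzMap.compSubConstCLM_apply]
    congr 1
    ext i; cases i <;> simp [inlL_apply]
  rw [hfun] at h3
  refine h3.congr_fderiv (ContinuousLinearMap.ext fun v => ?_)
  have hv : v = ∑ i, v i • EuclideanSpace.basisFun ι ℝ i :=
    ((EuclideanSpace.basisFun ι ℝ).sum_repr v).symm
  conv_lhs => rw [hv]
  simp only [map_sum, map_smul, sum_apply]
  rfl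

theorem coord_mul_sliceLM (g : 𝓢'(EuclideanSpace ℝ κ, ℂ)) (i : ι)
    (Φ : 𝓢(EuclideanSpace ℝ (ι ⊕ κ), ℂ)) (x : EuclideanSpace ℝ ι) :
    (x i : ℂ) * sliceLM g Φ x = sliceLM g (SchwartzMap.smulLeftCLM ℂ
      (fun z : EuclideanSpace ℝ (ι ⊕ κ) => ((z (Sum.inl i) : ℝ) : ℂ)) Φ) x := by
  have : sectionCLM x (SchwartzMap.smulLeftCLM ℂ
      (fun z : EuclideanSpace ℝ (ι ⊕ κ) => ((z (Sum.inl i) : ℝ) : ℂ)) Φ) =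
      (x i : ℂ) • sectionCLM x Φ := by
    ext y
    simp [SchwartzMap.smulLeftCLM_apply_apply (hasTemperateGrowth_coord (Sum.inl i))]
  simp only [sliceLM, LinearMap.coe_mk, AddHom.coe_mk, this, map_smul, smul_eq_mul]

theorem exists_bound_sliceLM (g : 𝓢'(EuclideanSpace ℝ κ, ℂ)) :
    ∃ q : Seminorm ℂ 𝓢(EuclideanSpace ℝ (ι ⊕ κ), ℂ), Continuous q ∧
      ∀ Φ x, ‖sliceLM g Φ x‖ ≤ q Φ :=
  exists_seminorm_section
    ((normSeminorm ℂ ℂ).comp (g : 𝓢(EuclideanSpace ℝ κ, ℂ) →L[ℂ] ℂ).toLinearMap)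
    (continuous_norm.comp (g : 𝓢(EuclideanSpace ℝ κ, ℂ) →L[ℂ] ℂ).continuous)

/-- For a tempered distribution `g` and a Schwartz function `Φ` on a product, the Schwartz function
`x ↦ ⟨g, Φ(x, ·)⟩`. -/
def sliceCLM (g : 𝓢'(EuclideanSpace ℝ κ, ℂ)) :
    𝓢(EuclideanSpace ℝ (ι ⊕ κ), ℂ) →L[ℂ] 𝓢(EuclideanSpace ℝ ι, ℂ) :=
  operatorCLM (sliceLM g)
    (fun i => LineDeriv.lineDerivOpCLM ℂ 𝓢(EuclideanSpace ℝ (ι ⊕ κ), ℂ)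
      (inlL (κ := κ) (EuclideanSpace.basisFun ι ℝ i)))
    (fun i => SchwartzMap.smulLeftCLM ℂ fun z => ((z (Sum.inl i) : ℝ) : ℂ))
    (hasFDerivAt_sliceLM g) (coord_mul_sliceLM g) (exists_bound_sliceLM g)

theorem sliceCLM_apply (g : 𝓢'(EuclideanSpace ℝ κ, ℂ)) (Φ : 𝓢(EuclideanSpace ℝ (ι ⊕ κ), ℂ))
    (x : EuclideanSpace ℝ ι) : sliceCLM g Φ x = g (sectionCLM x Φ) := rfl

end Product

section PartialFourier

variable {ι κ : Type*} [Fintype ι] [Fintype κ]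

/-- The partial Fourier transform `(x, ω) ↦ ∫ e^{-2πi ω·y} Φ(x, y) dy`, as a function. -/
def partialFourierLM :
    𝓢(EuclideanSpace ℝ (ι ⊕ κ), ℂ) →ₗ[ℂ] (EuclideanSpace ℝ (ι ⊕ κ) → ℂ) where
  toFun Φ z := 𝓕 (sectionCLM (fstL z) Φ) (sndL z)
  map_add' _ _ := by ext; simp [FourierTransform.fourier_add]
  map_smul' _ _ := by ext; simp [FourierTransform.fourier_smul]

theorem partialFourierLM_apply (Φ : 𝓢(EuclideanSpace ℝ (ι ⊕ κ), ℂ))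
    (z : EuclideanSpace ℝ (ι ⊕ κ)) :
    partialFourierLM Φ z = ∫ y, Real.fourierChar (-inner ℝ y (sndL z)) • Φ (join (fstL z) y) := by
  change 𝓕 (sectionCLM (fstL z) Φ) (sndL z) = _
  rw [SchwartzMap.fourier_coe, Real.fourier_eq]
  rfl

/-- The operator which the partial Fourier transform intertwines with a partial derivative. -/
def derivOp (i : ι ⊕ κ) :
    𝓢(EuclideanSpace ℝ (ι ⊕ κ), ℂ) →L[ℂ] 𝓢(EuclideanSpace ℝ (ι ⊕ κ), ℂ) :=
  Sum.elim
    (fun i => LineDeriv.lineDerivOpCLM ℂ 𝓢(EuclideanSpace ℝ (ι ⊕ κ), ℂ)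
      (inlL (κ := κ) (EuclideanSpace.basisFun ι ℝ i)))
    (fun j => (-(2 * Real.pi * Complex.I)) •
      SchwartzMap.smulLeftCLM ℂ fun z => ((z (Sum.inr j) : ℝ) : ℂ)) i

/-- The operator which the partial Fourier transform intertwines with multiplication by a
coordinate. -/
def coordOp (i : ι ⊕ κ) :
    𝓢(EuclideanSpace ℝ (ι ⊕ κ), ℂ) →L[ℂ] 𝓢(EuclideanSpace ℝ (ι ⊕ κ), ℂ) :=
  Sum.elim
    (fun i => SchwartzMap.smulLeftCLM ℂ fun z => ((z (Sum.inl i) : ℝ) : ℂ))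
    (fun j => (2 * Real.pi * Complex.I)⁻¹ •
      LineDeriv.lineDerivOpCLM ℂ 𝓢(EuclideanSpace ℝ (ι ⊕ κ), ℂ)
        (inrL (ι := ι) (EuclideanSpace.basisFun κ ℝ j))) i

theorem sectionCLM_lineDerivOp_inrL (Φ : 𝓢(EuclideanSpace ℝ (ι ⊕ κ), ℂ))
    (x : EuclideanSpace ℝ ι) (m : EuclideanSpace ℝ κ) :
    sectionCLM x (∂_{inrL (ι := ι) m} Φ) = ∂_{m} (sectionCLM x Φ) := by
  ext y
  rw [sectionCLM_apply, SchwartzMap.lineDerivOp_apply_eq_fderiv,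
    SchwartzMap.lineDerivOp_apply_eq_fderiv]
  have h : HasFDerivAt (fun y => join x y) (inrL : EuclideanSpace ℝ κ →L[ℝ] _) y := by
    simp_rw [join_eq]
    exact (inrL (ι := ι) (κ := κ)).hasFDerivAt.add_const _
  have h2 : HasFDerivAt (sectionCLM x Φ) _ y := (Φ.hasFDerivAt (join x y)).comp y h
  rw [h2.fderiv]; rfl

theorem coord_mul_partialFourierLM (i : ι ⊕ κ) (Φ : 𝓢(EuclideanSpace ℝ (ι ⊕ κ), ℂ))
    (z : EuclideanSpace ℝ (ι ⊕ κ)) :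
    (z i : ℂ) * partialFourierLM Φ z = partialFourierLM (coordOp i Φ) z := by
  cases i with
  | inl i =>
    have : sectionCLM (fstL z) (coordOp (Sum.inl i) Φ) =
        (z (Sum.inl i) : ℂ) • sectionCLM (fstL z) Φ := by
      ext y
      simp [coordOp, SchwartzMap.smulLeftCLM_apply_apply (hasTemperateGrowth_coord (Sum.inl i))]
    change _ = 𝓕 (sectionCLM (fstL z) (coordOp (Sum.inl i) Φ)) (sndL z)
    rw [this, FourierTransform.fourier_smul]; rfl
  | inr j =>
    have : sectionCLM (fstL z) (coordOp (Sum.inr j) Φ) =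
        (2 * Real.pi * Complex.I)⁻¹ • ∂_{EuclideanSpace.basisFun κ ℝ j} (sectionCLM (fstL z) Φ) := by
      rw [← sectionCLM_lineDerivOp_inrL, ← map_smul]; rfl
    change _ = 𝓕 (sectionCLM (fstL z) (coordOp (Sum.inr j) Φ)) (sndL z)
    rw [this, FourierTransform.fourier_smul, SchwartzMap.fourier_lineDerivOp_eq, smul_smul,
      inv_mul_cancel₀ Complex.two_pi_I_ne_zero, one_smul,
      SchwartzMap.smulLeftCLM_apply_apply (by fun_prop)]
    change _ = inner ℝ (sndL z) (EuclideanSpace.basisFun κ ℝ j) • partialFourierLM Φ z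
    rw [real_inner_comm, EuclideanSpace.basisFun_inner, Complex.real_smul]; rfl

theorem exists_bound_partialFourierLM :
    ∃ q : Seminorm ℂ 𝓢(EuclideanSpace ℝ (ι ⊕ κ), ℂ), Continuous q ∧
      ∀ Φ (z : EuclideanSpace ℝ (ι ⊕ κ)), ‖partialFourierLM Φ z‖ ≤ q Φ := by
  obtain ⟨q, hq, h⟩ := exists_seminorm_section (ι := ι) (κ := κ)
    ((schwartzSeminormFamily ℂ (EuclideanSpace ℝ κ) ℂ (0, 0)).comp
      (FourierTransform.fourierCLM ℂ 𝓢(EuclideanSpace ℝ κ, ℂ)).toLinearMap)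
    (((schwartz_withSeminorms ℂ (EuclideanSpace ℝ κ) ℂ).continuous_seminorm (0, 0)).comp
      (FourierTransform.fourierCLM ℂ 𝓢(EuclideanSpace ℝ κ, ℂ)).continuous)
  exact ⟨q, hq, fun Φ z => (SchwartzMap.norm_le_seminorm ℂ _ (sndL z)).trans (h Φ (fstL z))⟩

/-- Uniform integrable bound on the sections of a Schwartz function. -/
theorem exists_section_bound (Φ : 𝓢(EuclideanSpace ℝ (ι ⊕ κ), ℂ)) :
    ∃ b : EuclideanSpace ℝ κ → ℝ, Integrable b ∧
      ∀ (x : EuclideanSpace ℝ ι) y, ‖Φ (join x y)‖ ≤ b y := by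
  let N := (volume : Measure (EuclideanSpace ℝ κ)).integrablePower
  let C := 2 ^ N * ((Finset.Iic (N, 0)).sup fun m => SchwartzMap.seminorm ℂ m.1 m.2) Φ
  refine ⟨fun y => (1 + ‖y‖) ^ (-(N : ℝ)) * C,
    (Measure.integrable_pow_neg_integrablePower volume).mul_const C, fun x y => ?_⟩
  have h := SchwartzMap.one_add_le_sup_seminorm_apply (𝕜 := ℂ) (m := (N, 0)) (k := N) (n := 0)
    le_rfl le_rfl Φ (join x y)
  rw [norm_iteratedFDeriv_zero] at h
  change _ ≤ (1 + ‖y‖) ^ (-(N : ℝ)) * C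
  rw [Real.rpow_neg (by positivity), Real.rpow_natCast, ← div_eq_inv_mul,
    le_div_iff₀ (by positivity), mul_comm]
  refine le_trans ?_ h
  gcongr
  exact norm_snd_le x y

theorem sum_proj_smulRight_apply (c : ι → ℂ) (v : EuclideanSpace ℝ ι) :
    (∑ i, (EuclideanSpace.proj i : EuclideanSpace ℝ ι →L[ℝ] ℝ).smulRight (c i)) v =
      ∑ i, v i • c i := by
  rw [sum_apply]; rfl

theorem hasFDerivAt_integrand (Φ : 𝓢(EuclideanSpace ℝ (ι ⊕ κ), ℂ)) (y : EuclideanSpace ℝ κ)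
    (z : EuclideanSpace ℝ (ι ⊕ κ)) :
    HasFDerivAt (fun z => Real.fourierChar (-inner ℝ y (sndL z)) • Φ (join (fstL z) y))
      (∑ i, (EuclideanSpace.proj i : EuclideanSpace ℝ (ι ⊕ κ) →L[ℝ] ℝ).smulRight
        (Real.fourierChar (-inner ℝ y (sndL z)) • derivOp i Φ (join (fstL z) y))) z := by
  have h1 : HasFDerivAt (fun z : EuclideanSpace ℝ (ι ⊕ κ) => join (fstL z) y)
      ((inlL (κ := κ)).comp fstL) z := by
    simp_rw [join_eq]
    exact ((inlL (κ := κ)).comp (fstL (ι := ι))).hasFDerivAt.const_add _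
  have h2 := (Φ.hasFDerivAt (join (fstL z) y)).comp z h1
  let l : EuclideanSpace ℝ (ι ⊕ κ) →L[ℝ] ℝ := (innerSL ℝ y).comp sndL
  have h3 : HasFDerivAt (fun z => Complex.exp (-(2 * Real.pi * Complex.I) * (l z : ℂ)))
      (Complex.exp (-(2 * Real.pi * Complex.I) * (l z : ℂ)) •
        ((-(2 * Real.pi * Complex.I)) • Complex.ofRealCLM.comp l)) z :=
    ((Complex.ofRealCLM.comp l).hasFDerivAt.const_mul _).cexp
  have hc : ∀ z, ((Real.fourierChar (-inner ℝ y (sndL z)) : Circle) : ℂ) =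
      Complex.exp (-(2 * Real.pi * Complex.I) * (l z : ℂ)) := fun z => by
    rw [Real.fourierChar_apply]
    congr 1
    simp only [l, ContinuousLinearMap.comp_apply, innerSL_apply_apply]
    push_cast; ring
  have h4 := h3.mul h2
  simp_rw [Circle.smul_def, hc]
  refine h4.congr_fderiv (ContinuousLinearMap.ext fun v => ?_)
  have hv : fstL v = ∑ i, v (Sum.inl i) • EuclideanSpace.basisFun ι ℝ i :=
    ((EuclideanSpace.basisFun ι ℝ).sum_repr (fstL v)).symm
  have hl : l v = ∑ j, v (Sum.inr j) * y j := by
    simp [l, PiLp.inner_apply]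
  have hi : ∀ i, derivOp (κ := κ) (Sum.inl i) Φ (join (fstL z) y) =
      fderiv ℝ Φ (join (fstL z) y) (inlL (κ := κ) (EuclideanSpace.basisFun ι ℝ i)) := fun i =>
    SchwartzMap.lineDerivOp_apply_eq_fderiv _ Φ _
  have hj : ∀ j, derivOp (ι := ι) (Sum.inr j) Φ (join (fstL z) y) =
      -(2 * Real.pi * Complex.I) * ((y j : ℂ) * Φ (join (fstL z) y)) := fun j => by
    simp [derivOp, SchwartzMap.smulLeftCLM_apply_apply (hasTemperateGrowth_coord (Sum.inr j))]
  rw [sum_proj_smulRight_apply]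
  simp only [Fintype.sum_sum_type, hi, hj]
  simp only [add_apply, smul_apply,
    ContinuousLinearMap.comp_apply, Complex.ofRealCLM_apply, hv, hl, map_sum, map_smul,
    Function.comp_apply]
  push_cast
  simp only [smul_eq_mul, Complex.real_smul, Finset.mul_sum]
  congr 1
  · exact Finset.sum_congr rfl fun i _ => by ring
  · exact Finset.sum_congr rfl fun i _ => by ring

theorem hasFDerivAt_partialFourierLM (Φ : 𝓢(EuclideanSpace ℝ (ι ⊕ κ), ℂ))
    (z : EuclideanSpace ℝ (ι ⊕ κ)) :
    HasFDerivAt (partialFourierLM Φ)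
      (∑ i, (EuclideanSpace.proj i : EuclideanSpace ℝ (ι ⊕ κ) →L[ℝ] ℝ).smulRight
        (partialFourierLM (derivOp i Φ) z)) z := by
  let R : ι ⊕ κ → (ℂ →L[ℝ] (EuclideanSpace ℝ (ι ⊕ κ) →L[ℝ] ℂ)) := fun i =>
      ContinuousLinearMap.smulRightL ℝ (EuclideanSpace ℝ (ι ⊕ κ)) ℂ (EuclideanSpace.proj i)
  have hint : ∀ (Ψ : 𝓢(EuclideanSpace ℝ (ι ⊕ κ), ℂ)) (z : EuclideanSpace ℝ (ι ⊕ κ)),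
      Integrable fun y => Real.fourierChar (-inner ℝ y (sndL z)) • Ψ (join (fstL z) y) :=
    fun Ψ z => (Real.fourierIntegral_convergent_iff (sndL z)).2 (sectionCLM (fstL z) Ψ).integrable
  choose b hb hΨ using fun i : ι ⊕ κ => exists_section_bound (derivOp i Φ)
  have h := hasFDerivAt_integral_of_dominated_of_fderiv_le (𝕜 := ℝ) (μ := volume) (x₀ := z)
    (s := Set.univ)
    (F := fun z y => Real.fourierChar (-inner ℝ y (sndL z)) • Φ (join (fstL z) y))
    (F' := fun z y => ∑ i, R i (Real.fourierChar (-inner ℝ y (sndL z)) •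
      derivOp i Φ (join (fstL z) y)))
    (bound := fun y => ∑ i, ‖R i‖ * b i y) Filter.univ_mem
    (Filter.Eventually.of_forall fun z => (hint Φ z).aestronglyMeasurable) (hint Φ z)
    (integrable_finsetSum _ fun i _ => (R i).integrable_comp (hint _ z)).aestronglyMeasurable
    (Filter.Eventually.of_forall fun y z _ => by
      refine (norm_sum_le _ _).trans (Finset.sum_le_sum fun i _ => ?_)
      refine ((R i).le_opNorm _).trans ?_
      rw [Circle.norm_smul]
      gcongr
      exact hΨ i _ y)
    (integrable_finsetSum _ fun i _ => (hb i).const_mul _)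
    (Filter.Eventually.of_forall fun y z _ => hasFDerivAt_integrand Φ y z)
  have e1 : (fun z => ∫ y, Real.fourierChar (-inner ℝ y (sndL z)) • Φ (join (fstL z) y)) =
      partialFourierLM Φ := funext fun z => (partialFourierLM_apply Φ z).symm
  rw [e1] at h
  refine h.congr_fderiv ?_
  rw [integral_finsetSum _ fun i _ => (R i).integrable_comp (hint _ z)]
  refine Finset.sum_congr rfl fun i _ => ?_
  rw [ContinuousLinearMap.integral_comp_comm _ (hint _ z), ← partialFourierLM_apply]
  rfl

/-- The partial Fourier transform `𝓕₂Φ(x, ω) = ∫ e^{-2πi ω·y} Φ(x, y) dy` on the Schwartz space of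
a product. -/
def partialFourierCLM :
    𝓢(EuclideanSpace ℝ (ι ⊕ κ), ℂ) →L[ℂ] 𝓢(EuclideanSpace ℝ (ι ⊕ κ), ℂ) :=
  operatorCLM partialFourierLM derivOp coordOp hasFDerivAt_partialFourierLM
    coord_mul_partialFourierLM exists_bound_partialFourierLM

theorem partialFourierCLM_apply (Φ : 𝓢(EuclideanSpace ℝ (ι ⊕ κ), ℂ)) (x : EuclideanSpace ℝ ι)
    (ω : EuclideanSpace ℝ κ) :
    partialFourierCLM Φ (join x ω) =
      ∫ y, Real.fourierChar (-inner ℝ y ω) • Φ (join x y) :=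
  partialFourierLM_apply Φ (join x ω)

end PartialFourier

section TempDist

variable {ι κ : Type*} [Fintype ι] [Fintype κ]

/-- The complex conjugate of a Schwartz function. -/
def conjSchwartz : 𝓢(EuclideanSpace ℝ ι, ℂ) →L[ℝ] 𝓢(EuclideanSpace ℝ ι, ℂ) :=
  SchwartzMap.postcompCLM (Complex.conjCLE : ℂ →L[ℝ] ℂ)

@[simp] theorem conjSchwartz_apply (φ : 𝓢(EuclideanSpace ℝ ι, ℂ)) (t : EuclideanSpace ℝ ι) :
    conjSchwartz φ t = starRingEnd ℂ (φ t) := rfl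

/-- The complex conjugate `φ ↦ conj (g (conj φ))` of a tempered distribution `g`. Mathlib's tempered
distributions act linearly on test functions: `g φ` is `⟨g, conj φ⟩` for the sesquilinear
bracket. -/
def conjDist (g : 𝓢'(EuclideanSpace ℝ ι, ℂ)) : 𝓢'(EuclideanSpace ℝ ι, ℂ) :=
  ({ toFun := fun φ => starRingEnd ℂ (g (conjSchwartz φ))
     map_add' := fun φ ψ => by simp
     map_smul' := fun c φ => by
       have : conjSchwartz (c • φ) = starRingEnd ℂ c • conjSchwartz φ := by ext t; simp
       rw [this, map_smul]; simp
     cont := Complex.continuous_conj.comp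
       ((g : 𝓢(EuclideanSpace ℝ ι, ℂ) →L[ℂ] ℂ).continuous.comp conjSchwartz.continuous) } :
    𝓢(EuclideanSpace ℝ ι, ℂ) →L[ℂ] ℂ)

@[simp] theorem conjDist_apply (g : 𝓢'(EuclideanSpace ℝ ι, ℂ)) (φ : 𝓢(EuclideanSpace ℝ ι, ℂ)) :
    conjDist g φ = starRingEnd ℂ (g (conjSchwartz φ)) := rfl

/-- The tensor product of tempered distributions: `(f ⊗ g)(Φ) = f (x ↦ g (Φ(x, ·)))`. -/
def tensorDist (f : 𝓢'(EuclideanSpace ℝ ι, ℂ)) (g : 𝓢'(EuclideanSpace ℝ κ, ℂ)) :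
    𝓢'(EuclideanSpace ℝ (ι ⊕ κ), ℂ) :=
  PointwiseConvergenceCLM.precomp ℂ (sliceCLM g) f

@[simp] theorem tensorDist_apply (f : 𝓢'(EuclideanSpace ℝ ι, ℂ)) (g : 𝓢'(EuclideanSpace ℝ κ, ℂ))
    (Φ : 𝓢(EuclideanSpace ℝ (ι ⊕ κ), ℂ)) : tensorDist f g Φ = f (sliceCLM g Φ) := rfl

/-- The partial Fourier transform `𝓕₂` in the second variable of a tempered distribution. -/
def partialFourierDist (F : 𝓢'(EuclideanSpace ℝ (ι ⊕ κ), ℂ)) :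
    𝓢'(EuclideanSpace ℝ (ι ⊕ κ), ℂ) :=
  PointwiseConvergenceCLM.precomp ℂ partialFourierCLM F

@[simp] theorem partialFourierDist_apply (F : 𝓢'(EuclideanSpace ℝ (ι ⊕ κ), ℂ))
    (Φ : 𝓢(EuclideanSpace ℝ (ι ⊕ κ), ℂ)) :
    partialFourierDist F Φ = F (partialFourierCLM Φ) := rfl

/-- An invertible matrix as a linear automorphism `z ↦ A z` of Euclidean space. -/
def glEquiv [DecidableEq ι] (A : GL ι ℝ) : EuclideanSpace ℝ ι ≃L[ℝ] EuclideanSpace ℝ ι :=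
  ContinuousLinearEquiv.unitsEquiv ℝ (EuclideanSpace ℝ ι)
    (Units.map (Matrix.toEuclideanCLM (𝕜 := ℝ) (n := ι) :
      Matrix ι ι ℝ →* (EuclideanSpace ℝ ι →L[ℝ] EuclideanSpace ℝ ι)) A)

@[simp] theorem glEquiv_apply [DecidableEq ι] (A : GL ι ℝ) (z : EuclideanSpace ℝ ι) :
    glEquiv A z = WithLp.toLp 2 ((A : Matrix ι ι ℝ).mulVec z) := rfl

/-- The coordinate transformation `F ↦ F(A ·)` of a tempered distribution:
`(𝔗_A F)(Φ) = |det A|⁻¹ F(Φ(A⁻¹ ·))`. -/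
def coordTransform [DecidableEq ι] (A : GL ι ℝ) (F : 𝓢'(EuclideanSpace ℝ ι, ℂ)) :
    𝓢'(EuclideanSpace ℝ ι, ℂ) :=
  ((|(A : Matrix ι ι ℝ).det|⁻¹ : ℝ) : ℂ) •
    PointwiseConvergenceCLM.precomp ℂ
      (SchwartzMap.compCLMOfContinuousLinearEquiv ℂ (glEquiv A⁻¹)) F

/-- The matrix-Wigner distribution `𝓑_A(f, g) = 𝓕₂ 𝔗_A (f ⊗ conj g)` of two tempered
distributions. -/
def matrixWigner [DecidableEq ι] (A : GL (ι ⊕ ι) ℝ) (f g : 𝓢'(EuclideanSpace ℝ ι, ℂ)) :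
    𝓢'(EuclideanSpace ℝ (ι ⊕ ι), ℂ) :=
  partialFourierDist (coordTransform A (tensorDist f (conjDist g)))

/-- The Cohen-type matrix `A_M` with blocks `I, M + I/2; I, M - I/2`, with its inverse. -/
def cohenMatrix [DecidableEq ι] (M : Matrix ι ι ℝ) : GL (ι ⊕ ι) ℝ where
  val := Matrix.fromBlocks 1 (M + (1 / 2 : ℝ) • 1) 1 (M - (1 / 2 : ℝ) • 1)
  inv := Matrix.fromBlocks (-(M - (1 / 2 : ℝ) • 1)) (M + (1 / 2 : ℝ) • 1) 1 (-1)
  val_inv := by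
    have h : ((1 / 2 : ℝ) • (1 : Matrix ι ι ℝ)) + (1 / 2 : ℝ) • 1 = 1 := by
      rw [← add_smul]; norm_num
    generalize (1 / 2 : ℝ) • (1 : Matrix ι ι ℝ) = c at h ⊢
    rw [Matrix.fromBlocks_multiply, ← Matrix.fromBlocks_one]
    congr 1
    · have : 1 * -(M - c) + (M + c) * 1 = c + c := by noncomm_ring
      rw [this, h]
    · simp
    · simp
    · have : 1 * (M + c) + (M - c) * -1 = c + c := by noncomm_ring
      rw [this, h]
  inv_val := by
    have h : ((1 / 2 : ℝ) • (1 : Matrix ι ι ℝ)) + (1 / 2 : ℝ) • 1 = 1 := by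
      rw [← add_smul]; norm_num
    have hc : ((1 / 2 : ℝ) • (1 : Matrix ι ι ℝ)) * M = M * ((1 / 2 : ℝ) • 1) := by simp
    generalize (1 / 2 : ℝ) • (1 : Matrix ι ι ℝ) = c at h hc ⊢
    rw [Matrix.fromBlocks_multiply, ← Matrix.fromBlocks_one]
    congr 1
    · have : -(M - c) * 1 + (M + c) * 1 = c + c := by noncomm_ring
      rw [this, h]
    · have : -(M - c) * (M + c) + (M + c) * (M - c) = 2 • (c * M) - 2 • (M * c) := by noncomm_ring
      rw [this, hc, sub_self]
    · simp
    · have : 1 * (M + c) + -1 * (M - c) = c + c := by noncomm_ring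
      rw [this, h]

end TempDist

section TimeFrequency

variable {ι : Type*} [Fintype ι]

theorem hasTemperateGrowth_char (ω : EuclideanSpace ℝ ι) :
    (fun t : EuclideanSpace ℝ ι =>
      ((Real.fourierChar (inner ℝ ω t) : Circle) : ℂ)).HasTemperateGrowth := by
  let e : ℝ → ℂ := fun r => Complex.exp ((2 * Real.pi * Complex.I) * (r : ℂ))
  have he : e.HasTemperateGrowth := by
    have hs : ContDiff ℝ (⊤ : ℕ∞) e :=
      (contDiff_const.mul Complex.ofRealCLM.contDiff).cexp
    refine ⟨hs, fun n => ⟨0, (2 * Real.pi) ^ n, fun r => ?_⟩⟩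
    have hd : ∀ n, iteratedDeriv n e = fun r => (2 * Real.pi * Complex.I) ^ n * e r := by
      intro n
      induction n with
      | zero => simp
      | succ n ih =>
        rw [iteratedDeriv_succ, ih]
        ext r
        have h1 : HasDerivAt e (e r * (2 * Real.pi * Complex.I)) r := by
          have := ((Complex.ofRealCLM.hasDerivAt (x := r)).const_mul
            (2 * Real.pi * Complex.I)).cexp
          simpa using this
        rw [(h1.const_mul _).deriv]; ring
    rw [norm_iteratedFDeriv_eq_norm_iteratedDeriv, hd]
    have h2 : ‖e r‖ = 1 := by
      have : (2 * Real.pi * Complex.I) * (r : ℂ) = ((2 * Real.pi * r : ℝ) : ℂ) * Complex.I := by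
        push_cast; ring
      simp only [e, this, Complex.norm_exp_ofReal_mul_I]
    simp [h2, abs_of_pos Real.pi_pos]
  have h3 : (fun t : EuclideanSpace ℝ ι => ((Real.fourierChar (inner ℝ ω t) : Circle) : ℂ)) =
      e ∘ fun t => inner ℝ ω t := by
    ext t
    simp only [Function.comp_apply, e, Real.fourierChar_apply]
    congr 1; push_cast; ring
  rw [h3]
  exact he.comp (Function.hasTemperateGrowth_inner_right ω)

/-- The time-frequency shift `π(x, ω) g = M_ω T_x g`, i.e. `t ↦ e^{2πi ω·t} g(t - x)`, of a Schwartz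
function. -/
def tfShift (x ω : EuclideanSpace ℝ ι) (g : 𝓢(EuclideanSpace ℝ ι, ℂ)) :
    𝓢(EuclideanSpace ℝ ι, ℂ) :=
  SchwartzMap.smulLeftCLM ℂ (fun t => ((Real.fourierChar (inner ℝ ω t) : Circle) : ℂ))
    (SchwartzMap.compSubConstCLM ℂ x g)

theorem tfShift_apply (x ω : EuclideanSpace ℝ ι) (g : 𝓢(EuclideanSpace ℝ ι, ℂ))
    (t : EuclideanSpace ℝ ι) :
    tfShift x ω g t = ((Real.fourierChar (inner ℝ ω t) : Circle) : ℂ) * g (t - x) := by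
  simp [tfShift, SchwartzMap.smulLeftCLM_apply_apply (hasTemperateGrowth_char ω)]

/-- The short-time Fourier transform `V_g f(x, ω) = ⟨f, π(x, ω) g⟩` of a tempered distribution `f`
with window `g`. -/
def stft (g : 𝓢(EuclideanSpace ℝ ι, ℂ)) (f : 𝓢'(EuclideanSpace ℝ ι, ℂ))
    (x ω : EuclideanSpace ℝ ι) : ℂ :=
  f (conjSchwartz (tfShift x ω g))

/-- The norm of the modulation space `M^{p,q}_m(ℝ^ι)`, measured with the window `g`. -/
def modulationNorm (g : 𝓢(EuclideanSpace ℝ ι, ℂ)) (p q : ℝ) (m : EuclideanSpace ℝ (ι ⊕ ι) → ℝ)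
    (f : 𝓢'(EuclideanSpace ℝ ι, ℂ)) : ℝ≥0∞ :=
  (∫⁻ ω, (∫⁻ x, ‖stft g f x ω‖ₑ ^ p * ENNReal.ofReal (m (join x ω)) ^ p) ^ (q / p)) ^ (1 / q)

/-- Membership in the modulation space `M^{p,q}_m(ℝ^ι)`, with the window `g`. -/
def MemModulation (g : 𝓢(EuclideanSpace ℝ ι, ℂ)) (p q : ℝ) (m : EuclideanSpace ℝ (ι ⊕ ι) → ℝ)
    (f : 𝓢'(EuclideanSpace ℝ ι, ℂ)) : Prop :=
  modulationNorm g p q m f < ∞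

/-- The norm of the Wiener amalgam space `W(𝓕L^p_u, L^q_w)(ℝ^ι)`, measured with the window `g`. -/
def amalgamNorm (g : 𝓢(EuclideanSpace ℝ ι, ℂ)) (p q : ℝ) (u w : EuclideanSpace ℝ ι → ℝ)
    (f : 𝓢'(EuclideanSpace ℝ ι, ℂ)) : ℝ≥0∞ :=
  (∫⁻ x, (∫⁻ ω, ‖stft g f x ω‖ₑ ^ p * ENNReal.ofReal (u ω) ^ p) ^ (q / p)
    * ENNReal.ofReal (w x) ^ q) ^ (1 / q)

/-- Membership in the Wiener amalgam space `W(𝓕L^p_u, L^q_w)(ℝ^ι)`, with the window `g`. -/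
def MemAmalgam (g : 𝓢(EuclideanSpace ℝ ι, ℂ)) (p q : ℝ) (u w : EuclideanSpace ℝ ι → ℝ)
    (f : 𝓢'(EuclideanSpace ℝ ι, ℂ)) : Prop :=
  amalgamNorm g p q u w f < ∞

/-- The polynomial weight `v_s(z) = (1 + |z|²)^{s/2}`. -/
def polyWeight (s : ℝ) (z : EuclideanSpace ℝ ι) : ℝ := (1 + ‖z‖ ^ 2) ^ (s / 2)

/-- The tensor product `(u ⊗ w)(x, y) = u(x) w(y)` of two weights. -/
def tensorWeight (u w : EuclideanSpace ℝ ι → ℝ) (z : EuclideanSpace ℝ (ι ⊕ ι)) : ℝ :=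
  u (fstL z) * w (sndL z)

variable [DecidableEq ι]

/-- The block matrix `P_M = diag(-(M + I/2), M - I/2)`. -/
def matrixP (M : Matrix ι ι ℝ) : Matrix (ι ⊕ ι) (ι ⊕ ι) ℝ :=
  Matrix.fromBlocks (-(M + (1 / 2 : ℝ) • 1)) 0 0 (M - (1 / 2 : ℝ) • 1)

/-- The weight `v_s^M = v_s ∘ (I + P_M⁻¹)⁻¹`. -/
def polyWeightM (s : ℝ) (M : Matrix ι ι ℝ) (z : EuclideanSpace ℝ (ι ⊕ ι)) : ℝ :=
  polyWeight s (Matrix.toEuclideanCLM (𝕜 := ℝ) ((1 + (matrixP M)⁻¹)⁻¹) z)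

/-- The constant `C_M = |det(M + I/2) det(M - I/2)|`. -/
def constC (M : Matrix ι ι ℝ) : ℝ :=
  |(M + (1 / 2 : ℝ) • 1).det * (M - (1 / 2 : ℝ) • 1).det|

/-- A `2 × 2` block matrix is right-regular if the two blocks of its second column are
invertible. -/
def IsRightRegular (A : Matrix (ι ⊕ ι) (ι ⊕ ι) ℝ) : Prop :=
  IsUnit A.toBlocks₁₂ ∧ IsUnit A.toBlocks₂₂

end TimeFrequency

end

end MWD

/-! Everything rests on one identity. Choose the window `wignerWindow M g₁ g₂` so that the partial
Fourier transform of its conjugate is `(conj g₁ ⊗ g₂) ∘ A_M`. Moving `𝓕₂` and the coordinate change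
onto a time-frequency shift of this window produces, up to a unimodular factor, a tensor product of
time-frequency shifts of `g₁` and `g₂`. With `a = x - (M + I/2)η` and `b = ω - (M - I/2)ᵀξ`, this
gives (`norm_stft_matrixWigner`) |V 𝓑(f₁, f₂)((x, ω), (ξ, η))| = |det A_M|⁻¹ |V_{g₁}f₁(a, b)|
|V_{g₂}f₂(a + η, b - ξ)|.

For the modulation norm, `(ξ, η)` is fixed and the `p`-th power is integrated over `(x, ω)`.
Translation invariance removes the dependence on `M`, leaving the correlation of `|V_{g₁}f₁|^p` and
`|V_{g₂}f₂|^p` at `(η, -ξ)`. Its `L^{q/p}` norm is controlled by Young's inequality in mixed norms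
(`mixedNorm_translate_le`). For the amalgam norm, `(x, ω)` is fixed and the integral runs over `(ξ,
η)`. When `M ± I/2` are invertible, `(a, b)` can serve as the integration variable, and `(a + η, b -
ξ)` is an invertible linear image of a translate of `(a, b)`. The same correlation estimate then
applies (`exists_mixedNorm_shear_le`). In both cases the weights are distributed over the factors by
Peetre's inequality.

Young's inequality applies directly only if `p ≤ q` and the exponents satisfy an exact relation
`1/P₁ + 1/P₂ = 1/p + 1/q`. The general case follows from inclusions: `p` is replaced by `min p q`,
and `pᵢ`, `qᵢ` are raised to admissible `Pᵢ`, `Qᵢ` (`exists_youngExponents`). Inclusions and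
independence of the window are one statement, `exists_modulationNorm_le` and
`exists_amalgamNorm_le`: a change of window dominates one short-time Fourier transform by the
correlation of another with a Schwartz function, and Young's inequality may raise exponents at the
same time.

That domination comes from the reproducing formula for tempered distributions (`reproducing`), which
requires a distribution to commute with an integral of Schwartz functions (`distribution_integral`).
For this the distribution is factored, by Hahn–Banach, through a Banach space of bounded functions,
where Bochner integration is available.

In the amalgam estimate, `v_s^M` is equivalent to `v_s`, and the power of `C_M` is a positive
constant depending only on `M`, `p` and `q`, so both are absorbed into the constant. -/

namespace MWD

/-! ### Minkowski's and Young's inequalities in mixed Lebesgue norms -/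

section MixedNorm

/-- Minkowski's integral inequality. -/
theorem lintegral_rpow_lintegral_le {X Y : Type*} [MeasurableSpace X] [MeasurableSpace Y]
    {μ : Measure X} {ν : Measure Y} [SigmaFinite μ] [SFinite ν] {p : ℝ} (hp : 1 ≤ p)
    {h : X → Y → ℝ≥0∞} (hh : Measurable (Function.uncurry h)) :
    (∫⁻ x, (∫⁻ y, h x y ∂ν) ^ p ∂μ) ^ (1 / p) ≤ ∫⁻ y, (∫⁻ x, h x y ^ p ∂μ) ^ (1 / p) ∂ν := by
  rcases hp.eq_or_lt with rfl | hp1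
  · simp only [ENNReal.rpow_one, div_one]
    exact (lintegral_lintegral_swap hh.aemeasurable).le
  have hp0 : 0 < p := by linarith
  have hc : p.HolderConjugate (p.conjExponent) := Real.HolderConjugate.conjExponent hp1
  set S : X → ℝ≥0∞ := fun x => ∫⁻ y, h x y ∂ν with hS
  have hSm : Measurable S := hh.lintegral_prod_right
  set R := ∫⁻ y, (∫⁻ x, h x y ^ p ∂μ) ^ (1 / p) ∂ν with hR
  -- The truncations are bounded and supported in sets of finite measure, so the integrals of their
  -- `p`-th powers are finite and may be cancelled below. Monotone convergence recovers `S`.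
  let T : ℕ → X → ℝ≥0∞ := fun n => (spanningSets μ n).indicator fun x => min (S x) n
  have hTm : ∀ n, Measurable (T n) := fun n =>
    (hSm.min measurable_const).indicator (measurableSet_spanningSets μ n)
  have hTS : ∀ n x, T n x ≤ S x := fun n x =>
    Set.indicator_le' (fun _ _ => min_le_left _ _) (fun _ _ => zero_le) x
  have hmono : Monotone T := by
    intro m n hmn x
    by_cases hx : x ∈ spanningSets μ m
    · simp only [T, Set.indicator_of_mem hx, Set.indicator_of_mem (monotone_spanningSets μ hmn hx)]
      exact min_le_min le_rfl (by exact_mod_cast hmn)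
    · simp [T, Set.indicator_of_notMem hx]
  have hsup : ∀ x, ⨆ n, T n x = S x := by
    intro x
    refine le_antisymm (iSup_le fun n => hTS n x) ?_
    refine le_of_forall_lt fun c hcS => ?_
    obtain ⟨n, hn⟩ := ENNReal.exists_nat_gt (ne_top_of_lt hcS)
    have hmem : x ∈ ⋃ n, spanningSets μ n := by rw [iUnion_spanningSets]; trivial
    obtain ⟨m, hm⟩ := Set.mem_iUnion.1 hmem
    refine lt_of_lt_of_le ?_ (le_iSup _ (max m n))
    simp only [T, Set.indicator_of_mem (monotone_spanningSets μ (le_max_left m n) hm)]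
    refine lt_min hcS (hn.trans_le ?_)
    exact_mod_cast le_max_right m n
  have hfin : ∀ n, ∫⁻ x, T n x ^ p ∂μ ≠ ∞ := by
    intro n
    have : ∀ x, T n x ^ p ≤ (spanningSets μ n).indicator (fun _ => (n : ℝ≥0∞) ^ p) x := by
      intro x
      by_cases hx : x ∈ spanningSets μ n
      · simp only [T, Set.indicator_of_mem hx]
        exact ENNReal.rpow_le_rpow (min_le_right _ _) hp0.le
      · simp [T, Set.indicator_of_notMem hx, hp0]
    refine ((lintegral_mono this).trans_lt ?_).ne
    rw [lintegral_indicator (measurableSet_spanningSets μ n), setLIntegral_const]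
    exact ENNReal.mul_lt_top (ENNReal.rpow_lt_top_of_nonneg hp0.le (by simp))
      (measure_spanningSets_lt_top μ n)
  have hle : ∀ n, (∫⁻ x, T n x ^ p ∂μ) ^ (1 / p) ≤ R := by
    intro n
    set I := ∫⁻ x, T n x ^ p ∂μ with hI
    -- Duality argument: one factor `T` of `T ^ p` is enlarged to `S`, the integrals are swapped,
    -- and Hölder is applied to `h` against `T ^ (p - 1)`, whose conjugate power is again `T ^ p`.
    have h1 : I ≤ R * I ^ (1 / p.conjExponent) := by
      calc I ≤ ∫⁻ x, S x * T n x ^ (p - 1) ∂μ := by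
            refine lintegral_mono fun x => ?_
            calc T n x ^ p = T n x ^ (1 + (p - 1)) := by ring_nf
              _ = T n x * T n x ^ (p - 1) := by
                rw [ENNReal.rpow_add_of_nonneg _ _ zero_le_one (by linarith), ENNReal.rpow_one]
              _ ≤ _ := by gcongr; exact hTS n x
        _ = ∫⁻ x, ∫⁻ y, h x y * T n x ^ (p - 1) ∂ν ∂μ := by
            refine lintegral_congr fun x => ?_
            exact (lintegral_mul_const _ (hh.comp (measurable_const.prodMk measurable_id))).symm
        _ = ∫⁻ y, ∫⁻ x, h x y * T n x ^ (p - 1) ∂μ ∂ν := by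
            refine lintegral_lintegral_swap (Measurable.aemeasurable ?_)
            exact hh.mul (((hTm n).comp measurable_fst).pow_const _)
        _ ≤ ∫⁻ y, (∫⁻ x, h x y ^ p ∂μ) ^ (1 / p) * I ^ (1 / p.conjExponent) ∂ν := by
            refine lintegral_mono fun y => ?_
            refine (ENNReal.lintegral_mul_le_Lp_mul_Lq μ hc
              (hh.comp (measurable_id.prodMk measurable_const)).aemeasurable
              ((hTm n).pow_const _).aemeasurable).trans (le_of_eq ?_)
            congr 2
            refine lintegral_congr fun x => ?_
            rw [← ENNReal.rpow_mul, mul_comm, mul_comm, hc.sub_one_mul_conj]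
        _ = R * I ^ (1 / p.conjExponent) := by
            rw [lintegral_mul_const]
            exact ((hh.pow_const p).lintegral_prod_left' ).pow_const _
    rcases eq_or_ne I 0 with h0 | h0
    · rw [h0, ENNReal.zero_rpow_of_pos (by positivity)]; exact zero_le
    have hI' : I = I ^ (1 / p) * I ^ (1 / p.conjExponent) := by
      rw [← ENNReal.rpow_add _ _ h0 (hfin n)]
      have := hc.inv_add_inv_eq_one
      rw [one_div, one_div, this, ENNReal.rpow_one]
    refine (ENNReal.mul_le_mul_iff_left (c := I ^ (1 / p.conjExponent)) ?_ ?_).1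
      (hI'.symm.trans_le h1)
    · exact (ENNReal.rpow_pos (pos_iff_ne_zero.2 h0) (hfin n)).ne'
    · exact ENNReal.rpow_ne_top_of_nonneg (one_div_nonneg.2 hc.symm.nonneg) (hfin n)
  have h2 : ∫⁻ x, S x ^ p ∂μ = ⨆ n, ∫⁻ x, T n x ^ p ∂μ := by
    rw [← lintegral_iSup (fun n => (hTm n).pow_const p)
      (fun m n hmn x => ENNReal.rpow_le_rpow (hmono hmn x) hp0.le)]
    refine lintegral_congr fun x => ?_
    rw [← hsup x]
    exact (ENNReal.orderIsoRpow p hp0).map_iSup _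
  rw [h2, show (⨆ n, ∫⁻ x, T n x ^ p ∂μ) ^ (1 / p) = ⨆ n, (∫⁻ x, T n x ^ p ∂μ) ^ (1 / p) from
    (ENNReal.orderIsoRpow (1 / p) (by positivity)).map_iSup _]
  exact iSup_le hle

variable {X Y : Type*} [MeasureSpace X] [MeasureSpace Y]

section Young

variable [AddCommGroup X] [MeasurableAdd₂ X] [SFinite (volume : Measure X)]
  [(volume : Measure X).IsAddLeftInvariant]

/-- Young's inequality for the correlation of two nonnegative functions. -/
theorem lintegral_correlation_rpow_le {a b r : ℝ} (ha : 1 ≤ a) (hb : 1 ≤ b) (hr : 1 ≤ r)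
    (h : 1 / a + 1 / b = 1 + 1 / r) {F G : X → ℝ≥0∞} (hF : Measurable F) (hG : Measurable G) :
    (∫⁻ w, (∫⁻ z, F z * G (z + w)) ^ r) ^ (1 / r) ≤
      (∫⁻ z, F z ^ a) ^ (1 / a) * (∫⁻ z, G z ^ b) ^ (1 / b) := by
  have ha0 : 0 < a := by linarith
  have hb0 : 0 < b := by linarith
  have hr0 : 0 < r := by linarith
  have ha1 : 1 / a ≤ 1 := by rw [div_le_one ha0]; exact ha
  have hb1 : 1 / b ≤ 1 := by rw [div_le_one hb0]; exact hb
  set A := ∫⁻ z, F z ^ a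
  set B := ∫⁻ z, G z ^ b
  have hGw : ∀ w, Measurable fun z => G (z + w) := fun w =>
    hG.comp (measurable_id.add_const w)
  have hGi : ∀ w, ∫⁻ z, G (z + w) ^ b = B := fun w => by
    simp_rw [add_comm _ w]
    exact lintegral_add_left_eq_self (fun z => G z ^ b) w
  have key : ∀ w, (∫⁻ z, F z * G (z + w)) ≤
      (∫⁻ z, F z ^ a * G (z + w) ^ b) ^ (1 / r) * (A ^ (1 / a - 1 / r) * B ^ (1 / b - 1 / r)) := by
    intro w
    -- Three-function Hölder. The weights `1/r`, `1/a - 1/r`, `1/b - 1/r` add up to one by the Young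
    -- relation and are nonnegative because `a, b ≥ 1`.
    have := ENNReal.lintegral_prod_norm_pow_le (μ := (volume : Measure X)) (Finset.univ : Finset (Fin 3))
      (f := ![fun z => F z ^ a * G (z + w) ^ b, fun z => F z ^ a, fun z => G (z + w) ^ b])
      (p := ![1 / r, 1 / a - 1 / r, 1 / b - 1 / r])
      (by
        intro i _
        fin_cases i
        · exact ((hF.pow_const a).mul ((hGw w).pow_const b)).aemeasurable
        · exact (hF.pow_const a).aemeasurable
        · exact ((hGw w).pow_const b).aemeasurable)
      (by simp [Fin.sum_univ_three]; simp at h; linarith)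
      (by
        intro i _
        fin_cases i
        · simp; linarith
        · simp; simp at h hb1; linarith
        · simp; simp at h ha1; linarith)
    simp only [Fin.prod_univ_three, Matrix.cons_val_zero, Matrix.cons_val_one,
      Matrix.cons_val_two, Matrix.tail_cons, Matrix.head_cons] at this
    rw [hGi, mul_assoc] at this
    refine (le_of_eq (lintegral_congr fun z => ?_)).trans this
    have e : ∀ {c : ℝ} (x : ℝ≥0∞), 0 < c → 0 ≤ 1 / c - 1 / r →
        x = (x ^ c) ^ (1 / r) * (x ^ c) ^ (1 / c - 1 / r) := by
      intro c x hc hc'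
      rw [← ENNReal.rpow_add_of_nonneg _ _ (by positivity) hc', ← ENNReal.rpow_mul]
      rw [show c * (1 / r + (1 / c - 1 / r)) = 1 by field_simp; ring, ENNReal.rpow_one]
    rw [ENNReal.mul_rpow_of_nonneg _ _ (by positivity)]
    calc _ = ((F z ^ a) ^ (1 / r) * (F z ^ a) ^ (1 / a - 1 / r)) *
          ((G (z + w) ^ b) ^ (1 / r) * (G (z + w) ^ b) ^ (1 / b - 1 / r)) := by
          rw [← e (F z) ha0 (by linarith), ← e (G (z + w)) hb0 (by linarith)]
      _ = _ := by ring
  have hjoint : Measurable (Function.uncurry fun w z => F z ^ a * G (z + w) ^ b) :=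
    ((hF.comp measurable_snd).pow_const a).mul
      ((hG.comp (measurable_snd.add measurable_fst)).pow_const b)
  have hAB : ∫⁻ w, ∫⁻ z, F z ^ a * G (z + w) ^ b = A * B := by
    rw [lintegral_lintegral_swap hjoint.aemeasurable]
    have : ∀ z, ∫⁻ w, F z ^ a * G (z + w) ^ b = F z ^ a * B := fun z => by
      have hm : Measurable fun w => G (z + w) ^ b :=
        (hG.comp (measurable_id.const_add z)).pow_const b
      rw [lintegral_const_mul _ hm, lintegral_add_left_eq_self (fun z => G z ^ b) z]
    simp_rw [this]
    rw [lintegral_mul_const _ (hF.pow_const a)]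
  calc _ ≤ (∫⁻ w, (∫⁻ z, F z ^ a * G (z + w) ^ b) *
        (A ^ (1 / a - 1 / r) * B ^ (1 / b - 1 / r)) ^ r) ^ (1 / r) := by
        gcongr with w
        refine (ENNReal.rpow_le_rpow (key w) hr0.le).trans (le_of_eq ?_)
        rw [ENNReal.mul_rpow_of_nonneg _ _ hr0.le, ← ENNReal.rpow_mul, one_div_mul_cancel hr0.ne',
          ENNReal.rpow_one]
    _ = A ^ (1 / r) * B ^ (1 / r) * (A ^ (1 / a - 1 / r) * B ^ (1 / b - 1 / r)) := by
        rw [lintegral_mul_const _ hjoint.lintegral_prod_right, hAB,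
          ENNReal.mul_rpow_of_nonneg _ _ (by positivity), ← ENNReal.rpow_mul,
          mul_one_div_cancel hr0.ne', ENNReal.rpow_one,
          ENNReal.mul_rpow_of_nonneg _ _ (by positivity)]
    _ = (A ^ (1 / r) * A ^ (1 / a - 1 / r)) * (B ^ (1 / r) * B ^ (1 / b - 1 / r)) := by ring
    _ = _ := by
        rw [← ENNReal.rpow_add_of_nonneg _ _ (by positivity) (by linarith),
          ← ENNReal.rpow_add_of_nonneg _ _ (by positivity) (by linarith)]
        ring_nf

end Young

/-- The mixed Lebesgue norm of a nonnegative function on a product. -/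
noncomputable def mixedNorm (p q : ℝ) (F : X → Y → ℝ≥0∞) : ℝ≥0∞ :=
  (∫⁻ y, (∫⁻ x, F x y ^ p) ^ (q / p)) ^ (1 / q)

/-- The form as an iterated norm, in which the one-variable inequalities apply to the inner and the
outer integral separately. -/
theorem mixedNorm_eq (p q : ℝ) (F : X → Y → ℝ≥0∞) :
    mixedNorm p q F = (∫⁻ y, ((∫⁻ x, F x y ^ p) ^ (1 / p)) ^ q) ^ (1 / q) := by
  simp_rw [mixedNorm, ← ENNReal.rpow_mul, one_div_mul_eq_div]

theorem mixedNorm_mono {p q : ℝ} (hp : 0 ≤ p) (hq : 0 ≤ q) {F G : X → Y → ℝ≥0∞}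
    (h : ∀ x y, F x y ≤ G x y) : mixedNorm p q F ≤ mixedNorm p q G := by
  unfold mixedNorm
  gcongr with y x
  exact h x y

theorem mixedNorm_const_mul {p q : ℝ} (hp : 0 < p) (hq : 0 < q) (c : ℝ≥0∞) (hc : c ≠ ∞)
    (F : X → Y → ℝ≥0∞) : mixedNorm p q (fun x y => c * F x y) = c * mixedNorm p q F := by
  have hcp : ∀ r : ℝ, 0 < r → c ^ r ≠ ∞ := fun r hr => ENNReal.rpow_ne_top_of_nonneg hr.le hc
  unfold mixedNorm
  simp_rw [ENNReal.mul_rpow_of_nonneg _ _ hp.le]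
  simp_rw [lintegral_const_mul' _ _ (hcp p hp), ENNReal.mul_rpow_of_nonneg _ _ (div_pos hq hp).le,
    ← ENNReal.rpow_mul, mul_div_cancel₀ q hp.ne']
  rw [lintegral_const_mul' _ _ (hcp q hq), ENNReal.mul_rpow_of_nonneg _ _ (by positivity),
    ← ENNReal.rpow_mul, mul_one_div_cancel hq.ne', ENNReal.rpow_one]

/-- Used to apply Young's inequality to `r`-th powers, which divides all exponents by `r`. -/
theorem mixedNorm_rpow {p q r : ℝ} (hr : r ≠ 0) (F : X → Y → ℝ≥0∞) :
    mixedNorm (p / r) (q / r) (fun x y => F x y ^ r) = mixedNorm p q F ^ r := by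
  unfold mixedNorm
  rw [← ENNReal.rpow_mul]
  simp_rw [← ENNReal.rpow_mul, mul_div_cancel₀ p hr, div_div_div_cancel_right₀ hr]
  congr 1
  rw [one_div_div, one_div_mul_eq_div]

variable [AddCommGroup X] [MeasurableAdd₂ X] [(volume : Measure X).IsAddLeftInvariant]
  [AddCommGroup Y] [MeasurableAdd₂ Y] [(volume : Measure Y).IsAddLeftInvariant]

/-- Young's inequality for the correlation of two functions in mixed Lebesgue norms. -/
theorem mixedNorm_correlation_le [SigmaFinite (volume : Measure X)]
    [SFinite (volume : Measure Y)] {a b c d r t : ℝ} (ha : 1 ≤ a) (hb : 1 ≤ b) (hc : 1 ≤ c)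
    (hd : 1 ≤ d) (hr : 1 ≤ r) (ht : 1 ≤ t) (h₁ : 1 / a + 1 / c = 1 + 1 / r)
    (h₂ : 1 / b + 1 / d = 1 + 1 / t) {F G : X → Y → ℝ≥0∞}
    (hF : Measurable (Function.uncurry F)) (hG : Measurable (Function.uncurry G)) :
    mixedNorm r t (fun x y => ∫⁻ y', ∫⁻ x', F x' y' * G (x' + x) (y' + y)) ≤
      mixedNorm a b F * mixedNorm c d G := by
  have hFy : ∀ y, Measurable fun x => F x y := fun y =>
    hF.comp (measurable_id.prodMk measurable_const)
  have hGy : ∀ y, Measurable fun x => G x y := fun y =>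
    hG.comp (measurable_id.prodMk measurable_const)
  have hinner : ∀ y, (∫⁻ x, (∫⁻ y', ∫⁻ x', F x' y' * G (x' + x) (y' + y)) ^ r) ^ (1 / r) ≤
      ∫⁻ y', (∫⁻ x, F x y' ^ a) ^ (1 / a) * (∫⁻ x, G x (y' + y) ^ c) ^ (1 / c) := by
    intro y
    -- Minkowski moves the `L^r` norm in `x` under the integral over `y'`; Young in `x` then applies
    -- for each `y'`. What is left is a correlation in `y` of the inner norms, to which Young
    -- applies once more.
    refine (lintegral_rpow_lintegral_le hr ?_).trans (lintegral_mono fun y' => ?_)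
    · exact Measurable.lintegral_prod_right (f := fun (p : X × Y) x' =>
        F x' p.2 * G (x' + p.1) (p.2 + y)) (by
          exact (hF.comp (by fun_prop : Measurable fun z : (X × Y) × X => (z.2, z.1.2))).mul
            (hG.comp (by fun_prop : Measurable fun z : (X × Y) × X =>
              (z.2 + z.1.1, z.1.2 + y))))
    · exact lintegral_correlation_rpow_le ha hc hr h₁ (hFy y') (hGy (y' + y))
  rw [mixedNorm_eq, mixedNorm_eq, mixedNorm_eq]
  refine le_trans ?_ (lintegral_correlation_rpow_le hb hd ht h₂
    ((hF.pow_const a).lintegral_prod_left'.pow_const _)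
    ((hG.pow_const c).lintegral_prod_left'.pow_const _))
  gcongr with y
  exact hinner y

/-- Young's inequality for the correlation of two functions in mixed Lebesgue norms, with the order
of integration reversed. -/
theorem mixedNorm_correlation_swap_le [SFinite (volume : Measure X)]
    [SigmaFinite (volume : Measure Y)] {a b c d r t : ℝ} (ha : 1 ≤ a) (hb : 1 ≤ b) (hc : 1 ≤ c)
    (hd : 1 ≤ d) (hr : 1 ≤ r) (ht : 1 ≤ t) (h₁ : 1 / a + 1 / c = 1 + 1 / r)
    (h₂ : 1 / b + 1 / d = 1 + 1 / t) {F G : X → Y → ℝ≥0∞}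
    (hF : Measurable (Function.uncurry F)) (hG : Measurable (Function.uncurry G)) :
    mixedNorm r t (fun y x => ∫⁻ y', ∫⁻ x', F x' y' * G (x' + x) (y' + y)) ≤
      mixedNorm a b (fun y x => F x y) * mixedNorm c d (fun y x => G x y) := by
  refine le_trans (le_of_eq ?_) (mixedNorm_correlation_le ha hb hc hd hr ht h₁ h₂
    (hF.comp measurable_swap) (hG.comp measurable_swap))
  congr 1
  ext y x
  refine lintegral_lintegral_swap (Measurable.aemeasurable ?_)
  exact (hF.comp measurable_swap).mul
    (hG.comp (by fun_prop : Measurable fun z : Y × X => (z.2 + x, z.1 + y)))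

end MixedNorm
end MWD

namespace MWD
noncomputable section

/-! ### Tensor products of Schwartz functions -/

section TensorSchwartz

variable {ι κ : Type*} [Fintype ι] [Fintype κ]

@[simp] theorem join_fstL_sndL (z : EuclideanSpace ℝ (ι ⊕ κ)) : join (fstL z) (sndL z) = z := by
  ext i; cases i <;> rfl

@[simp] theorem fstL_join (x : EuclideanSpace ℝ ι) (y : EuclideanSpace ℝ κ) :
    fstL (join x y) = x := rfl

@[simp] theorem sndL_join (x : EuclideanSpace ℝ ι) (y : EuclideanSpace ℝ κ) :
    sndL (join x y) = y := rfl

theorem norm_fst_le (x : EuclideanSpace ℝ ι) (y : EuclideanSpace ℝ κ) : ‖x‖ ≤ ‖join x y‖ := by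
  refine le_of_sq_le_sq ?_ (norm_nonneg _)
  rw [norm_join_sq]; nlinarith [norm_nonneg y]

theorem norm_join_le (x : EuclideanSpace ℝ ι) (y : EuclideanSpace ℝ κ) :
    ‖join x y‖ ≤ ‖x‖ + ‖y‖ := by
  refine le_of_sq_le_sq ?_ (by positivity)
  rw [norm_join_sq]; nlinarith [norm_nonneg x, norm_nonneg y]

theorem one_add_norm_join_le (x : EuclideanSpace ℝ ι) (y : EuclideanSpace ℝ κ) :
    1 + ‖join x y‖ ≤ (1 + ‖x‖) * (1 + ‖y‖) := by
  nlinarith [norm_join_le x y, norm_nonneg x, norm_nonneg y]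

theorem norm_fstL_le : ‖(fstL : EuclideanSpace ℝ (ι ⊕ κ) →L[ℝ] EuclideanSpace ℝ ι)‖ ≤ 1 :=
  ContinuousLinearMap.opNorm_le_bound _ zero_le_one fun z => by
    rw [one_mul]
    simpa using norm_fst_le (fstL z) (sndL z)

theorem norm_sndL_le : ‖(sndL : EuclideanSpace ℝ (ι ⊕ κ) →L[ℝ] EuclideanSpace ℝ κ)‖ ≤ 1 :=
  ContinuousLinearMap.opNorm_le_bound _ zero_le_one fun z => by
    rw [one_mul]
    simpa using norm_snd_le (fstL z) (sndL z)

theorem norm_iteratedFDeriv_comp_le {V W : Type*} [NormedAddCommGroup V] [NormedSpace ℝ V]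
    [NormedAddCommGroup W] [NormedSpace ℝ W] {L : V →L[ℝ] W} (hL : ‖L‖ ≤ 1) (φ : 𝓢(W, ℂ))
    (n : ℕ) (z : V) :
    ‖iteratedFDeriv ℝ n (fun z => φ (L z)) z‖ ≤ ‖iteratedFDeriv ℝ n φ (L z)‖ := by
  rw [show (fun z => φ (L z)) = φ ∘ L from rfl,
    ContinuousLinearMap.iteratedFDeriv_comp_right _ (φ.smooth n) _ le_rfl]
  refine (ContinuousMultilinearMap.norm_compContinuousLinearMap_le _ _).trans ?_
  refine mul_le_of_le_one_right (norm_nonneg _) ?_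
  exact Finset.prod_le_one (fun _ _ => norm_nonneg _) fun _ _ => hL

theorem exists_one_add_norm_pow_mul_le {V : Type*} [NormedAddCommGroup V] [NormedSpace ℝ V]
    (φ : 𝓢(V, ℂ)) (k n : ℕ) :
    ∃ C : ℝ, 0 ≤ C ∧ ∀ x, (1 + ‖x‖) ^ k * ‖iteratedFDeriv ℝ n φ x‖ ≤ C :=
  ⟨_, by positivity, fun x => SchwartzMap.one_add_le_sup_seminorm_apply (𝕜 := ℂ) (m := (k, n))
    (k := k) (n := n) le_rfl le_rfl φ x⟩

theorem contDiff_tensor (φ : 𝓢(EuclideanSpace ℝ ι, ℂ)) (ψ : 𝓢(EuclideanSpace ℝ κ, ℂ)) :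
    ContDiff ℝ (⊤ : ℕ∞) fun z : EuclideanSpace ℝ (ι ⊕ κ) => φ (fstL z) * ψ (sndL z) :=
  ((φ.smooth ⊤).comp (fstL (ι := ι) (κ := κ)).contDiff).mul
    ((ψ.smooth ⊤).comp (sndL (ι := ι) (κ := κ)).contDiff)

/-- Leibniz' rule: since `‖z‖ ^ k` is at most the product of the two weights in `L z` and `L' z`,
each term splits into a weighted derivative of `φ` and one of `ψ`. -/
theorem decay_mul_comp {V W W' : Type*} [NormedAddCommGroup V] [NormedSpace ℝ V]
    [NormedAddCommGroup W] [NormedSpace ℝ W] [NormedAddCommGroup W'] [NormedSpace ℝ W']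
    {L : V →L[ℝ] W} {L' : V →L[ℝ] W'} (hL : ‖L‖ ≤ 1) (hL' : ‖L'‖ ≤ 1)
    (hLL' : ∀ z, ‖z‖ ≤ (1 + ‖L z‖) * (1 + ‖L' z‖)) (φ : 𝓢(W, ℂ)) (ψ : 𝓢(W', ℂ)) (k n : ℕ) :
    ∃ C : ℝ, ∀ z : V, ‖z‖ ^ k * ‖iteratedFDeriv ℝ n (fun z => φ (L z) * ψ (L' z)) z‖ ≤ C := by
  choose A hA0 hA using fun i => exists_one_add_norm_pow_mul_le φ k i
  choose B hB0 hB using fun i => exists_one_add_norm_pow_mul_le ψ k i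
  refine ⟨∑ i ∈ Finset.range (n + 1), (n.choose i : ℝ) * A i * B (n - i), fun z => ?_⟩
  have h := norm_iteratedFDeriv_mul_le (𝕜 := ℝ) (N := (⊤ : ℕ∞)) (n := n)
    (f := fun z : V => φ (L z)) (g := fun z => ψ (L' z))
    ((φ.smooth ⊤).comp L.contDiff) ((ψ.smooth ⊤).comp L'.contDiff) z (by exact_mod_cast le_top)
  have hz : ‖z‖ ^ k ≤ (1 + ‖L z‖) ^ k * (1 + ‖L' z‖) ^ k := by
    rw [← mul_pow]
    exact pow_le_pow_left₀ (norm_nonneg _) (hLL' z) k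
  have h1 : ∀ i ∈ Finset.range (n + 1), (n.choose i : ℝ) *
      ‖iteratedFDeriv ℝ i (fun z : V => φ (L z)) z‖ *
        ‖iteratedFDeriv ℝ (n - i) (fun z : V => ψ (L' z)) z‖ ≤
      (n.choose i : ℝ) * ‖iteratedFDeriv ℝ i φ (L z)‖ * ‖iteratedFDeriv ℝ (n - i) ψ (L' z)‖ :=
    fun i _ =>
    mul_le_mul (mul_le_mul_of_nonneg_left (norm_iteratedFDeriv_comp_le hL φ i z)
      (by positivity)) (norm_iteratedFDeriv_comp_le hL' ψ (n - i) z) (norm_nonneg _)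
      (by positivity)
  calc _ ≤ ((1 + ‖L z‖) ^ k * (1 + ‖L' z‖) ^ k) * ∑ i ∈ Finset.range (n + 1),
        (n.choose i : ℝ) * ‖iteratedFDeriv ℝ i φ (L z)‖ *
          ‖iteratedFDeriv ℝ (n - i) ψ (L' z)‖ :=
        mul_le_mul hz (h.trans (Finset.sum_le_sum h1)) (norm_nonneg _) (by positivity)
    _ = ∑ i ∈ Finset.range (n + 1), (n.choose i : ℝ) *
        ((1 + ‖L z‖) ^ k * ‖iteratedFDeriv ℝ i φ (L z)‖) *
        ((1 + ‖L' z‖) ^ k * ‖iteratedFDeriv ℝ (n - i) ψ (L' z)‖) := by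
        rw [Finset.mul_sum]
        exact Finset.sum_congr rfl fun i _ => by ring
    _ ≤ _ := by
        refine Finset.sum_le_sum fun i _ => ?_
        exact mul_le_mul (mul_le_mul_of_nonneg_left (hA i _) (by positivity)) (hB _ _)
          (by positivity) (mul_nonneg (by positivity) (hA0 i))

theorem norm_le_one_add_mul (z : EuclideanSpace ℝ (ι ⊕ κ)) :
    ‖z‖ ≤ (1 + ‖fstL z‖) * (1 + ‖sndL z‖) := by
  have := one_add_norm_join_le (fstL z) (sndL z)
  rw [join_fstL_sndL] at this
  linarith

/-- The tensor product `(x, y) ↦ φ(x) ψ(y)` of two Schwartz functions. -/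
def tensorSchwartz (φ : 𝓢(EuclideanSpace ℝ ι, ℂ)) (ψ : 𝓢(EuclideanSpace ℝ κ, ℂ)) :
    𝓢(EuclideanSpace ℝ (ι ⊕ κ), ℂ) where
  toFun z := φ (fstL z) * ψ (sndL z)
  smooth' := contDiff_tensor φ ψ
  decay' := decay_mul_comp (V := EuclideanSpace ℝ (ι ⊕ κ)) (W := EuclideanSpace ℝ ι)
    (W' := EuclideanSpace ℝ κ) (L := fstL) (L' := sndL) norm_fstL_le norm_sndL_le
    norm_le_one_add_mul φ ψ

@[simp] theorem tensorSchwartz_apply (φ : 𝓢(EuclideanSpace ℝ ι, ℂ)) (ψ : 𝓢(EuclideanSpace ℝ κ, ℂ))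
    (z : EuclideanSpace ℝ (ι ⊕ κ)) : tensorSchwartz φ ψ z = φ (fstL z) * ψ (sndL z) := rfl

end TensorSchwartz

/-! ### Tempered distributions commute with integrals of Schwartz functions -/

section Fubini

theorem seminorm_lineDerivOp_le {V : Type*} [NormedAddCommGroup V] [NormedSpace ℝ V]
    (Φ : 𝓢(V, ℂ)) (h : V) (k l : ℕ) :
    SchwartzMap.seminorm ℂ k l (∂_{h} Φ : 𝓢(V, ℂ)) ≤ SchwartzMap.seminorm ℂ k (l + 1) Φ * ‖h‖ := by
  refine SchwartzMap.seminorm_le_bound ℂ k l _ (by positivity) fun x => ?_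
  rw [iteratedFDeriv_lineDerivOp]
  calc _ ≤ ‖x‖ ^ k * (‖iteratedFDeriv ℝ (l + 1) Φ x‖ * ‖h‖) := by
        gcongr
        rw [← norm_fderiv_iteratedFDeriv]
        exact ContinuousLinearMap.le_opNorm _ _
    _ = (‖x‖ ^ k * ‖iteratedFDeriv ℝ (l + 1) Φ x‖) * ‖h‖ := by ring
    _ ≤ _ := by gcongr; exact SchwartzMap.le_seminorm ℂ k (l + 1) Φ x

/-- Translation is continuous in every Schwartz seminorm. -/
theorem tendsto_seminorm_translation {V : Type*} [NormedAddCommGroup V] [NormedSpace ℝ V]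
    (Φ : 𝓢(V, ℂ)) (k l : ℕ) :
    Filter.Tendsto (fun h : V => SchwartzMap.seminorm ℂ k l (Φ.compSubConstCLM ℂ (-h) - Φ))
      (nhds 0) (nhds 0) := by
  obtain ⟨C, hC0, hC⟩ := exists_seminorm_translation_le Φ k l
  have hlim : Filter.Tendsto (fun h : V => C * ‖h‖ ^ 2 + SchwartzMap.seminorm ℂ k (l + 1) Φ * ‖h‖)
      (nhds 0) (nhds 0) := by
    have : Continuous fun h : V => C * ‖h‖ ^ 2 + SchwartzMap.seminorm ℂ k (l + 1) Φ * ‖h‖ := by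
      fun_prop
    simpa using this.tendsto 0
  refine squeeze_zero' (Filter.Eventually.of_forall fun h => apply_nonneg _ _) ?_ hlim
  filter_upwards [Metric.closedBall_mem_nhds (0 : V) one_pos] with h hh
  calc _ = SchwartzMap.seminorm ℂ k l ((Φ.compSubConstCLM ℂ (-h) - Φ - ∂_{h} Φ) + ∂_{h} Φ) := by
        rw [sub_add_cancel]
    _ ≤ _ := (map_add_le_add _ _ _).trans
        (add_le_add (hC h (by simpa using hh)) (seminorm_lineDerivOp_le Φ h k l))

variable {V : Type*} [NormedAddCommGroup V] [NormedSpace ℝ V]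

/-- The points at which the finitely many weighted derivatives that bound a tempered distribution
are evaluated, with the discrete topology. -/
def JetIndex (V : Type*) (s : Finset (ℕ × ℕ)) : Type _ := (i : s) × V × (Fin i.1.2 → V)

/-- With no continuity to check, the bounded functions on the index set form a Banach space in which
Schwartz functions can be integrated. -/
instance (s : Finset (ℕ × ℕ)) : TopologicalSpace (JetIndex V s) := ⊥

instance (s : Finset (ℕ × ℕ)) : DiscreteTopology (JetIndex V s) := ⟨rfl⟩

theorem norm_jet_le (φ : 𝓢(V, ℂ)) (k l : ℕ) (x : V) (m : Fin l → V) :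
    ‖((∏ j, ‖m j‖)⁻¹ * ‖x‖ ^ k) • iteratedFDeriv ℝ l φ x m‖ ≤ SchwartzMap.seminorm ℂ k l φ := by
  have h1 := (iteratedFDeriv ℝ l φ x).le_opNorm m
  have h2 := SchwartzMap.le_seminorm ℂ k l φ x
  have h0 : 0 ≤ ∏ j, ‖m j‖ := by positivity
  rw [norm_smul, norm_mul, norm_inv, norm_pow, norm_norm, Real.norm_of_nonneg h0]
  calc _ ≤ (∏ j, ‖m j‖)⁻¹ * ‖x‖ ^ k * (‖iteratedFDeriv ℝ l φ x‖ * ∏ j, ‖m j‖) := by gcongr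
    _ = ((∏ j, ‖m j‖)⁻¹ * (∏ j, ‖m j‖)) * (‖x‖ ^ k * ‖iteratedFDeriv ℝ l φ x‖) := by ring
    -- Only an inequality: if some `m j` vanishes, the inverse of the product is `0` by convention.
    _ ≤ 1 * (‖x‖ ^ k * ‖iteratedFDeriv ℝ l φ x‖) := by gcongr; exact inv_mul_le_one
    _ ≤ _ := by rw [one_mul]; exact h2

/-- Finitely many weighted derivatives `‖x‖^k D^l φ(x)` of a Schwartz function, as a bounded
function. -/
def jetLM (s : Finset (ℕ × ℕ)) : 𝓢(V, ℂ) →ₗ[ℂ] BoundedContinuousFunction (JetIndex V s) ℂ where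
  toFun φ := BoundedContinuousFunction.ofNormedAddCommGroupDiscrete
    (fun d => ((∏ j, ‖d.2.2 j‖)⁻¹ * ‖d.2.1‖ ^ d.1.1.1) • iteratedFDeriv ℝ d.1.1.2 φ d.2.1 d.2.2)
    (∑ i ∈ s, SchwartzMap.seminorm ℂ i.1 i.2 φ) (fun d => by
      refine (norm_jet_le φ _ _ _ _).trans ?_
      exact Finset.single_le_sum (f := fun i : ℕ × ℕ => SchwartzMap.seminorm ℂ i.1 i.2 φ)
        (fun i _ => apply_nonneg _ _) d.1.2)
  map_add' φ ψ := by
    ext d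
    have : iteratedFDeriv ℝ d.1.1.2 (φ + ψ : 𝓢(V, ℂ)) d.2.1 =
        iteratedFDeriv ℝ d.1.1.2 φ d.2.1 + iteratedFDeriv ℝ d.1.1.2 ψ d.2.1 :=
      iteratedFDeriv_add_apply (φ.smooth _).contDiffAt (ψ.smooth _).contDiffAt
    simp only [BoundedContinuousFunction.coe_ofNormedAddCommGroupDiscrete,
      BoundedContinuousFunction.coe_add, Pi.add_apply]
    rw [this, ← smul_add]; rfl
  map_smul' c φ := by
    ext d
    have : iteratedFDeriv ℝ d.1.1.2 (c • φ : 𝓢(V, ℂ)) d.2.1 =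
        c • iteratedFDeriv ℝ d.1.1.2 φ d.2.1 :=
      iteratedFDeriv_const_smul_apply (φ.smooth _).contDiffAt
    simp only [BoundedContinuousFunction.coe_ofNormedAddCommGroupDiscrete, RingHom.id_apply,
      BoundedContinuousFunction.coe_smul]
    rw [this, smul_comm]; rfl

theorem jetLM_apply (s : Finset (ℕ × ℕ)) (φ : 𝓢(V, ℂ)) (d : JetIndex V s) :
    jetLM s φ d =
      ((∏ j, ‖d.2.2 j‖)⁻¹ * ‖d.2.1‖ ^ d.1.1.1) • iteratedFDeriv ℝ d.1.1.2 φ d.2.1 d.2.2 := rfl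

theorem norm_jetLM_le (s : Finset (ℕ × ℕ)) (φ : 𝓢(V, ℂ)) :
    ‖jetLM s φ‖ ≤ ∑ i ∈ s, SchwartzMap.seminorm ℂ i.1 i.2 φ := by
  refine (BoundedContinuousFunction.norm_le (Finset.sum_nonneg fun i _ => apply_nonneg _ _)).2
    fun d => ?_
  refine (norm_jet_le φ _ _ _ _).trans ?_
  exact Finset.single_le_sum (f := fun i : ℕ × ℕ => SchwartzMap.seminorm ℂ i.1 i.2 φ)
    (fun i _ => apply_nonneg _ _) d.1.2

/-- Dividing by `∏ ‖m j‖` in the jet makes the supremum over `m` an operator norm; vectors `m` with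
a zero entry contribute nothing to it. -/
theorem seminorm_le_norm_jetLM {s : Finset (ℕ × ℕ)} {i : ℕ × ℕ} (hi : i ∈ s) (φ : 𝓢(V, ℂ)) :
    SchwartzMap.seminorm ℂ i.1 i.2 φ ≤ ‖jetLM s φ‖ := by
  refine SchwartzMap.seminorm_le_bound ℂ i.1 i.2 _ (norm_nonneg _) fun x => ?_
  rw [← norm_norm x, ← norm_pow, ← norm_smul]
  refine ContinuousMultilinearMap.opNorm_le_bound (norm_nonneg _) fun m => ?_
  rcases eq_or_ne (∏ j, ‖m j‖) 0 with h0 | h0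
  · obtain ⟨j, -, hj⟩ := Finset.prod_eq_zero_iff.1 h0
    rw [ContinuousMultilinearMap.map_coord_zero _ j (norm_eq_zero.1 hj), norm_zero, h0, mul_zero]
  · have h : ‖((∏ j, ‖m j‖)⁻¹ * ‖x‖ ^ i.1) • iteratedFDeriv ℝ i.2 φ x m‖ ≤ ‖jetLM s φ‖ :=
      (jetLM s φ).norm_coe_le_norm ⟨⟨i, hi⟩, x, m⟩
    have hpos : 0 < ∏ j, ‖m j‖ := lt_of_le_of_ne (by positivity) h0.symm
    rw [mul_smul, norm_smul, norm_inv, Real.norm_of_nonneg hpos.le,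
      inv_mul_le_iff₀ hpos, mul_comm] at h
    exact h

/-- A linear functional that is bounded by the norm of a linear map factors through that map. -/
theorem exists_factor_of_bound {S E : Type*} [AddCommGroup S] [Module ℂ S] [NormedAddCommGroup E]
    [NormedSpace ℂ E] (J : S →ₗ[ℂ] E) (f : S →ₗ[ℂ] ℂ) (C : ℝ) (hb : ∀ φ, ‖f φ‖ ≤ C * ‖J φ‖) :
    ∃ F : E →L[ℂ] ℂ, ∀ φ, F (J φ) = f φ := by
  have hker : J.ker ≤ f.ker := by
    intro φ hφ
    have := hb φ
    rw [LinearMap.mem_ker.1 hφ, norm_zero, mul_zero] at this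
    exact norm_le_zero_iff.1 this
  let g₀ : J.range →ₗ[ℂ] ℂ := (J.ker.liftQ f hker) ∘ₗ J.quotKerEquivRange.symm.toLinearMap
  have hg₀ : ∀ φ, g₀ ⟨J φ, LinearMap.mem_range_self _ φ⟩ = f φ := fun φ => by
    simp only [g₀, LinearMap.comp_apply, LinearEquiv.coe_coe]
    rw [LinearMap.quotKerEquivRange_symm_apply_image]
    rfl
  let g : J.range →L[ℂ] ℂ := g₀.mkContinuous C fun ⟨w, φ, hφ⟩ => by
    subst hφ
    rw [hg₀]
    exact hb φ
  -- Hahn–Banach: the functional is so far defined and bounded only on the range of `J`.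
  obtain ⟨F, hF, -⟩ := exists_extension_norm_eq _ g
  exact ⟨F, fun φ => (hF ⟨J φ, LinearMap.mem_range_self _ φ⟩).trans (hg₀ φ)⟩

/-- A continuous functional on the Schwartz space factors through finitely many weighted
derivatives. -/
theorem exists_factor_jetLM (f : 𝓢(V, ℂ) →L[ℂ] ℂ) :
    ∃ (s : Finset (ℕ × ℕ))
      (F : BoundedContinuousFunction (JetIndex V s) ℂ →L[ℂ] ℂ),
      ∀ φ, F (jetLM s φ) = f φ := by
  obtain ⟨s, C, -, hC⟩ := Seminorm.bound_of_continuous (schwartz_withSeminorms ℂ V ℂ)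
    ((normSeminorm ℂ ℂ).comp f.toLinearMap) (continuous_norm.comp f.continuous)
  refine ⟨s, exists_factor_of_bound (jetLM s) f.toLinearMap C fun φ => ?_⟩
  refine (hC φ).trans (mul_le_mul_of_nonneg_left ?_ C.2)
  exact Seminorm.finset_sup_apply_le (norm_nonneg _) fun m hm => seminorm_le_norm_jetLM hm φ

variable {ι κ : Type*} [Fintype ι] [Fintype κ]

/-- The difference of two sections of `Φ` is a section of a translate of `Φ` minus `Φ`, and
translation is continuous in each seminorm. This supplies strong measurability for the Bochner
integral. -/
theorem continuous_jetLM_sectionCLM (s : Finset (ℕ × ℕ)) (Φ : 𝓢(EuclideanSpace ℝ (κ ⊕ ι), ℂ)) :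
    Continuous fun y : EuclideanSpace ℝ κ => jetLM s (sectionCLM y Φ) := by
  refine continuous_iff_continuousAt.2 fun y₀ => ?_
  rw [ContinuousAt, tendsto_iff_norm_sub_tendsto_zero]
  have hlim := tendsto_finsetSum s fun i _ => (tendsto_seminorm_translation Φ i.1 i.2).comp
    (((inlL (ι := κ) (κ := ι)).continuous.comp (continuous_id.sub continuous_const)).tendsto'
      y₀ 0 (by simp : (inlL (ι := κ) (κ := ι)) (id y₀ - y₀) = 0))
  rw [Finset.sum_const_zero] at hlim
  refine squeeze_zero (fun _ => norm_nonneg _) (fun y => ?_) hlim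
  rw [← map_sub]
  have e : sectionCLM y Φ - sectionCLM y₀ Φ =
      sectionCLM y₀ (Φ.compSubConstCLM ℂ (-(inlL (ι := κ) (κ := ι) (y - y₀))) - Φ) := by
    ext t
    simp only [sectionCLM_apply, map_sub, sub_apply, SchwartzMap.compSubConstCLM_apply]
    congr 2
    ext i; cases i <;> simp [inlL_apply]
  rw [e]
  exact (norm_jetLM_le s _).trans (Finset.sum_le_sum fun i _ => seminorm_sectionCLM_le _ _ _ _)

/-- Sections of a Schwartz function on a product decay rapidly in every Schwartz seminorm. -/
theorem exists_seminorm_sectionCLM_bound (Φ : 𝓢(EuclideanSpace ℝ (κ ⊕ ι), ℂ)) (k l : ℕ) :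
    ∃ b : EuclideanSpace ℝ κ → ℝ, Integrable b ∧ ∀ y,
      SchwartzMap.seminorm ℂ k l (sectionCLM y Φ) ≤ b y := by
  let N := (volume : Measure (EuclideanSpace ℝ κ)).integrablePower
  -- The power `N` is spent on integrability in `y`, the power `k` on the weight of the seminorm.
  obtain ⟨C, hC0, hC⟩ := exists_one_add_norm_pow_mul_le Φ (N + k) l
  refine ⟨fun y => (1 + ‖y‖) ^ (-(N : ℝ)) * C,
    (Measure.integrable_pow_neg_integrablePower volume).mul_const C, fun y => ?_⟩
  refine SchwartzMap.seminorm_le_bound ℂ k l _ (by positivity) fun t => ?_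
  have e : ⇑(sectionCLM y Φ) = (fun z => Φ (z + inlL y)) ∘ ⇑(inrL (ι := κ) (κ := ι)) := by
    ext t; simp [join_eq]
  have c0 : ContDiff ℝ l (fun z => Φ (z + inlL y)) := (Φ.smooth l).comp (by fun_prop)
  have hn : ‖iteratedFDeriv ℝ l (sectionCLM y Φ) t‖ ≤ ‖iteratedFDeriv ℝ l Φ (join y t)‖ := by
    rw [e, ContinuousLinearMap.iteratedFDeriv_comp_right _ c0 _ le_rfl,
      iteratedFDeriv_comp_add_right, ← join_eq]
    refine (ContinuousMultilinearMap.norm_compContinuousLinearMap_le _ _).trans ?_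
    refine mul_le_of_le_one_right (norm_nonneg _) ?_
    exact Finset.prod_le_one (fun _ _ => norm_nonneg _) fun _ _ => norm_inrL_le
  beta_reduce
  rw [Real.rpow_neg (by positivity), Real.rpow_natCast, ← div_eq_inv_mul,
    le_div_iff₀ (by positivity)]
  refine le_trans ?_ (hC (join y t))
  rw [pow_add]
  calc _ ≤ (1 + ‖join y t‖) ^ k * ‖iteratedFDeriv ℝ l Φ (join y t)‖ * (1 + ‖join y t‖) ^ N := by
        gcongr
        · exact (norm_snd_le y t).trans (by linarith)
        · exact norm_fst_le y t
    _ = _ := by ring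

theorem integrable_section (Φ : 𝓢(EuclideanSpace ℝ (κ ⊕ ι), ℂ)) (t : EuclideanSpace ℝ ι) :
    Integrable fun y => Φ (join y t) := by
  obtain ⟨b, hb, h⟩ := exists_seminorm_sectionCLM_bound Φ 0 0
  refine hb.mono' ?_ (Filter.Eventually.of_forall fun y => ?_)
  · refine (Φ.continuous.comp ?_).aestronglyMeasurable
    simp_rw [join_eq]; fun_prop
  · exact (SchwartzMap.norm_le_seminorm ℂ (sectionCLM y Φ) t).trans (h y)

/-- Differentiation under the integral sign along the line `t + r v`, dominated by the integrable
bound on the sections of the derivative of `Φ`. -/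
theorem lineDerivOp_integral_section {Φ : 𝓢(EuclideanSpace ℝ (κ ⊕ ι), ℂ)}
    {φ : 𝓢(EuclideanSpace ℝ ι, ℂ)} (h : ∀ t, φ t = ∫ y, Φ (join y t)) (v : EuclideanSpace ℝ ι)
    (t : EuclideanSpace ℝ ι) :
    (∂_{v} φ : 𝓢(EuclideanSpace ℝ ι, ℂ)) t =
      ∫ y, (∂_{inrL (ι := κ) v} Φ : 𝓢(EuclideanSpace ℝ (κ ⊕ ι), ℂ)) (join y t) := by
  obtain ⟨b, hb, hbd⟩ := exists_seminorm_sectionCLM_bound (∂_{inrL (ι := κ) v} Φ) 0 0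
  have hd := (hasDerivAt_integral_of_dominated_loc_of_deriv_le (𝕜 := ℝ) (μ := volume) (x₀ := (0 : ℝ))
    (s := Set.univ) (F := fun r y => Φ (join y (t + r • v)))
    (F' := fun r y => (∂_{inrL (ι := κ) v} Φ : 𝓢(EuclideanSpace ℝ (κ ⊕ ι), ℂ)) (join y (t + r • v)))
    (bound := b) Filter.univ_mem
    (Filter.Eventually.of_forall fun r => (integrable_section Φ _).aestronglyMeasurable)
    (integrable_section Φ _) (integrable_section _ _).aestronglyMeasurable
    (Filter.Eventually.of_forall fun y r _ =>
      (SchwartzMap.norm_le_seminorm ℂ (sectionCLM y (∂_{inrL (ι := κ) v} Φ)) _).trans (hbd y)) hb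
    (Filter.Eventually.of_forall fun y r _ => by
      have h1 : HasDerivAt (fun r : ℝ => t + r • v) v r := by
        simpa using ((hasDerivAt_id r).smul_const v).const_add t
      have h2 := ((sectionCLM y Φ).hasFDerivAt (t + r • v)).comp_hasDerivAt r h1
      rw [← SchwartzMap.lineDerivOp_apply_eq_fderiv, ← sectionCLM_lineDerivOp_inrL] at h2
      exact h2)).2
  simp_rw [← h] at hd
  have h1 : HasDerivAt (fun r : ℝ => t + r • v) v 0 := by
    simpa using ((hasDerivAt_id (0 : ℝ)).smul_const v).const_add t
  have h2 := (φ.hasFDerivAt (t + (0 : ℝ) • v)).comp_hasDerivAt 0 h1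
  have h3 := h2.unique hd
  rw [← SchwartzMap.lineDerivOp_apply_eq_fderiv] at h3
  simpa using h3

theorem iteratedLineDerivOp_integral_section {Φ : 𝓢(EuclideanSpace ℝ (κ ⊕ ι), ℂ)}
    {φ : 𝓢(EuclideanSpace ℝ ι, ℂ)} (h : ∀ t, φ t = ∫ y, Φ (join y t)) {n : ℕ}
    (m : Fin n → EuclideanSpace ℝ ι) (t : EuclideanSpace ℝ ι) :
    (∂^{m} φ : 𝓢(EuclideanSpace ℝ ι, ℂ)) t =
      ∫ y, (∂^{m} (sectionCLM y Φ) : 𝓢(EuclideanSpace ℝ ι, ℂ)) t := by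
  -- The induction carries a Schwartz function on the product whose sections are the derivatives of
  -- the sections of `Φ`, so that the one-derivative lemma can be reapplied.
  have key : ∀ (n : ℕ) (m : Fin n → EuclideanSpace ℝ ι), ∃ Ψ : 𝓢(EuclideanSpace ℝ (κ ⊕ ι), ℂ),
      (∀ y, sectionCLM y Ψ = ∂^{m} (sectionCLM y Φ)) ∧
        ∀ t, (∂^{m} φ : 𝓢(EuclideanSpace ℝ ι, ℂ)) t = ∫ y, Ψ (join y t) := by
    intro n
    induction n with
    | zero => intro m; exact ⟨Φ, fun y => by simp, fun t => by simpa using h t⟩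
    | succ n ih =>
      intro m
      obtain ⟨Ψ, h1, h2⟩ := ih (Fin.tail m)
      refine ⟨∂_{inrL (ι := κ) (m 0)} Ψ, fun y => ?_, fun t => ?_⟩
      · rw [sectionCLM_lineDerivOp_inrL, h1, LineDeriv.iteratedLineDerivOp_succ_left]
      · rw [LineDeriv.iteratedLineDerivOp_succ_left, lineDerivOp_integral_section h2]
  obtain ⟨Ψ, h1, h2⟩ := key n m
  rw [h2]
  simp_rw [← h1, sectionCLM_apply]

/-- A tempered distribution commutes with the integration of a Schwartz function on a product. -/
theorem distribution_integral (f : 𝓢'(EuclideanSpace ℝ ι, ℂ))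
    {Φ : 𝓢(EuclideanSpace ℝ (κ ⊕ ι), ℂ)} {φ : 𝓢(EuclideanSpace ℝ ι, ℂ)}
    (h : ∀ t, φ t = ∫ y, Φ (join y t)) : f φ = ∫ y, f (sectionCLM y Φ) := by
  obtain ⟨s, F, hF⟩ := exists_factor_jetLM (f : 𝓢(EuclideanSpace ℝ ι, ℂ) →L[ℂ] ℂ)
  choose b hb hbd using fun i : ℕ × ℕ => exists_seminorm_sectionCLM_bound Φ i.1 i.2
  have hint : Integrable fun y : EuclideanSpace ℝ κ => jetLM s (sectionCLM y Φ) := by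
    refine (integrable_finsetSum s fun i _ => hb i).mono'
      (continuous_jetLM_sectionCLM s Φ).aestronglyMeasurable
      (Filter.Eventually.of_forall fun y => ?_)
    exact (norm_jetLM_le s _).trans (Finset.sum_le_sum fun i _ => hbd i y)
  -- Equality of bounded functions is checked at each index, where evaluation commutes with the
  -- Bochner integral and the claim is differentiation under the integral.
  have hjet : jetLM s φ = ∫ y, jetLM s (sectionCLM y Φ) := by
    ext d
    have h1 := (BoundedContinuousFunction.evalCLM ℂ d).integral_comp_comm hint
    simp only [BoundedContinuousFunction.evalCLM_apply] at h1
    rw [← h1]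
    simp_rw [jetLM_apply]
    rw [integral_smul]
    congr 1
    simp_rw [← SchwartzMap.iteratedLineDerivOp_eq_iteratedFDeriv]
    exact iteratedLineDerivOp_integral_section h _ _
  calc f φ = F (jetLM s φ) := (hF φ).symm
    _ = ∫ y, F (jetLM s (sectionCLM y Φ)) := by rw [hjet, F.integral_comp_comm hint]
    _ = _ := integral_congr_ae (Filter.Eventually.of_forall fun y => hF _)

end Fubini
end
end MWD

namespace MWD
noncomputable section

/-! ### Identification of a product of Euclidean spaces with a Euclidean space -/

section Join

variable {ι κ : Type*}

theorem join_add_join (x x' : EuclideanSpace ℝ ι) (y y' : EuclideanSpace ℝ κ) :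
    join x y + join x' y' = join (x + x') (y + y') := by
  ext i; cases i <;> simp

theorem join_sub_join (x x' : EuclideanSpace ℝ ι) (y y' : EuclideanSpace ℝ κ) :
    join x y - join x' y' = join (x - x') (y - y') := by
  ext i; cases i <;> simp

variable [Fintype ι] [Fintype κ]

theorem inlL_add_inrL (x : EuclideanSpace ℝ ι) (y : EuclideanSpace ℝ κ) :
    inlL x + inrL y = join x y := by rw [join_eq, add_comm]

theorem inner_join (x x' : EuclideanSpace ℝ ι) (y y' : EuclideanSpace ℝ κ) :
    inner ℝ (join x y) (join x' y') = inner ℝ x x' + inner ℝ y y' := by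
  simp [PiLp.inner_apply]

theorem continuous_join :
    Continuous fun p : EuclideanSpace ℝ ι × EuclideanSpace ℝ κ => join p.1 p.2 := by
  simp_rw [join_eq]; fun_prop

/-- The identification of `ℝ^ι × ℝ^κ` with `ℝ^(ι ⊕ κ)`. -/
def joinEquiv : EuclideanSpace ℝ ι × EuclideanSpace ℝ κ ≃ᵐ EuclideanSpace ℝ (ι ⊕ κ) where
  toFun p := join p.1 p.2
  invFun z := (fstL z, sndL z)
  left_inv _ := rfl
  right_inv z := join_fstL_sndL z
  measurable_toFun := continuous_join.measurable
  measurable_invFun := (fstL.continuous.prodMk sndL.continuous).measurable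

theorem measurePreserving_joinEquiv :
    MeasurePreserving (joinEquiv : EuclideanSpace ℝ ι × EuclideanSpace ℝ κ ≃ᵐ _) := by
  have h1 : MeasurePreserving (fun p : EuclideanSpace ℝ ι × EuclideanSpace ℝ κ =>
      (WithLp.ofLp p.1, WithLp.ofLp p.2)) :=
    (PiLp.volume_preserving_ofLp ι).prod (PiLp.volume_preserving_ofLp κ)
  have h2 := volume_measurePreserving_sumPiEquivProdPi_symm (fun _ : ι ⊕ κ => ℝ)
  have h3 := ((PiLp.volume_preserving_toLp (ι ⊕ κ)).comp h2).comp h1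
  convert h3 using 1
  ext p i
  cases i <;> rfl

theorem lintegral_join {F : EuclideanSpace ℝ (ι ⊕ κ) → ℝ≥0∞} (hF : Measurable F) :
    ∫⁻ z, F z = ∫⁻ y : EuclideanSpace ℝ κ, ∫⁻ x : EuclideanSpace ℝ ι, F (join x y) := by
  rw [← measurePreserving_joinEquiv.lintegral_comp_emb joinEquiv.measurableEmbedding]
  exact lintegral_prod_symm' _ (hF.comp joinEquiv.measurable)

theorem integral_join {F : EuclideanSpace ℝ (ι ⊕ κ) → ℂ} (hF : Integrable F) :
    ∫ z, F z = ∫ x : EuclideanSpace ℝ ι, ∫ y : EuclideanSpace ℝ κ, F (join x y) := by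
  rw [← measurePreserving_joinEquiv.integral_comp joinEquiv.measurableEmbedding]
  refine integral_prod _ ?_
  exact (measurePreserving_joinEquiv.integrable_comp_emb joinEquiv.measurableEmbedding).2 hF

end Join

/-! ### Continuity of the short-time Fourier transform -/

section Kernel

variable {ι : Type*} [Fintype ι]

theorem hasTemperateGrowth_fourierChar :
    (fun r : ℝ => ((Real.fourierChar r : Circle) : ℂ)).HasTemperateGrowth := by
  let v : EuclideanSpace ℝ Unit := EuclideanSpace.single () 1
  have h := (hasTemperateGrowth_char v).comp
    ((ContinuousLinearMap.id ℝ ℝ).smulRight v).hasTemperateGrowth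
  convert h using 1
  ext r
  simp [v, inner_smul_right]

/-- The quadratic character `((x, ω), t) ↦ e^{-2πi ω·t}`. -/
def kernelChar (w : EuclideanSpace ℝ ((ι ⊕ ι) ⊕ ι)) : ℂ :=
  ((Real.fourierChar (-inner ℝ (sndL (fstL w)) (sndL w)) : Circle) : ℂ)

theorem hasTemperateGrowth_kernelChar :
    (kernelChar : EuclideanSpace ℝ ((ι ⊕ ι) ⊕ ι) → ℂ).HasTemperateGrowth := by
  have h : (fun w : EuclideanSpace ℝ ((ι ⊕ ι) ⊕ ι) =>
      inner ℝ (sndL (fstL w)) (sndL w)).HasTemperateGrowth :=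
    (innerSL ℝ (E := EuclideanSpace ℝ ι)).bilinear_hasTemperateGrowth
      ((sndL (ι := ι) (κ := ι)).comp (fstL (ι := ι ⊕ ι) (κ := ι))).hasTemperateGrowth
      (sndL (ι := ι ⊕ ι) (κ := ι)).hasTemperateGrowth
  exact hasTemperateGrowth_fourierChar.comp h.neg

/-- The linear map `((x, ω), t) ↦ ((x, ω), t - x)`. -/
def kernelShear : EuclideanSpace ℝ ((ι ⊕ ι) ⊕ ι) ≃L[ℝ] EuclideanSpace ℝ ((ι ⊕ ι) ⊕ ι) :=
  ContinuousLinearEquiv.equivOfInverse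
    (inlL.comp fstL + inrL.comp (sndL - fstL.comp fstL))
    (inlL.comp fstL + inrL.comp (sndL + fstL.comp fstL))
    (fun w => by
      change inlL (fstL _) + inrL (sndL _ + fstL (fstL _)) = w
      ext i; rcases i with (i | i) | i <;> simp [inlL_apply, inrL_apply])
    (fun w => by
      change inlL (fstL _) + inrL (sndL _ - fstL (fstL _)) = w
      ext i; rcases i with (i | i) | i <;> simp [inlL_apply, inrL_apply])

theorem kernelShear_join (z : EuclideanSpace ℝ (ι ⊕ ι)) (t : EuclideanSpace ℝ ι) :
    kernelShear (join z t) = join z (t - fstL z) :=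
  inlL_add_inrL z (t - fstL z)

/-- The Schwartz function `(z, t) ↦ c(z) conj (π(z) g (t))`. -/
def stftKernel (c : 𝓢(EuclideanSpace ℝ (ι ⊕ ι), ℂ)) (g : 𝓢(EuclideanSpace ℝ ι, ℂ)) :
    𝓢(EuclideanSpace ℝ ((ι ⊕ ι) ⊕ ι), ℂ) :=
  SchwartzMap.smulLeftCLM ℂ kernelChar
    (SchwartzMap.compCLMOfContinuousLinearEquiv ℂ kernelShear (tensorSchwartz c (conjSchwartz g)))

theorem stftKernel_join (c : 𝓢(EuclideanSpace ℝ (ι ⊕ ι), ℂ)) (g : 𝓢(EuclideanSpace ℝ ι, ℂ))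
    (z : EuclideanSpace ℝ (ι ⊕ ι)) (t : EuclideanSpace ℝ ι) :
    stftKernel c g (join z t) = ((Real.fourierChar (-inner ℝ (sndL z) t) : Circle) : ℂ) *
      (c z * starRingEnd ℂ (g (t - fstL z))) := by
  rw [stftKernel, SchwartzMap.smulLeftCLM_apply_apply hasTemperateGrowth_kernelChar]
  simp only [SchwartzMap.compCLMOfContinuousLinearEquiv_apply, Function.comp_apply,
    kernelShear_join, tensorSchwartz_apply, fstL_join, sndL_join, conjSchwartz_apply, smul_eq_mul]
  rfl

theorem conj_fourierChar (r : ℝ) :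
    starRingEnd ℂ ((Real.fourierChar r : Circle) : ℂ) = ((Real.fourierChar (-r) : Circle) : ℂ) := by
  rw [← Circle.coe_inv_eq_conj, ← AddChar.map_neg_eq_inv]

theorem sectionCLM_stftKernel (c : 𝓢(EuclideanSpace ℝ (ι ⊕ ι), ℂ)) (g : 𝓢(EuclideanSpace ℝ ι, ℂ))
    (z : EuclideanSpace ℝ (ι ⊕ ι)) :
    sectionCLM z (stftKernel c g) = c z • conjSchwartz (tfShift (fstL z) (sndL z) g) := by
  ext t
  rw [sectionCLM_apply, stftKernel_join, smul_apply, conjSchwartz_apply, tfShift_apply, map_mul,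
    conj_fourierChar, smul_eq_mul]
  ring

/-- The factor `c` makes the kernel Schwartz in all variables jointly. It is taken to be a bump
function for continuity and `ambiguity g h` for the reproducing formula. -/
theorem sliceCLM_stftKernel (c : 𝓢(EuclideanSpace ℝ (ι ⊕ ι), ℂ)) (g : 𝓢(EuclideanSpace ℝ ι, ℂ))
    (f : 𝓢'(EuclideanSpace ℝ ι, ℂ)) (z : EuclideanSpace ℝ (ι ⊕ ι)) :
    sliceCLM f (stftKernel c g) z = c z * stft g f (fstL z) (sndL z) := by
  rw [sliceCLM_apply, sectionCLM_stftKernel, map_smul]; rfl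

/-- The short-time Fourier transform of a tempered distribution is continuous. -/
theorem continuous_stft_fstL_sndL (g : 𝓢(EuclideanSpace ℝ ι, ℂ)) (f : 𝓢'(EuclideanSpace ℝ ι, ℂ)) :
    Continuous fun z : EuclideanSpace ℝ (ι ⊕ ι) => stft g f (fstL z) (sndL z) := by
  refine continuous_iff_continuousAt.2 fun z₀ => ?_
  -- Near `z₀` the cut-off equals one, so there the transform agrees with a Schwartz function.
  let b : ContDiffBump z₀ := ⟨1, 2, one_pos, one_lt_two⟩
  have hb : HasCompactSupport fun z => ((b z : ℝ) : ℂ) :=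
    b.hasCompactSupport.comp_left Complex.ofReal_zero
  let c : 𝓢(EuclideanSpace ℝ (ι ⊕ ι), ℂ) := hb.toSchwartzMap
    (Complex.ofRealCLM.contDiff.comp b.contDiff)
  refine (sliceCLM f (stftKernel c g)).continuous.continuousAt.congr ?_
  filter_upwards [b.eventuallyEq_one] with z hz
  rw [sliceCLM_stftKernel]
  have : c z = 1 := by
    change ((b z : ℝ) : ℂ) = 1
    rw [hz]; simp
  rw [this, one_mul]

theorem continuous_stft (g : 𝓢(EuclideanSpace ℝ ι, ℂ)) (f : 𝓢'(EuclideanSpace ℝ ι, ℂ)) :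
    Continuous fun p : EuclideanSpace ℝ ι × EuclideanSpace ℝ ι => stft g f p.1 p.2 := by
  refine ((continuous_stft_fstL_sndL g f).comp continuous_join).congr fun p => ?_
  rw [Function.comp_apply, fstL_join, sndL_join]

end Kernel

/-! ### The reproducing formula and the change of window -/

section Reproducing

variable {ι : Type*} [Fintype ι]

/-- The reflection `(x, ω) ↦ (x, -ω)`. -/
def reflectSnd : EuclideanSpace ℝ (ι ⊕ ι) ≃L[ℝ] EuclideanSpace ℝ (ι ⊕ ι) :=
  ContinuousLinearEquiv.equivOfInverse (inlL.comp fstL - inrL.comp sndL)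
    (inlL.comp fstL - inrL.comp sndL)
    (fun w => by
      change inlL (fstL _) - inrL (sndL _) = w
      ext i; rcases i with i | i <;> simp [inlL_apply, inrL_apply])
    (fun w => by
      change inlL (fstL _) - inrL (sndL _) = w
      ext i; rcases i with i | i <;> simp [inlL_apply, inrL_apply])

theorem reflectSnd_join (x ω : EuclideanSpace ℝ ι) : reflectSnd (join x ω) = join x (-ω) := by
  change inlL x - inrL ω = _
  rw [sub_eq_add_neg, ← map_neg, inlL_add_inrL]

/-- The involution `(x, t) ↦ (t - x, t)`. -/
def windowShear : EuclideanSpace ℝ (ι ⊕ ι) ≃L[ℝ] EuclideanSpace ℝ (ι ⊕ ι) :=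
  ContinuousLinearEquiv.equivOfInverse (inlL.comp (sndL - fstL) + inrL.comp sndL)
    (inlL.comp (sndL - fstL) + inrL.comp sndL)
    (fun w => by
      change inlL (sndL _ - fstL _) + inrL (sndL _) = w
      ext i; rcases i with i | i <;> simp [inlL_apply, inrL_apply])
    (fun w => by
      change inlL (sndL _ - fstL _) + inrL (sndL _) = w
      ext i; rcases i with i | i <;> simp [inlL_apply, inrL_apply])

theorem windowShear_join (x t : EuclideanSpace ℝ ι) : windowShear (join x t) = join (t - x) t :=
  inlL_add_inrL (t - x) t

/-- The Schwartz function `(x, t) ↦ h(t) g(t - x)`. -/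
def windowedSchwartz (g h : 𝓢(EuclideanSpace ℝ ι, ℂ)) : 𝓢(EuclideanSpace ℝ (ι ⊕ ι), ℂ) :=
  SchwartzMap.compCLMOfContinuousLinearEquiv ℂ windowShear (tensorSchwartz g h)

theorem windowedSchwartz_join (g h : 𝓢(EuclideanSpace ℝ ι, ℂ)) (x t : EuclideanSpace ℝ ι) :
    windowedSchwartz g h (join x t) = g (t - x) * h t := by
  simp [windowedSchwartz, windowShear_join]

/-- The Schwartz function `z ↦ ∫ h(t) π(z) g (t) dt`. -/
def ambiguity (g h : 𝓢(EuclideanSpace ℝ ι, ℂ)) : 𝓢(EuclideanSpace ℝ (ι ⊕ ι), ℂ) :=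
  SchwartzMap.compCLMOfContinuousLinearEquiv ℂ reflectSnd
    (partialFourierCLM (windowedSchwartz g h))

theorem ambiguity_join (g h : 𝓢(EuclideanSpace ℝ ι, ℂ)) (x ω : EuclideanSpace ℝ ι) :
    ambiguity g h (join x ω) =
      ∫ t, ((Real.fourierChar (inner ℝ ω t) : Circle) : ℂ) * (g (t - x) * h t) := by
  simp only [ambiguity, SchwartzMap.compCLMOfContinuousLinearEquiv_apply, Function.comp_apply,
    reflectSnd_join, partialFourierCLM_apply]
  refine integral_congr_ae (Filter.Eventually.of_forall fun t => ?_)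
  simp only [windowedSchwartz_join, Circle.smul_def, smul_eq_mul]
  rw [inner_neg_right, neg_neg, real_inner_comm]

theorem partialFourierCLM_section (Φ : 𝓢(EuclideanSpace ℝ (ι ⊕ ι), ℂ)) (x ω : EuclideanSpace ℝ ι) :
    partialFourierCLM Φ (join x ω) = 𝓕 (sectionCLM x Φ) ω := rfl

/-- Fourier inversion in `ω` for fixed `x`. The reflection in `ambiguity` accounts for the sign of
the frequency. -/
theorem integral_ambiguity (g h : 𝓢(EuclideanSpace ℝ ι, ℂ)) (x t : EuclideanSpace ℝ ι) :
    ∫ ω, ((Real.fourierChar (-inner ℝ ω t) : Circle) : ℂ) * ambiguity g h (join x ω) =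
      g (t - x) * h t := by
  have h1 : 𝓕⁻ (𝓕 (sectionCLM x (windowedSchwartz g h))) t = g (t - x) * h t := by
    rw [FourierTransform.fourierInv_fourier_eq, sectionCLM_apply, windowedSchwartz_join]
  rw [← h1, SchwartzMap.fourierInv_coe, Real.fourierInv_eq, ← integral_neg_eq_self]
  refine integral_congr_ae (Filter.Eventually.of_forall fun ω => ?_)
  simp only [ambiguity, SchwartzMap.compCLMOfContinuousLinearEquiv_apply, Function.comp_apply,
    reflectSnd_join, partialFourierCLM_section, Circle.smul_def, smul_eq_mul, neg_neg,
    inner_neg_left]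

/-- The squared `L²` norm of a window. -/
def energy (g : 𝓢(EuclideanSpace ℝ ι, ℂ)) : ℝ := ∫ t, ‖g t‖ ^ 2

theorem energy_pos {g : 𝓢(EuclideanSpace ℝ ι, ℂ)} (hg : g ≠ 0) : 0 < energy g := by
  obtain ⟨t, ht⟩ : ∃ t, g t ≠ 0 := by
    by_contra! h
    exact hg (SchwartzMap.ext h)
  have hint : Integrable fun t => ‖g t‖ ^ 2 := by
    have := (g.memLp 2 volume).integrable_norm_pow (p := 2) (by norm_num)
    simpa using this
  refine (integral_pos_iff_support_of_nonneg (fun t => by positivity) hint).2 ?_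
  refine IsOpen.measure_pos _ ?_ ⟨t, by simpa using ht⟩
  exact (g.continuous.norm.pow 2).isOpen_support

/-- The pointwise reproducing formula for the test function: integrating out `ω` leaves `h t * ‖g (t
- x)‖ ^ 2`, and integrating out `x` gives the energy. -/
theorem integral_stftKernel_ambiguity (g h : 𝓢(EuclideanSpace ℝ ι, ℂ)) (t : EuclideanSpace ℝ ι) :
    ((energy g : ℂ) • h) t = ∫ z, stftKernel (ambiguity g h) g (join z t) := by
  rw [integral_join (integrable_section _ t)]
  simp_rw [stftKernel_join, fstL_join, sndL_join, ← mul_assoc]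
  have h1 : ∀ x : EuclideanSpace ℝ ι, ∫ ω, ((Real.fourierChar (-inner ℝ ω t) : Circle) : ℂ) *
      ambiguity g h (join x ω) * starRingEnd ℂ (g (t - x)) = h t * ((‖g (t - x)‖ ^ 2 : ℝ) : ℂ) := by
    intro x
    rw [integral_mul_const, integral_ambiguity, Complex.ofReal_pow, ← Complex.mul_conj']
    ring
  simp_rw [h1]
  rw [integral_const_mul, integral_sub_left_eq_self (fun x => ((‖g x‖ ^ 2 : ℝ) : ℂ)),
    integral_complex_ofReal]
  simp [energy, mul_comm]

/-- The reproducing formula for the short-time Fourier transform of a tempered distribution. -/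
theorem reproducing (g h : 𝓢(EuclideanSpace ℝ ι, ℂ)) (f : 𝓢'(EuclideanSpace ℝ ι, ℂ)) :
    (energy g : ℂ) * f h = ∫ z, ambiguity g h z * stft g f (fstL z) (sndL z) := by
  have := distribution_integral f (integral_stftKernel_ambiguity g h)
  rw [map_smul, smul_eq_mul] at this
  rw [this]
  refine integral_congr_ae (Filter.Eventually.of_forall fun z => ?_)
  exact sliceCLM_stftKernel (ambiguity g h) g f z

/-- Covariance under time-frequency shifts: after `t ↦ t + x₀` the characters of frequency `ω₀`
cancel, and only a unimodular constant remains. -/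
theorem norm_ambiguity_tfShift (g₀ g : 𝓢(EuclideanSpace ℝ ι, ℂ)) (x₀ ω₀ x ω : EuclideanSpace ℝ ι) :
    ‖ambiguity g₀ (conjSchwartz (tfShift x₀ ω₀ g)) (join (x + x₀) (ω + ω₀))‖ =
      ‖ambiguity g₀ (conjSchwartz g) (join x ω)‖ := by
  rw [ambiguity_join, ambiguity_join, ← integral_add_right_eq_self _ x₀]
  have : ∀ t, ((Real.fourierChar (inner ℝ (ω + ω₀) (t + x₀)) : Circle) : ℂ) *
      (g₀ (t + x₀ - (x + x₀)) * conjSchwartz (tfShift x₀ ω₀ g) (t + x₀)) =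
      ((Real.fourierChar (inner ℝ ω x₀) : Circle) : ℂ) *
        (((Real.fourierChar (inner ℝ ω t) : Circle) : ℂ) * (g₀ (t - x) * conjSchwartz g t)) := by
    intro t
    rw [conjSchwartz_apply, tfShift_apply, map_mul, conj_fourierChar, conjSchwartz_apply]
    rw [add_sub_add_right_eq_sub, add_sub_cancel_right]
    have e : inner ℝ (ω + ω₀) (t + x₀) = inner ℝ ω x₀ + (inner ℝ ω t + inner ℝ ω₀ (t + x₀)) := by
      rw [inner_add_left, inner_add_right ω]; ring
    rw [e, AddChar.map_add_eq_mul, AddChar.map_add_eq_mul, Circle.coe_mul, Circle.coe_mul]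
    have e2 : ((Real.fourierChar (inner ℝ ω₀ (t + x₀)) : Circle) : ℂ) *
        ((Real.fourierChar (-inner ℝ ω₀ (t + x₀)) : Circle) : ℂ) = 1 := by
      rw [← Circle.coe_mul, ← AddChar.map_add_eq_mul, add_neg_cancel]; simp
    linear_combination (((Real.fourierChar (inner ℝ ω x₀) : Circle) : ℂ) *
      (((Real.fourierChar (inner ℝ ω t) : Circle) : ℂ) *
        (g₀ (t - x) * starRingEnd ℂ (g t)))) * e2
  simp_rw [this]
  rw [integral_const_mul, norm_mul, Circle.norm_coe, one_mul]

/-- Pointwise domination of the short-time Fourier transform after a change of window. -/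
theorem enorm_stft_le (g₀ g : 𝓢(EuclideanSpace ℝ ι, ℂ)) (f : 𝓢'(EuclideanSpace ℝ ι, ℂ))
    (x₀ ω₀ : EuclideanSpace ℝ ι) :
    ENNReal.ofReal (energy g₀) * ‖stft g f x₀ ω₀‖ₑ ≤
      ∫⁻ ω, ∫⁻ x, ‖ambiguity g₀ (conjSchwartz g) (join x ω)‖ₑ *
        ‖stft g₀ f (x + x₀) (ω + ω₀)‖ₑ := by
  have h0 : 0 ≤ energy g₀ := integral_nonneg fun t => by positivity
  have h1 : ENNReal.ofReal (energy g₀) * ‖stft g f x₀ ω₀‖ₑ =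
      ‖(energy g₀ : ℂ) * f (conjSchwartz (tfShift x₀ ω₀ g))‖ₑ := by
    rw [enorm_mul, ← ofReal_norm (energy g₀ : ℂ), Complex.norm_real,
      Real.norm_of_nonneg h0]
    rfl
  rw [h1, reproducing, ← integral_add_right_eq_self _ (join x₀ ω₀)]
  refine (enorm_integral_le_lintegral_enorm _).trans (le_of_eq ?_)
  have hc : Continuous fun z : EuclideanSpace ℝ (ι ⊕ ι) =>
      ambiguity g₀ (conjSchwartz (tfShift x₀ ω₀ g)) (z + join x₀ ω₀) *
        stft g₀ f (fstL (z + join x₀ ω₀)) (sndL (z + join x₀ ω₀)) := by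
    have := ((ambiguity g₀ (conjSchwartz (tfShift x₀ ω₀ g))).continuous.mul
      (continuous_stft_fstL_sndL g₀ f)).comp (continuous_add_const (join x₀ ω₀))
    exact this
  rw [lintegral_join hc.enorm.measurable]
  refine lintegral_congr fun ω => lintegral_congr fun x => ?_
  rw [join_add_join, enorm_mul, fstL_join, sndL_join, ← ofReal_norm,
    norm_ambiguity_tfShift, ofReal_norm]

end Reproducing
end
end MWD

namespace MWD
noncomputable section

/-! ### Polynomial and moderate weights -/

section Weights

variable {ι κ : Type*} [Fintype ι] [Fintype κ]

theorem polyWeight_pos (s : ℝ) (z : EuclideanSpace ℝ ι) : 0 < polyWeight s z :=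
  Real.rpow_pos_of_pos (by positivity) _

theorem continuous_polyWeight (s : ℝ) : Continuous (polyWeight s : EuclideanSpace ℝ ι → ℝ) :=
  Continuous.rpow_const (by fun_prop) fun z => Or.inl (by positivity)

/-- A two-sided comparison is needed to treat both signs of the exponent: `h₁` serves `r ≥ 0` and
`h₂` serves `r ≤ 0`. -/
theorem rpow_le_rpow_abs {a b c : ℝ} (ha : 0 < a) (hb : 0 < b) (hc : 0 < c) (h₁ : a ≤ c * b)
    (h₂ : b ≤ c * a) (r : ℝ) : a ^ r ≤ c ^ |r| * b ^ r := by
  rcases le_total 0 r with hr | hr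
  · rw [abs_of_nonneg hr, ← Real.mul_rpow hc.le hb.le]
    exact Real.rpow_le_rpow ha.le h₁ hr
  · rw [abs_of_nonpos hr]
    have h3 : b ^ (-r) ≤ c ^ (-r) * a ^ (-r) := by
      rw [← Real.mul_rpow hc.le ha.le]
      exact Real.rpow_le_rpow hb.le h₂ (by linarith)
    have h4 : a ^ r = (a ^ (-r))⁻¹ := by rw [Real.rpow_neg ha.le, inv_inv]
    have h5 : b ^ r = (b ^ (-r))⁻¹ := by rw [Real.rpow_neg hb.le, inv_inv]
    have ha' := Real.rpow_pos_of_pos ha (-r)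
    have hb' := Real.rpow_pos_of_pos hb (-r)
    rw [h4, h5, inv_eq_one_div, div_le_iff₀ ha', mul_assoc, mul_comm _⁻¹, ← mul_assoc,
      ← div_eq_mul_inv, le_div_iff₀ hb', one_mul]
    exact h3

/-- Peetre's inequality. -/
theorem polyWeight_add_le (s : ℝ) (z w : EuclideanSpace ℝ ι) :
    polyWeight s (z + w) ≤ 2 ^ |s / 2| * polyWeight |s| z * polyWeight s w := by
  have key : ∀ a b : EuclideanSpace ℝ ι,
      1 + ‖a + b‖ ^ 2 ≤ 2 * (1 + ‖a‖ ^ 2) * (1 + ‖b‖ ^ 2) := by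
    intro a b
    have h := norm_add_le a b
    have h2 : ‖a + b‖ ^ 2 ≤ (‖a‖ + ‖b‖) ^ 2 := by gcongr
    nlinarith [sq_nonneg (‖a‖ - ‖b‖), mul_nonneg (sq_nonneg ‖a‖) (sq_nonneg ‖b‖)]
  -- The reverse comparison, for negative `s`, is the same inequality for `w = -z + (z + w)`.
  have h2 : 1 + ‖w‖ ^ 2 ≤ 2 * (1 + ‖z‖ ^ 2) * (1 + ‖z + w‖ ^ 2) := by
    have := key (-z) (z + w)
    rwa [neg_add_cancel_left, norm_neg] at this
  have h := rpow_le_rpow_abs (by positivity) (by positivity) (by positivity) (key z w) h2 (s / 2)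
  unfold polyWeight
  refine h.trans (le_of_eq ?_)
  rw [Real.mul_rpow (by norm_num) (by positivity)]
  congr 3
  rw [abs_div, abs_two]

theorem polyWeight_le_of_norm_le (s : ℝ) {c : ℝ} (hc : 1 ≤ c) {a : EuclideanSpace ℝ ι}
    {b : EuclideanSpace ℝ κ} (h₁ : ‖a‖ ≤ c * ‖b‖) (h₂ : ‖b‖ ≤ c * ‖a‖) :
    polyWeight s a ≤ (c ^ 2) ^ |s / 2| * polyWeight s b := by
  refine rpow_le_rpow_abs (by positivity) (by positivity) (by positivity) ?_ ?_ (s / 2)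
  · have : ‖a‖ ^ 2 ≤ (c * ‖b‖) ^ 2 := by gcongr
    nlinarith
  · have : ‖b‖ ^ 2 ≤ (c * ‖a‖) ^ 2 := by gcongr
    nlinarith

theorem polyWeight_abs_le (s : ℝ) (z : EuclideanSpace ℝ ι) :
    polyWeight |s| z ≤ (1 + ‖z‖) ^ ⌈|s|⌉₊ := by
  have h1 : 1 + ‖z‖ ^ 2 ≤ (1 + ‖z‖) ^ (2 : ℝ) := by
    rw [Real.rpow_two]; nlinarith [norm_nonneg z]
  calc polyWeight |s| z ≤ ((1 + ‖z‖) ^ (2 : ℝ)) ^ (|s| / 2) :=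
        Real.rpow_le_rpow (by positivity) h1 (by positivity)
    _ = (1 + ‖z‖) ^ |s| := by rw [← Real.rpow_mul (by positivity)]; ring_nf
    _ ≤ (1 + ‖z‖) ^ ((⌈|s|⌉₊ : ℕ) : ℝ) :=
        Real.rpow_le_rpow_of_exponent_le (le_add_of_nonneg_right (norm_nonneg z)) (Nat.le_ceil _)
    _ = _ := Real.rpow_natCast _ _

/-- Continuous weights that are moderate with respect to a polynomial. -/
structure IsModerate (m : EuclideanSpace ℝ ι → ℝ) : Prop where
  continuous : Continuous m
  nonneg : ∀ z, 0 ≤ m z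
  bound : ∃ (C : ℝ) (N : ℕ), 0 ≤ C ∧ ∀ z w, m (z + w) ≤ C * (1 + ‖z‖) ^ N * m w

theorem isModerate_polyWeight (s : ℝ) : IsModerate (polyWeight s : EuclideanSpace ℝ ι → ℝ) where
  continuous := continuous_polyWeight s
  nonneg z := (polyWeight_pos s z).le
  bound := ⟨2 ^ |s / 2|, ⌈|s|⌉₊, by positivity, fun z w => (polyWeight_add_le s z w).trans
    (mul_le_mul_of_nonneg_right (mul_le_mul_of_nonneg_left (polyWeight_abs_le s z) (by positivity))
      (polyWeight_pos s w).le)⟩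

theorem isModerate_one : IsModerate (fun _ : EuclideanSpace ℝ ι => (1 : ℝ)) where
  continuous := continuous_const
  nonneg _ := zero_le_one
  bound := ⟨1, 0, zero_le_one, fun z w => by simp⟩

theorem IsModerate.tensorWeight {u w : EuclideanSpace ℝ ι → ℝ} (hu : IsModerate u)
    (hw : IsModerate w) : IsModerate (tensorWeight u w) where
  continuous := (hu.continuous.comp fstL.continuous).mul (hw.continuous.comp sndL.continuous)
  nonneg z := mul_nonneg (hu.nonneg _) (hw.nonneg _)
  bound := by
    obtain ⟨C, N, hC, h⟩ := hu.bound
    obtain ⟨C', N', hC', h'⟩ := hw.bound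
    refine ⟨C * C', N + N', by positivity, fun a b => ?_⟩
    have h1 : ‖fstL a‖ ≤ ‖a‖ := by simpa using norm_fst_le (fstL a) (sndL a)
    have h2 : ‖sndL a‖ ≤ ‖a‖ := by simpa using norm_snd_le (fstL a) (sndL a)
    simp only [MWD.tensorWeight, map_add]
    have hub := hu.nonneg (fstL b)
    have hwb := hw.nonneg (sndL b)
    calc _ ≤ (C * (1 + ‖fstL a‖) ^ N * u (fstL b)) * (C' * (1 + ‖sndL a‖) ^ N' * w (sndL b)) :=
          mul_le_mul (h _ _) (h' _ _) (hw.nonneg _) (by positivity)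
      _ ≤ (C * (1 + ‖a‖) ^ N * u (fstL b)) * (C' * (1 + ‖a‖) ^ N' * w (sndL b)) := by gcongr
      _ = _ := by ring

end Weights

/-! ### Finiteness of mixed norms of Schwartz functions -/

section Decay

variable {ι : Type*} [Fintype ι]

theorem mixedNorm_tensor {X Y : Type*} [MeasureSpace X] [MeasureSpace Y] {p q : ℝ} (hp : 0 < p)
    (hq : 0 < q) {u : X → ℝ≥0∞} {v : Y → ℝ≥0∞} (hu : ∫⁻ x, u x ^ p < ∞) (hv : ∫⁻ y, v y ^ q < ∞)
    (hvt : ∀ y, v y ≠ ∞) : mixedNorm p q (fun x y => v y * u x) < ∞ := by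
  unfold mixedNorm
  simp_rw [ENNReal.mul_rpow_of_nonneg _ _ hp.le]
  have h1 : ∀ y, ∫⁻ x, v y ^ p * u x ^ p = v y ^ p * ∫⁻ x, u x ^ p := fun y =>
    lintegral_const_mul' _ _ (ENNReal.rpow_ne_top_of_nonneg hp.le (hvt y))
  simp_rw [h1, ENNReal.mul_rpow_of_nonneg _ _ (div_pos hq hp).le, ← ENNReal.rpow_mul,
    mul_div_cancel₀ q hp.ne']
  have hU : (∫⁻ x, u x ^ p) ^ (q / p) < ∞ :=
    ENNReal.rpow_lt_top_of_nonneg (div_pos hq hp).le hu.ne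
  rw [lintegral_mul_const' _ _ hU.ne]
  exact ENNReal.rpow_lt_top_of_nonneg (by positivity) (ENNReal.mul_lt_top hv hU).ne

/-- An integrable negative power of `1 + ‖x‖`. -/
def decayProfile (x : EuclideanSpace ℝ ι) : ℝ :=
  (1 + ‖x‖) ^ (-((volume : Measure (EuclideanSpace ℝ ι)).integrablePower : ℝ))

/-- The profile is at most one, so its powers with exponent at least one are dominated by the
profile itself, and one choice of decay serves all exponents. -/
theorem lintegral_decayProfile_rpow_lt_top {r : ℝ} (hr : 1 ≤ r) :
    ∫⁻ x : EuclideanSpace ℝ ι, ENNReal.ofReal (decayProfile x) ^ r < ∞ := by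
  have h1 : Integrable (decayProfile : EuclideanSpace ℝ ι → ℝ) :=
    Measure.integrable_pow_neg_integrablePower volume
  refine lt_of_le_of_lt (lintegral_mono fun x => ?_) h1.lintegral_lt_top
  have h2 : ENNReal.ofReal (decayProfile x) ≤ 1 := by
    rw [ENNReal.ofReal_le_one]
    exact Real.rpow_le_one_of_one_le_of_nonpos (by linarith [norm_nonneg x]) (by simp)
  calc _ ≤ ENNReal.ofReal (decayProfile x) ^ (1 : ℝ) := ENNReal.rpow_le_rpow_of_exponent_ge h2 hr
    _ = _ := ENNReal.rpow_one _

theorem exists_decayProfile_bound (φ : 𝓢(EuclideanSpace ℝ (ι ⊕ ι), ℂ)) (N : ℕ) :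
    ∃ C : ℝ≥0∞, C ≠ ∞ ∧ ∀ x y : EuclideanSpace ℝ ι,
      ‖φ (join x y)‖ₑ * ENNReal.ofReal ((1 + ‖join x y‖) ^ N) ≤
        C * (ENNReal.ofReal (decayProfile x) * ENNReal.ofReal (decayProfile y)) := by
  let k := (volume : Measure (EuclideanSpace ℝ ι)).integrablePower
  -- `N` powers absorb the weight; `k` powers each give the decay in `x` and in `y`.
  obtain ⟨C, hC0, hC⟩ := exists_one_add_norm_pow_mul_le φ (N + (k + k)) 0
  refine ⟨ENNReal.ofReal C, ENNReal.ofReal_ne_top, fun x y => ?_⟩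
  have hdx : decayProfile x = ((1 + ‖x‖) ^ k)⁻¹ := by
    rw [decayProfile, Real.rpow_neg (by positivity), Real.rpow_natCast]
  have hdy : decayProfile y = ((1 + ‖y‖) ^ k)⁻¹ := by
    rw [decayProfile, Real.rpow_neg (by positivity), Real.rpow_natCast]
  rw [← ofReal_norm, ← ENNReal.ofReal_mul (norm_nonneg _),
    ← ENNReal.ofReal_mul (by rw [hdx]; positivity), ← ENNReal.ofReal_mul hC0]
  refine ENNReal.ofReal_le_ofReal ?_
  have h := hC (join x y)
  rw [norm_iteratedFDeriv_zero, pow_add, pow_add] at h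
  rw [hdx, hdy, ← mul_inv, ← div_eq_mul_inv, le_div_iff₀ (by positivity)]
  refine le_trans ?_ h
  calc _ ≤ ‖φ (join x y)‖ * (1 + ‖join x y‖) ^ N *
        ((1 + ‖join x y‖) ^ k * (1 + ‖join x y‖) ^ k) := by
        gcongr
        · exact norm_fst_le x y
        · exact norm_snd_le x y
    _ = _ := by ring

/-- The dominating function is a product, so the norm factors in either order of integration: the
first is used for modulation norms, the second for amalgam norms. -/
theorem mixedNorm_schwartz_lt_top (φ : 𝓢(EuclideanSpace ℝ (ι ⊕ ι), ℂ)) (N : ℕ) {p q : ℝ}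
    (hp : 1 ≤ p) (hq : 1 ≤ q) :
    mixedNorm p q (fun x y : EuclideanSpace ℝ ι =>
        ‖φ (join x y)‖ₑ * ENNReal.ofReal ((1 + ‖join x y‖) ^ N)) < ∞ ∧
      mixedNorm p q (fun y x : EuclideanSpace ℝ ι =>
        ‖φ (join x y)‖ₑ * ENNReal.ofReal ((1 + ‖join x y‖) ^ N)) < ∞ := by
  obtain ⟨C, hC, h⟩ := exists_decayProfile_bound φ N
  have hp0 : 0 < p := by linarith
  have hq0 : 0 < q := by linarith
  have hfin := mixedNorm_tensor hp0 hq0 (lintegral_decayProfile_rpow_lt_top (ι := ι) hp)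
    (lintegral_decayProfile_rpow_lt_top (ι := ι) hq) (fun _ => ENNReal.ofReal_ne_top)
  constructor
  · refine (mixedNorm_mono hp0.le hq0.le fun x y => (h x y).trans_eq
      (by rw [mul_comm (ENNReal.ofReal (decayProfile x))])).trans_lt ?_
    rw [mixedNorm_const_mul hp0 hq0 C hC]
    exact ENNReal.mul_lt_top hC.lt_top hfin
  · refine (mixedNorm_mono hp0.le hq0.le fun y x => h x y).trans_lt ?_
    rw [mixedNorm_const_mul hp0 hq0 C hC]
    exact ENNReal.mul_lt_top hC.lt_top hfin

end Decay

/-! ### Independence of the window and inclusions between the spaces -/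

section Inclusion

variable {ι : Type*} [Fintype ι]

theorem modulationNorm_eq (g : 𝓢(EuclideanSpace ℝ ι, ℂ)) {p : ℝ} (hp : 0 ≤ p) (q : ℝ)
    (m : EuclideanSpace ℝ (ι ⊕ ι) → ℝ) (f : 𝓢'(EuclideanSpace ℝ ι, ℂ)) :
    modulationNorm g p q m f =
      mixedNorm p q fun x ω => ‖stft g f x ω‖ₑ * ENNReal.ofReal (m (join x ω)) := by
  simp_rw [modulationNorm, mixedNorm, ENNReal.mul_rpow_of_nonneg _ _ hp]

/-- The outer weight is constant in the inner variable and can be moved inside. Amalgam norms thus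
become mixed norms with `x` and `ω` exchanged, and share the theory of modulation norms. -/
theorem amalgamNorm_eq (g : 𝓢(EuclideanSpace ℝ ι, ℂ)) {p q : ℝ} (hp : 0 < p) (hq : 0 ≤ q)
    (w : EuclideanSpace ℝ ι → ℝ) (f : 𝓢'(EuclideanSpace ℝ ι, ℂ)) :
    amalgamNorm g p q (fun _ => 1) w f =
      mixedNorm p q fun ω x => ‖stft g f x ω‖ₑ *
        ENNReal.ofReal (tensorWeight w (fun _ => 1) (join x ω)) := by
  simp only [amalgamNorm, mixedNorm, tensorWeight, fstL_join, mul_one, ENNReal.ofReal_one,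
    ENNReal.one_rpow, ENNReal.mul_rpow_of_nonneg _ _ hp.le]
  congr 1
  refine lintegral_congr fun x => ?_
  rw [lintegral_mul_const' _ _ (ENNReal.rpow_ne_top_of_nonneg hp.le ENNReal.ofReal_ne_top),
    ENNReal.mul_rpow_of_nonneg _ _ (by positivity), ← ENNReal.rpow_mul, mul_div_cancel₀ q hp.ne']

theorem measurable_stft_weight (g : 𝓢(EuclideanSpace ℝ ι, ℂ)) (f : 𝓢'(EuclideanSpace ℝ ι, ℂ))
    {m : EuclideanSpace ℝ (ι ⊕ ι) → ℝ} (hm : Continuous m) :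
    Measurable (Function.uncurry fun x ω => ‖stft g f x ω‖ₑ * ENNReal.ofReal (m (join x ω))) :=
  (continuous_stft g f).enorm.measurable.mul
    (ENNReal.measurable_ofReal.comp (hm.comp continuous_join).measurable)

/-- Weighted pointwise domination of the short-time Fourier transform after a change of window. -/
theorem exists_stft_domination {g₀ : 𝓢(EuclideanSpace ℝ ι, ℂ)} (hg₀ : g₀ ≠ 0)
    (g : 𝓢(EuclideanSpace ℝ ι, ℂ)) {m : EuclideanSpace ℝ (ι ⊕ ι) → ℝ} (hm : IsModerate m) :
    ∃ (C : ℝ≥0∞) (N : ℕ), C ≠ ∞ ∧ ∀ (f : 𝓢'(EuclideanSpace ℝ ι, ℂ)) (x ω : EuclideanSpace ℝ ι),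
      ‖stft g f x ω‖ₑ * ENNReal.ofReal (m (join x ω)) ≤ C * ∫⁻ ω', ∫⁻ x',
        (‖ambiguity g₀ (conjSchwartz g) (join x' ω')‖ₑ *
            ENNReal.ofReal ((1 + ‖join x' ω'‖) ^ N)) *
          (‖stft g₀ f (x' + x) (ω' + ω)‖ₑ *
            ENNReal.ofReal (m (join (x' + x) (ω' + ω)))) := by
  obtain ⟨C, N, hC, h⟩ := hm.bound
  have hE := energy_pos hg₀
  have hE0 : ENNReal.ofReal (energy g₀) ≠ 0 := by simpa using hE
  refine ⟨(ENNReal.ofReal (energy g₀))⁻¹ * ENNReal.ofReal C, N,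
    ENNReal.mul_ne_top (ENNReal.inv_ne_top.2 hE0) ENNReal.ofReal_ne_top, fun f x ω => ?_⟩
  have h1 := enorm_stft_le g₀ g f x ω
  rw [mul_comm, ← ENNReal.le_div_iff_mul_le (Or.inl hE0) (Or.inl ENNReal.ofReal_ne_top),
    ENNReal.div_eq_inv_mul] at h1
  calc _ ≤ ((ENNReal.ofReal (energy g₀))⁻¹ * ∫⁻ ω', ∫⁻ x',
        ‖ambiguity g₀ (conjSchwartz g) (join x' ω')‖ₑ * ‖stft g₀ f (x' + x) (ω' + ω)‖ₑ) *
        ENNReal.ofReal (m (join x ω)) := by gcongr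
    _ = (ENNReal.ofReal (energy g₀))⁻¹ * ∫⁻ ω', ∫⁻ x',
        ‖ambiguity g₀ (conjSchwartz g) (join x' ω')‖ₑ * ‖stft g₀ f (x' + x) (ω' + ω)‖ₑ *
        ENNReal.ofReal (m (join x ω)) := by
      rw [mul_assoc, ← lintegral_mul_const' _ _ ENNReal.ofReal_ne_top]
      simp_rw [lintegral_mul_const' _ _ (ENNReal.ofReal_ne_top (r := m (join x ω)))]
    _ ≤ (ENNReal.ofReal (energy g₀))⁻¹ * ∫⁻ ω', ∫⁻ x', ENNReal.ofReal C *
        ((‖ambiguity g₀ (conjSchwartz g) (join x' ω')‖ₑ *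
            ENNReal.ofReal ((1 + ‖join x' ω'‖) ^ N)) *
          (‖stft g₀ f (x' + x) (ω' + ω)‖ₑ *
            ENNReal.ofReal (m (join (x' + x) (ω' + ω))))) := by
      refine mul_le_mul_right (lintegral_mono fun ω' => lintegral_mono fun x' => ?_) _
      -- Moderateness for the shift by `-(x', ω')`: the polynomial goes to the Schwartz kernel and
      -- the weight follows the shifted transform.
      have h2 : m (join x ω) ≤ C * (1 + ‖join x' ω'‖) ^ N * m (join (x' + x) (ω' + ω)) := by
        have := h (-(join x' ω')) (join x' ω' + join x ω)
        rwa [neg_add_cancel_left, norm_neg, join_add_join] at this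
      calc _ ≤ ‖ambiguity g₀ (conjSchwartz g) (join x' ω')‖ₑ * ‖stft g₀ f (x' + x) (ω' + ω)‖ₑ *
            ENNReal.ofReal (C * (1 + ‖join x' ω'‖) ^ N * m (join (x' + x) (ω' + ω))) :=
            mul_le_mul_right (ENNReal.ofReal_le_ofReal h2) _
        _ = _ := by
            rw [ENNReal.ofReal_mul (by positivity), ENNReal.ofReal_mul hC]
            ring
    _ = _ := by
      simp_rw [lintegral_const_mul' _ _ (ENNReal.ofReal_ne_top (r := C)), mul_assoc]

/-- The exponent `a` of the kernel that lets a correlation raise `p` to `p'`; for `p = p'` it is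
`1`. -/
theorem exists_young_exponent {p p' : ℝ} (hp : 1 ≤ p) (hpp : p ≤ p') :
    ∃ a : ℝ, 1 ≤ a ∧ 1 / a + 1 / p = 1 + 1 / p' := by
  have hp0 : 0 < p := by linarith
  have hp'0 : 0 < p' := by linarith
  have h1 : 1 / p ≤ 1 := by rw [div_le_one hp0]; exact hp
  have h2 : 1 / p' ≤ 1 / p := one_div_le_one_div_of_le hp0 hpp
  have h3 : 0 < 1 / p' := by positivity
  have h4 : 0 < 1 + 1 / p' - 1 / p := by linarith
  refine ⟨(1 + 1 / p' - 1 / p)⁻¹, (one_le_inv₀ h4).2 (by linarith), ?_⟩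
  rw [one_div, inv_inv]; ring

/-- Modulation norms with respect to two windows, with growing exponents. -/
theorem exists_modulationNorm_le {g₀ : 𝓢(EuclideanSpace ℝ ι, ℂ)} (hg₀ : g₀ ≠ 0)
    (g : 𝓢(EuclideanSpace ℝ ι, ℂ)) {m : EuclideanSpace ℝ (ι ⊕ ι) → ℝ} (hm : IsModerate m)
    {p q p' q' : ℝ} (hp : 1 ≤ p) (hq : 1 ≤ q) (hpp : p ≤ p') (hqq : q ≤ q') :
    ∃ C : ℝ≥0, ∀ f, modulationNorm g p' q' m f ≤ C * modulationNorm g₀ p q m f := by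
  obtain ⟨C, N, hC, h⟩ := exists_stft_domination hg₀ g hm
  obtain ⟨a, ha, hap⟩ := exists_young_exponent hp hpp
  obtain ⟨b, hb, hbq⟩ := exists_young_exponent hq hqq
  have hfin := (mixedNorm_schwartz_lt_top (ambiguity g₀ (conjSchwartz g)) N ha hb).1
  obtain ⟨K, hK⟩ : ∃ K : ℝ≥0, (K : ℝ≥0∞) = C * _ :=
    ⟨_, ENNReal.coe_toNNReal (ENNReal.mul_ne_top hC hfin.ne)⟩
  refine ⟨K, fun f => ?_⟩
  rw [hK, modulationNorm_eq g (by linarith),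
    modulationNorm_eq g₀ (by linarith), mul_assoc]
  refine (mixedNorm_mono (by linarith) (by linarith) (h f)).trans ?_
  rw [mixedNorm_const_mul (by linarith) (by linarith) C hC]
  gcongr
  refine mixedNorm_correlation_le ha hb hp hq (by linarith) (by linarith) hap hbq ?_
    (measurable_stft_weight g₀ f hm.continuous)
  exact ((SchwartzMap.continuous _).comp continuous_join).enorm.measurable.mul
    (ENNReal.measurable_ofReal.comp
      ((continuous_const.add continuous_join.norm).pow N).measurable)

/-- Amalgam norms with respect to two windows, with growing exponents. -/
theorem exists_amalgamNorm_le {g₀ : 𝓢(EuclideanSpace ℝ ι, ℂ)} (hg₀ : g₀ ≠ 0)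
    (g : 𝓢(EuclideanSpace ℝ ι, ℂ)) {w : EuclideanSpace ℝ ι → ℝ} (hw : IsModerate w)
    {p q p' q' : ℝ} (hp : 1 ≤ p) (hq : 1 ≤ q) (hpp : p ≤ p') (hqq : q ≤ q') :
    ∃ C : ℝ≥0, ∀ f, amalgamNorm g p' q' (fun _ => 1) w f ≤
      C * amalgamNorm g₀ p q (fun _ => 1) w f := by
  have hm := hw.tensorWeight isModerate_one
  obtain ⟨C, N, hC, h⟩ := exists_stft_domination hg₀ g hm
  obtain ⟨a, ha, hap⟩ := exists_young_exponent hp hpp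
  obtain ⟨b, hb, hbq⟩ := exists_young_exponent hq hqq
  have hfin := (mixedNorm_schwartz_lt_top (ambiguity g₀ (conjSchwartz g)) N ha hb).2
  obtain ⟨K, hK⟩ : ∃ K : ℝ≥0, (K : ℝ≥0∞) = C * _ :=
    ⟨_, ENNReal.coe_toNNReal (ENNReal.mul_ne_top hC hfin.ne)⟩
  have hA : Measurable (Function.uncurry fun x' ω' : EuclideanSpace ℝ ι =>
      ‖ambiguity g₀ (conjSchwartz g) (join x' ω')‖ₑ *
        ENNReal.ofReal ((1 + ‖join x' ω'‖) ^ N)) :=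
    ((SchwartzMap.continuous _).comp continuous_join).enorm.measurable.mul
      (ENNReal.measurable_ofReal.comp
        ((continuous_const.add continuous_join.norm).pow N).measurable)
  refine ⟨K, fun f => ?_⟩
  have hV := measurable_stft_weight g₀ f hm.continuous
  rw [hK, amalgamNorm_eq g (by linarith) (by linarith),
    amalgamNorm_eq g₀ (by linarith) (by linarith), mul_assoc]
  refine (mixedNorm_mono (by linarith) (by linarith) fun ω x => h f x ω).trans ?_
  rw [mixedNorm_const_mul (by linarith) (by linarith) C hC]
  gcongr
  exact mixedNorm_correlation_swap_le ha hb hp hq (by linarith) (by linarith) hap hbq hA hV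

end Inclusion
end
end MWD

namespace MWD
noncomputable section

/-! ### The short-time Fourier transform of a matrix-Wigner distribution -/

section Wigner

variable {ι : Type*} [Fintype ι]

/-- Fourier inversion in the second variable. It is used to build a window with prescribed partial
Fourier transform. -/
theorem partialFourierCLM_reflectSnd (Ψ : 𝓢(EuclideanSpace ℝ (ι ⊕ ι), ℂ))
    (a b : EuclideanSpace ℝ ι) :
    partialFourierCLM (SchwartzMap.compCLMOfContinuousLinearEquiv ℂ reflectSnd
      (partialFourierCLM Ψ)) (join a b) = Ψ (join a b) := by
  have h1 : 𝓕⁻ (𝓕 (sectionCLM a Ψ)) b = Ψ (join a b) := by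
    rw [FourierTransform.fourierInv_fourier_eq, sectionCLM_apply]
  rw [← h1, SchwartzMap.fourierInv_coe, Real.fourierInv_eq, ← integral_neg_eq_self,
    partialFourierCLM_apply]
  refine integral_congr_ae (Filter.Eventually.of_forall fun ω => ?_)
  simp only [SchwartzMap.compCLMOfContinuousLinearEquiv_apply, Function.comp_apply,
    reflectSnd_join, partialFourierCLM_section, inner_neg_left]

/-- The substitution `y ↦ y + ω` turns the translation by `ω` into a phase and the modulation by `η`
into a translation. The two conjugations cancel, so the right side involves `Φ` itself. -/
theorem partialFourierCLM_conj_tfShift (Φ : 𝓢(EuclideanSpace ℝ (ι ⊕ ι), ℂ))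
    (x ω ξ η x' ω' : EuclideanSpace ℝ ι) :
    partialFourierCLM (conjSchwartz (tfShift (join x ω) (join ξ η) (conjSchwartz Φ)))
        (join x' ω') =
      ((Real.fourierChar (-inner ℝ ξ x' - inner ℝ ω (ω' + η)) : Circle) : ℂ) *
        partialFourierCLM Φ (join (x' - x) (ω' + η)) := by
  rw [partialFourierCLM_apply, partialFourierCLM_apply, ← integral_const_mul,
    ← integral_add_right_eq_self _ ω]
  refine integral_congr_ae (Filter.Eventually.of_forall fun y => ?_)
  simp only [conjSchwartz_apply, tfShift_apply, map_mul, conj_fourierChar, Complex.conj_conj,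
    Circle.smul_def, smul_eq_mul, inner_join, join_sub_join, add_sub_cancel_right]
  rw [← mul_assoc, ← mul_assoc]
  congr 1
  rw [← Circle.coe_mul, ← Circle.coe_mul, ← AddChar.map_add_eq_mul, ← AddChar.map_add_eq_mul]
  congr 2
  simp only [inner_add_left, inner_add_right, real_inner_comm y η, real_inner_comm ω η]
  ring

variable [DecidableEq ι]

/-- The linear map of Euclidean space given by the matrix `M - I/2`. -/
def lowerL (M : Matrix ι ι ℝ) : EuclideanSpace ℝ ι →L[ℝ] EuclideanSpace ℝ ι :=
  Matrix.toEuclideanCLM (𝕜 := ℝ) (n := ι) (M - (1 / 2 : ℝ) • 1)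

theorem lowerL_apply (M : Matrix ι ι ℝ) (x : EuclideanSpace ℝ ι) :
    lowerL M x = WithLp.toLp 2 ((M - (1 / 2 : ℝ) • 1).mulVec x) := rfl

theorem lowerL_add_self (M : Matrix ι ι ℝ) (x : EuclideanSpace ℝ ι) :
    lowerL M x + x = WithLp.toLp 2 ((M + (1 / 2 : ℝ) • 1).mulVec x) := by
  have h : M + (1 / 2 : ℝ) • 1 = (M - (1 / 2 : ℝ) • 1) + 1 := by
    have : (1 / 2 : ℝ) • 1 + (1 / 2 : ℝ) • 1 = (1 : Matrix ι ι ℝ) := by rw [← add_smul]; norm_num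
    rw [sub_add_eq_add_sub, eq_sub_iff_add_eq, add_assoc, this]
  rw [h, Matrix.add_mulVec, Matrix.one_mulVec, lowerL_apply]
  rfl

theorem glEquiv_cohenMatrix_join (M : Matrix ι ι ℝ) (a b : EuclideanSpace ℝ ι) :
    glEquiv (cohenMatrix M) (join a b) = join (a + (lowerL M b + b)) (a + lowerL M b) := by
  rw [lowerL_add_self, lowerL_apply, glEquiv_apply]
  change WithLp.toLp 2 ((Matrix.fromBlocks 1 (M + (1 / 2 : ℝ) • 1) 1
    (M - (1 / 2 : ℝ) • 1)).mulVec (Sum.elim a b)) = _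
  rw [Matrix.fromBlocks_mulVec]
  ext i
  cases i <;> simp

theorem glEquiv_cohenMatrix_inv_join (M : Matrix ι ι ℝ) (u v : EuclideanSpace ℝ ι) :
    glEquiv (cohenMatrix M)⁻¹ (join u v) = join (lowerL M v + v - lowerL M u) (u - v) := by
  rw [lowerL_add_self, lowerL_apply, glEquiv_apply]
  change WithLp.toLp 2 ((Matrix.fromBlocks (-(M - (1 / 2 : ℝ) • 1)) (M + (1 / 2 : ℝ) • 1) 1
    (-1)).mulVec (Sum.elim u v)) = _
  rw [Matrix.fromBlocks_mulVec]
  ext i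
  cases i
  · simp [-neg_sub, Matrix.neg_mulVec, ← sub_eq_neg_add]
  · simp [Matrix.neg_mulVec, ← sub_eq_add_neg]

/-- The Schwartz function whose partial Fourier transform is
`(a, b) ↦ conj g₁ (a + (M + I/2) b) g₂ (a + (M - I/2) b)`. -/
def wignerWindowConj (M : Matrix ι ι ℝ) (g₁ g₂ : 𝓢(EuclideanSpace ℝ ι, ℂ)) :
    𝓢(EuclideanSpace ℝ (ι ⊕ ι), ℂ) :=
  SchwartzMap.compCLMOfContinuousLinearEquiv ℂ reflectSnd (partialFourierCLM
    (SchwartzMap.compCLMOfContinuousLinearEquiv ℂ (glEquiv (cohenMatrix M))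
      (tensorSchwartz (conjSchwartz g₁) g₂)))

theorem partialFourierCLM_wignerWindowConj (M : Matrix ι ι ℝ) (g₁ g₂ : 𝓢(EuclideanSpace ℝ ι, ℂ))
    (a b : EuclideanSpace ℝ ι) :
    partialFourierCLM (wignerWindowConj M g₁ g₂) (join a b) =
      starRingEnd ℂ (g₁ (a + (lowerL M b + b))) * g₂ (a + lowerL M b) := by
  rw [wignerWindowConj, partialFourierCLM_reflectSnd]
  simp only [SchwartzMap.compCLMOfContinuousLinearEquiv_apply, Function.comp_apply,
    glEquiv_cohenMatrix_join, tensorSchwartz_apply, fstL_join, sndL_join, conjSchwartz_apply]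

/-- A window adapted to the matrix-Wigner distribution. -/
def wignerWindow (M : Matrix ι ι ℝ) (g₁ g₂ : 𝓢(EuclideanSpace ℝ ι, ℂ)) :
    𝓢(EuclideanSpace ℝ (ι ⊕ ι), ℂ) :=
  conjSchwartz (wignerWindowConj M g₁ g₂)

/-- At `A_M⁻¹(u, v)` the partial Fourier transform of the conjugate window is `conj (g₁ u) * g₂ v`.
Nonvanishing is what allows a change from this window to an arbitrary one. -/
theorem wignerWindow_ne_zero (M : Matrix ι ι ℝ) {g₁ g₂ : 𝓢(EuclideanSpace ℝ ι, ℂ)} (hg₁ : g₁ ≠ 0)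
    (hg₂ : g₂ ≠ 0) : wignerWindow M g₁ g₂ ≠ 0 := by
  intro h
  obtain ⟨u, hu⟩ : ∃ u, g₁ u ≠ 0 := by by_contra! H; exact hg₁ (SchwartzMap.ext H)
  obtain ⟨v, hv⟩ : ∃ v, g₂ v ≠ 0 := by by_contra! H; exact hg₂ (SchwartzMap.ext H)
  have h0 : wignerWindowConj M g₁ g₂ = 0 := by
    ext z
    have := congrArg (fun φ : 𝓢(EuclideanSpace ℝ (ι ⊕ ι), ℂ) => φ z) h
    simpa [wignerWindow] using this
  have h1 := partialFourierCLM_wignerWindowConj M g₁ g₂ (lowerL M v + v - lowerL M u) (u - v)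
  rw [h0, map_zero] at h1
  have e1 : lowerL M v + v - lowerL M u + (lowerL M (u - v) + (u - v)) = u := by
    rw [map_sub]; abel
  have e2 : lowerL M v + v - lowerL M u + lowerL M (u - v) = v := by
    rw [map_sub]; abel
  rw [e1, e2] at h1
  exact mul_ne_zero ((map_ne_zero _).2 hu) hv h1.symm

/-- The short-time Fourier transform of a matrix-Wigner distribution of Cohen type. -/
theorem norm_stft_matrixWigner (M : Matrix ι ι ℝ) (g₁ g₂ : 𝓢(EuclideanSpace ℝ ι, ℂ))
    (f₁ f₂ : 𝓢'(EuclideanSpace ℝ ι, ℂ)) (x ω ξ η : EuclideanSpace ℝ ι) :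
    ‖stft (wignerWindow M g₁ g₂) (matrixWigner (cohenMatrix M) f₁ f₂) (join x ω) (join ξ η)‖ =
      |(cohenMatrix M).val.det|⁻¹ *
        (‖stft g₁ f₁ (x - (lowerL M η + η)) (ω - (lowerL M).adjoint ξ)‖ *
          ‖stft g₂ f₂ (x - lowerL M η) (ω - (lowerL M).adjoint ξ - ξ)‖) := by
  set T := conjSchwartz (tfShift (join x ω) (join ξ η) (wignerWindow M g₁ g₂)) with hT
  set α := x - (lowerL M η + η)
  set β := ω - (lowerL M).adjoint ξ
  -- The test function against which `f₁ ⊗ conj f₂` is evaluated, once `𝓕₂` and the coordinate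
  -- change have been transposed, is a pure tensor up to a phase.
  have key : SchwartzMap.compCLMOfContinuousLinearEquiv ℂ (glEquiv (cohenMatrix M)⁻¹)
      (partialFourierCLM T) = ((Real.fourierChar (-inner ℝ ω η) : Circle) : ℂ) •
        tensorSchwartz (conjSchwartz (tfShift α β g₁)) (tfShift (x - lowerL M η) (β - ξ) g₂) := by
    ext w
    obtain ⟨u, v, rfl⟩ : ∃ u v, w = join u v := ⟨_, _, (join_fstL_sndL w).symm⟩
    rw [SchwartzMap.compCLMOfContinuousLinearEquiv_apply, Function.comp_apply,
      glEquiv_cohenMatrix_inv_join, hT, wignerWindow, partialFourierCLM_conj_tfShift,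
      partialFourierCLM_wignerWindowConj, smul_apply, tensorSchwartz_apply, fstL_join, sndL_join,
      conjSchwartz_apply, tfShift_apply, tfShift_apply, map_mul, conj_fourierChar, smul_eq_mul]
    have e1 : lowerL M v + v - lowerL M u - x + (lowerL M (u - v + η) + (u - v + η)) = u - α := by
      simp only [map_add, map_sub, α]; abel
    have e2 : lowerL M v + v - lowerL M u - x + lowerL M (u - v + η) = v - (x - lowerL M η) := by
      simp only [map_add, map_sub]; abel
    -- Collecting the phase in `u` and in `v` identifies the two frequencies; moving `lowerL M`
    -- across the inner product is where its adjoint enters.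
    have e3 : ((Real.fourierChar (-inner ℝ ξ (lowerL M v + v - lowerL M u) -
        inner ℝ ω (u - v + η)) : Circle) : ℂ) = ((Real.fourierChar (-inner ℝ ω η) : Circle) : ℂ) *
        (((Real.fourierChar (-inner ℝ β u) : Circle) : ℂ) *
          ((Real.fourierChar (inner ℝ (β - ξ) v) : Circle) : ℂ)) := by
      rw [← Circle.coe_mul, ← Circle.coe_mul, ← AddChar.map_add_eq_mul, ← AddChar.map_add_eq_mul]
      congr 2
      simp only [β, inner_add_right, inner_sub_right, inner_sub_left,
        ContinuousLinearMap.adjoint_inner_left]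
      ring
    rw [e1, e2, e3]; ring
  have h1 : stft (wignerWindow M g₁ g₂) (matrixWigner (cohenMatrix M) f₁ f₂) (join x ω)
      (join ξ η) = ((|(cohenMatrix M).val.det|⁻¹ : ℝ) : ℂ) *
        f₁ (sliceCLM (conjDist f₂) (SchwartzMap.compCLMOfContinuousLinearEquiv ℂ
          (glEquiv (cohenMatrix M)⁻¹) (partialFourierCLM T))) := rfl
  -- Evaluating `conj f₂` on a shift of `g₂` gives the conjugate of a short-time Fourier transform,
  -- which is a scalar that comes out of `f₁`.
  have h2 : sliceCLM (conjDist f₂) (tensorSchwartz (conjSchwartz (tfShift α β g₁))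
      (tfShift (x - lowerL M η) (β - ξ) g₂)) =
      starRingEnd ℂ (stft g₂ f₂ (x - lowerL M η) (β - ξ)) • conjSchwartz (tfShift α β g₁) := by
    ext t
    rw [sliceCLM_apply]
    have : sectionCLM t (tensorSchwartz (conjSchwartz (tfShift α β g₁))
      (tfShift (x - lowerL M η) (β - ξ) g₂)) =
        conjSchwartz (tfShift α β g₁) t • tfShift (x - lowerL M η) (β - ξ) g₂ := by
      ext v; simp
    rw [this, map_smul, conjDist_apply, smul_apply, smul_eq_mul, smul_eq_mul, mul_comm]
    rfl
  rw [h1, key, map_smul, h2, map_smul, map_smul, norm_mul, norm_smul, norm_smul, Circle.norm_coe,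
    one_mul, Complex.norm_real, Real.norm_of_nonneg (by positivity), RCLike.norm_conj,
    mul_comm ‖stft g₂ f₂ _ _‖]
  rfl

end Wigner
end
end MWD

namespace MWD
noncomputable section

/-! ### Linear changes of variables in integrals and mixed norms -/

section ChangeOfVariables

variable {E : Type*} [NormedAddCommGroup E] [InnerProductSpace ℝ E] [FiniteDimensional ℝ E]
  [MeasurableSpace E] [BorelSpace E]

theorem exists_lintegral_comp_equiv (e : E ≃L[ℝ] E) :
    ∃ c : ℝ≥0, ∀ φ : E → ℝ≥0∞, ∫⁻ x, φ (e x) = c * ∫⁻ x, φ x := by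
  have hdet : LinearMap.det (e.toLinearEquiv : E →ₗ[ℝ] E) ≠ 0 :=
    (LinearEquiv.isUnit_det' e.toLinearEquiv).ne_zero
  refine ⟨Real.toNNReal |(LinearMap.det (e.toLinearEquiv : E →ₗ[ℝ] E))⁻¹|, fun φ => ?_⟩
  have h := Measure.map_linearMap_addHaar_eq_smul_addHaar (volume : Measure E) hdet
  -- Transport along a measurable equivalence is valid for arbitrary `φ`, so no measurability is
  -- assumed.
  have h2 : ∫⁻ x, φ x ∂(Measure.map e.toHomeomorph.toMeasurableEquiv volume) = ∫⁻ x, φ (e x) :=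
    lintegral_map_equiv _ _
  rw [← h2]
  change ∫⁻ x, φ x ∂(Measure.map (e.toLinearEquiv : E →ₗ[ℝ] E) volume) = _
  rw [h, lintegral_smul_measure]
  rfl

theorem exists_lintegral_lintegral_comp_equiv (e f : E ≃L[ℝ] E) :
    ∃ c : ℝ≥0, ∀ φ : E → E → ℝ≥0∞, ∫⁻ y, ∫⁻ x, φ (e x) (f y) = c * ∫⁻ y, ∫⁻ x, φ x y := by
  obtain ⟨c, hc⟩ := exists_lintegral_comp_equiv e
  obtain ⟨c', hc'⟩ := exists_lintegral_comp_equiv f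
  refine ⟨c * c', fun φ => ?_⟩
  have h : ∀ y, ∫⁻ x, φ (e x) y = c * ∫⁻ x, φ x y := fun y => hc fun x => φ x y
  simp_rw [h]
  rw [lintegral_const_mul' _ _ ENNReal.coe_ne_top, hc' fun y => ∫⁻ x, φ x y, ENNReal.coe_mul,
    mul_assoc]

theorem exists_mixedNorm_comp_equiv (e f : E ≃L[ℝ] E) {p q : ℝ} (hp : 0 < p) (hq : 0 < q) :
    ∃ c : ℝ≥0, ∀ H : E → E → ℝ≥0∞,
      mixedNorm p q (fun x y => H (e x) (f y)) = c * mixedNorm p q H := by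
  obtain ⟨c, hc⟩ := exists_lintegral_comp_equiv e
  obtain ⟨c', hc'⟩ := exists_lintegral_comp_equiv f
  have hr : 0 ≤ q / p := by positivity
  refine ⟨(c ^ (q / p) * c') ^ (1 / q), fun H => ?_⟩
  have h : ∀ y, ∫⁻ x, H (e x) y ^ p = c * ∫⁻ x, H x y ^ p := fun y => hc fun x => H x y ^ p
  unfold mixedNorm
  simp_rw [h, ENNReal.mul_rpow_of_nonneg _ _ hr]
  rw [lintegral_const_mul' _ _ (ENNReal.rpow_ne_top_of_nonneg hr ENNReal.coe_ne_top),
    hc' fun y => (∫⁻ x, H x y ^ p) ^ (q / p), ← mul_assoc,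
    ENNReal.mul_rpow_of_nonneg _ _ (by positivity),
    ENNReal.coe_rpow_of_nonneg _ (by positivity), ENNReal.coe_mul, ENNReal.coe_rpow_of_nonneg _ hr]

end ChangeOfVariables

/-! ### Correlation estimates for products of two functions on phase space -/

section Correlation

variable {ι : Type*} [Fintype ι]

/-- Exponents for which the correlation estimate of two weighted short-time Fourier transforms
holds. -/
structure YoungExponents (p q P₁ P₂ : ℝ) : Prop where
  pos : 0 < p
  le : p ≤ q
  le₁ : p ≤ P₁
  le₂ : p ≤ P₂
  sum : 1 / P₁ + 1 / P₂ = 1 / p + 1 / q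

theorem YoungExponents.div {p q P₁ P₂ : ℝ} (h : YoungExponents p q P₁ P₂) :
    1 / (P₁ / p) + 1 / (P₂ / p) = 1 + 1 / (q / p) := by
  have := h.pos
  have hs := h.sum
  have := h.le; have := h.le₁; have := h.le₂
  have hP₁ : 0 < P₁ := by linarith
  have hP₂ : 0 < P₂ := by linarith
  have hq : 0 < q := by linarith
  calc 1 / (P₁ / p) + 1 / (P₂ / p) = p * (1 / P₁ + 1 / P₂) := by field_simp
    _ = _ := by rw [hs]; field_simp

theorem lintegral_fstL_sndL {K : EuclideanSpace ℝ ι → EuclideanSpace ℝ ι → ℝ≥0∞}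
    (hK : Measurable (Function.uncurry K)) :
    ∫⁻ z : EuclideanSpace ℝ (ι ⊕ ι), K (fstL z) (sndL z) = ∫⁻ y, ∫⁻ x, K x y :=
  lintegral_join (hK.comp joinEquiv.symm.measurable)

variable {H₁ H₂ : EuclideanSpace ℝ ι → EuclideanSpace ℝ ι → ℝ≥0∞}

theorem measurable_correlation (hH₁ : Measurable (Function.uncurry H₁))
    (hH₂ : Measurable (Function.uncurry H₂)) (p : ℝ) :
    Measurable fun w : EuclideanSpace ℝ ι × EuclideanSpace ℝ ι =>
      ∫⁻ b, ∫⁻ a, (H₁ a b * H₂ (a + w.1) (b + w.2)) ^ p := by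
  refine Measurable.lintegral_prod_right (f := fun (w : EuclideanSpace ℝ ι × EuclideanSpace ℝ ι) b =>
    ∫⁻ a, (H₁ a b * H₂ (a + w.1) (b + w.2)) ^ p) ?_
  refine Measurable.lintegral_prod_right
    (f := fun (v : (EuclideanSpace ℝ ι × EuclideanSpace ℝ ι) × EuclideanSpace ℝ ι) a =>
      (H₁ a v.2 * H₂ (a + v.1.1) (v.2 + v.1.2)) ^ p) ?_
  refine Measurable.pow_const (Measurable.mul ?_ ?_) p
  · exact hH₁.comp (measurable_snd.prodMk measurable_fst.snd)
  · exact hH₂.comp ((measurable_snd.add measurable_fst.fst.fst).prodMk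
      (measurable_fst.snd.add measurable_fst.fst.snd))

/-- Mixed Young for `H₁ ^ p` and `H₂ ^ p`, with all exponents divided by `p` and target exponent `q
/ p` in both variables, followed by a `p`-th root. -/
theorem lintegral_correlation_le (hH₁ : Measurable (Function.uncurry H₁))
    (hH₂ : Measurable (Function.uncurry H₂)) {p q P₁ P₂ Q₁ Q₂ : ℝ}
    (hP : YoungExponents p q P₁ P₂) (hQ : YoungExponents p q Q₁ Q₂) :
    (∫⁻ v, ∫⁻ u, (∫⁻ b, ∫⁻ a, (H₁ a b * H₂ (a + u) (b + v)) ^ p) ^ (q / p)) ^ (1 / q) ≤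
      mixedNorm P₁ Q₁ H₁ * mixedNorm P₂ Q₂ H₂ := by
  have hp := hP.pos
  have hq : 0 < q := hp.trans_le hP.le
  have h1 : ∀ {r}, p ≤ r → 1 ≤ r / p := fun h => (one_le_div hp).2 h
  have h := mixedNorm_correlation_le (h1 hP.le₁) (h1 hQ.le₁) (h1 hP.le₂) (h1 hQ.le₂) (h1 hP.le)
    (h1 hP.le) hP.div hQ.div (F := fun a b => H₁ a b ^ p) (G := fun a b => H₂ a b ^ p)
    (hH₁.pow_const p) (hH₂.pow_const p)
  change mixedNorm (q / p) (q / p) (fun x y => ∫⁻ b, ∫⁻ a, H₁ a b ^ p * H₂ (a + x) (b + y) ^ p) ≤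
    mixedNorm (P₁ / p) (Q₁ / p) (fun a b => H₁ a b ^ p) *
      mixedNorm (P₂ / p) (Q₂ / p) (fun a b => H₂ a b ^ p) at h
  rw [mixedNorm_rpow hp.ne', mixedNorm_rpow hp.ne', ← ENNReal.mul_rpow_of_nonneg _ _ hp.le,
    mixedNorm, div_self (by positivity)] at h
  simp_rw [← ENNReal.mul_rpow_of_nonneg _ _ hp.le, ENNReal.rpow_one] at h
  have h' := ENNReal.rpow_le_rpow h (one_div_pos.2 hp).le
  rwa [← ENNReal.rpow_mul, ← ENNReal.rpow_mul, mul_one_div_cancel hp.ne', ENNReal.rpow_one,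
    one_div_div, div_mul_div_comm, mul_one, mul_comm q p, ← div_div, div_self hp.ne'] at h'

/-- The correlation estimate behind the boundedness into modulation spaces. -/
theorem mixedNorm_translate_le (hH₁ : Measurable (Function.uncurry H₁))
    (hH₂ : Measurable (Function.uncurry H₂)) {p q P₁ P₂ Q₁ Q₂ : ℝ}
    (hP : YoungExponents p q P₁ P₂) (hQ : YoungExponents p q Q₁ Q₂)
    (S T : EuclideanSpace ℝ ι → EuclideanSpace ℝ ι) :
    mixedNorm p q (fun z ζ : EuclideanSpace ℝ (ι ⊕ ι) =>
        H₁ (fstL z - S (sndL ζ)) (sndL z - T (fstL ζ)) *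
          H₂ (fstL z - S (sndL ζ) + sndL ζ) (sndL z - T (fstL ζ) - fstL ζ)) ≤
      mixedNorm P₁ Q₁ H₁ * mixedNorm P₂ Q₂ H₂ := by
  refine le_trans (le_of_eq ?_) (lintegral_correlation_le hH₁ hH₂ hP hQ)
  have hJ := (measurable_correlation hH₁ hH₂ p).pow_const (q / p)
  -- For fixed `(ξ, η)` the shifts `S η` and `T ξ` are constants in the integration variable, so
  -- they disappear whatever `S` and `T` are.
  have hinner : ∀ ξ η : EuclideanSpace ℝ ι, ∫⁻ z : EuclideanSpace ℝ (ι ⊕ ι),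
      (H₁ (fstL z - S η) (sndL z - T ξ) * H₂ (fstL z - S η + η) (sndL z - T ξ - ξ)) ^ p =
      ∫⁻ b, ∫⁻ a, (H₁ a b * H₂ (a + η) (b + -ξ)) ^ p := by
    intro ξ η
    have hm : Measurable (Function.uncurry fun x ω : EuclideanSpace ℝ ι =>
        (H₁ (x - S η) (ω - T ξ) * H₂ (x - S η + η) (ω - T ξ - ξ)) ^ p) :=
      ((hH₁.comp ((measurable_fst.sub_const _).prodMk (measurable_snd.sub_const _))).mul
        (hH₂.comp (((measurable_fst.sub_const _).add_const _).prodMk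
          ((measurable_snd.sub_const _).sub_const _)))).pow_const p
    refine (lintegral_fstL_sndL hm).trans ?_
    rw [lintegral_sub_right_eq_self (fun b => ∫⁻ x, (H₁ (x - S η) b *
      H₂ (x - S η + η) (b - ξ)) ^ p)]
    refine lintegral_congr fun b => ?_
    rw [lintegral_sub_right_eq_self (fun a => (H₁ a b * H₂ (a + η) (b - ξ)) ^ p)]
    simp_rw [sub_eq_add_neg]
  unfold mixedNorm
  congr 1
  refine (lintegral_congr fun ζ => congrArg (· ^ (q / p)) (hinner (fstL ζ) (sndL ζ))).trans ?_
  have hm : Measurable (Function.uncurry fun ξ η : EuclideanSpace ℝ ι =>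
      (∫⁻ b, ∫⁻ a, (H₁ a b * H₂ (a + η) (b + -ξ)) ^ p) ^ (q / p)) :=
    hJ.comp (measurable_snd.prodMk measurable_fst.neg)
  refine (lintegral_fstL_sndL hm).trans ?_
  -- The correlation is evaluated at `(η, -ξ)`, so the order of integration is exchanged and `ξ`
  -- reflected. This costs nothing because the target exponent is the same in both variables.
  refine (lintegral_lintegral_swap hm.aemeasurable).symm.trans ?_
  exact lintegral_neg_eq_self fun v => ∫⁻ u, (∫⁻ b, ∫⁻ a,
      (H₁ a b * H₂ (a + u) (b + v)) ^ p) ^ (q / p)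

/-- The correlation estimate behind the boundedness into Wiener amalgam spaces. -/
theorem exists_mixedNorm_shear_le {p q P₁ P₂ Q₁ Q₂ : ℝ}
    (hP : YoungExponents p q P₁ P₂) (hQ : YoungExponents p q Q₁ Q₂)
    (S P S' P' : EuclideanSpace ℝ ι ≃L[ℝ] EuclideanSpace ℝ ι) (hSP : ∀ x, P x = S x + x)
    (hSP' : ∀ x, P' x = S' x + x) :
    ∃ C : ℝ≥0, ∀ H₁ H₂ : EuclideanSpace ℝ ι → EuclideanSpace ℝ ι → ℝ≥0∞,
      Measurable (Function.uncurry H₁) → Measurable (Function.uncurry H₂) →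
      mixedNorm p q (fun ζ z : EuclideanSpace ℝ (ι ⊕ ι) =>
        H₁ (fstL z - P (sndL ζ)) (sndL z - S' (fstL ζ)) *
          H₂ (fstL z - P (sndL ζ) + sndL ζ) (sndL z - S' (fstL ζ) - fstL ζ)) ≤
      C * (mixedNorm P₁ Q₁ H₁ * mixedNorm P₂ Q₂ H₂) := by
  have hp := hP.pos
  have hq : 0 < q := hp.trans_le hP.le
  have hP₂ : 0 < P₂ := hp.trans_le hP.le₂
  have hQ₂ : 0 < Q₂ := hp.trans_le hQ.le₂
  -- Here `U = I - P⁻¹` and `V = I + S'⁻¹`. With `a = x - P η` and `b = ω - S' ξ` one has `a + η = U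
  -- a + P⁻¹ x` and `b - ξ = V b - S'⁻¹ ω`; `R` and `R'` are chosen so that these are `U (a + R x)`
  -- and `V (b + R' ω)`.
  let U := P.symm.trans S
  let V := S'.symm.trans P'
  let R := P.symm.trans U.symm
  let R' := (S'.symm.trans V.symm).trans (ContinuousLinearEquiv.neg ℝ)
  have hU : ∀ a x, U (a + R x) = a + P.symm (x - a) := by
    intro a x
    have h1 : U (R x) = P.symm x := U.apply_symm_apply _
    have h2 : U a = a - P.symm a := by
      have := hSP (P.symm a)
      rw [P.apply_symm_apply] at this
      change S (P.symm a) = _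
      exact (sub_eq_of_eq_add this).symm
    rw [map_add, h1, h2, map_sub]; abel
  have hV : ∀ b ω, V (b + R' ω) = b - S'.symm (ω - b) := by
    intro b ω
    have h1 : V (R' ω) = -S'.symm ω := by
      change V (-V.symm (S'.symm ω)) = _
      rw [map_neg, V.apply_symm_apply]
    have h2 : V b = b + S'.symm b := by
      change P' (S'.symm b) = _
      rw [hSP', S'.apply_symm_apply]
    rw [map_add, h1, h2, map_sub]; abel
  -- Three Jacobian factors: `c₁` for passing from `(ξ, η)` to `(a, b)`, `c₂` for `(x, ω) ↦ (R x, R'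
  -- ω)`, and `c₃` for composing `H₂` with `U` and `V`.
  obtain ⟨c₁, hc₁⟩ := exists_lintegral_lintegral_comp_equiv S' P
  obtain ⟨c₂, hc₂⟩ := exists_lintegral_lintegral_comp_equiv R R'
  obtain ⟨c₃, hc₃⟩ := exists_mixedNorm_comp_equiv U V hP₂ hQ₂
  refine ⟨(c₁ ^ (q / p) * c₂) ^ (1 / q) * c₃, fun H₁ H₂ hH₁ hH₂ => ?_⟩
  set G := fun a b => H₂ (U a) (V b)
  have hG : Measurable (Function.uncurry G) :=
    hH₂.comp ((U.continuous.measurable.comp measurable_fst).prodMk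
      (V.continuous.measurable.comp measurable_snd))
  have hJ := (measurable_correlation hH₁ hG p).pow_const (q / p)
  have key := lintegral_correlation_le hH₁ hG hP hQ
  rw [hc₃] at key
  have hinner : ∀ x ω : EuclideanSpace ℝ ι, ∫⁻ ζ : EuclideanSpace ℝ (ι ⊕ ι),
      (H₁ (x - P (sndL ζ)) (ω - S' (fstL ζ)) *
          H₂ (x - P (sndL ζ) + sndL ζ) (ω - S' (fstL ζ) - fstL ζ)) ^ p =
      c₁ * ∫⁻ b, ∫⁻ a, (H₁ a b * G (a + R x) (b + R' ω)) ^ p := by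
    intro x ω
    have hmK : Measurable (Function.uncurry fun a b => (H₁ a b * G (a + R x) (b + R' ω)) ^ p) :=
      (hH₁.mul (hG.comp ((measurable_fst.add_const _).prodMk
        (measurable_snd.add_const _)))).pow_const p
    have hm : Measurable (Function.uncurry fun ξ η : EuclideanSpace ℝ ι =>
        (H₁ (x - P η) (ω - S' ξ) * G (x - P η + R x) (ω - S' ξ + R' ω)) ^ p) :=
      hmK.comp (((P.continuous.measurable.comp measurable_snd).const_sub x).prodMk
        ((S'.continuous.measurable.comp measurable_fst).const_sub ω))
    have e : ∀ ξ η, H₂ (x - P η + η) (ω - S' ξ - ξ) = G (x - P η + R x) (ω - S' ξ + R' ω) := by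
      intro ξ η
      simp only [G, hU, hV, sub_sub_cancel, ContinuousLinearEquiv.symm_apply_apply]
    simp_rw [e]
    refine (lintegral_fstL_sndL hm).trans ?_
    rw [hc₁ fun b a => (H₁ (x - a) (ω - b) * G (x - a + R x) (ω - b + R' ω)) ^ p,
      lintegral_sub_left_eq_self (fun a => ∫⁻ b, (H₁ a (ω - b) *
        G (a + R x) (ω - b + R' ω)) ^ p) x]
    congr 1
    refine (lintegral_congr fun a => lintegral_sub_left_eq_self
      (fun b => (H₁ a b * G (a + R x) (b + R' ω)) ^ p) ω).trans ?_
    exact lintegral_lintegral_swap hmK.aemeasurable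
  have hm : Measurable (Function.uncurry fun x ω : EuclideanSpace ℝ ι =>
      (c₁ * ∫⁻ b, ∫⁻ a, (H₁ a b * G (a + R x) (b + R' ω)) ^ p) ^ (q / p)) :=
    ((((measurable_correlation hH₁ hG p).comp ((R.continuous.measurable.comp
      measurable_fst).prodMk (R'.continuous.measurable.comp measurable_snd)))).const_mul
        _).pow_const _
  have hr : 0 ≤ q / p := by positivity
  calc _ = (∫⁻ z : EuclideanSpace ℝ (ι ⊕ ι), (c₁ * ∫⁻ b, ∫⁻ a,
        (H₁ a b * G (a + R (fstL z)) (b + R' (sndL z))) ^ p) ^ (q / p)) ^ (1 / q) :=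
        congrArg (· ^ (1 / q)) (lintegral_congr fun z =>
          congrArg (· ^ (q / p)) (hinner (fstL z) (sndL z)))
    _ = (∫⁻ ω, ∫⁻ x, (c₁ * ∫⁻ b, ∫⁻ a,
        (H₁ a b * G (a + R x) (b + R' ω)) ^ p) ^ (q / p)) ^ (1 / q) :=
        congrArg (· ^ (1 / q)) (lintegral_fstL_sndL hm)
    _ = ((c₁ ^ (q / p) * c₂ : ℝ≥0∞) * ∫⁻ v, ∫⁻ u, (∫⁻ b, ∫⁻ a,
        (H₁ a b * G (a + u) (b + v)) ^ p) ^ (q / p)) ^ (1 / q) := by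
      have hc : (c₁ : ℝ≥0∞) ^ (q / p) ≠ ∞ :=
        ENNReal.rpow_ne_top_of_nonneg hr ENNReal.coe_ne_top
      rw [hc₂ fun x ω => (c₁ * ∫⁻ b, ∫⁻ a, (H₁ a b * G (a + x) (b + ω)) ^ p) ^ (q / p)]
      simp_rw [ENNReal.mul_rpow_of_nonneg _ _ hr, lintegral_const_mul' _ _ hc]
      rw [← mul_assoc, mul_comm (c₂ : ℝ≥0∞)]
    _ ≤ (c₁ ^ (q / p) * c₂ : ℝ≥0∞) ^ (1 / q) * (mixedNorm P₁ Q₁ H₁ * (c₃ * mixedNorm P₂ Q₂ H₂)) := by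
      rw [ENNReal.mul_rpow_of_nonneg _ _ (by positivity)]
      gcongr
    _ = _ := by
      rw [ENNReal.coe_mul, ENNReal.coe_rpow_of_nonneg _ (by positivity), ENNReal.coe_mul,
        ENNReal.coe_rpow_of_nonneg _ hr]
      ring

end Correlation
end
end MWD

namespace MWD
noncomputable section

/-! ### Distribution of the weights over the two factors -/

section WeightComparison

variable {ι κ : Type*} [Fintype ι] [Fintype κ]

theorem exists_polyWeight_comp_le (s : ℝ) (L : EuclideanSpace ℝ κ ≃L[ℝ] EuclideanSpace ℝ κ) :
    ∃ C : ℝ, 0 ≤ C ∧ ∀ z, polyWeight s (L z) ≤ C * polyWeight s z ∧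
      polyWeight s z ≤ C * polyWeight s (L z) := by
  let T : EuclideanSpace ℝ κ →L[ℝ] EuclideanSpace ℝ κ := L
  let T' : EuclideanSpace ℝ κ →L[ℝ] EuclideanSpace ℝ κ := L.symm
  let c := 1 + ‖T‖ + ‖T'‖
  have hc : 1 ≤ c := by linarith [norm_nonneg T, norm_nonneg T']
  have h₁ : ∀ z, ‖L z‖ ≤ c * ‖z‖ := fun z => (T.le_opNorm z).trans
    (mul_le_mul_of_nonneg_right (by linarith [norm_nonneg T']) (norm_nonneg z))
  have h₂ : ∀ z, ‖z‖ ≤ c * ‖L z‖ := fun z => by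
    have := T'.le_opNorm (L z)
    rw [show T' (L z) = z from L.symm_apply_apply z] at this
    exact this.trans (mul_le_mul_of_nonneg_right (by linarith [norm_nonneg T]) (norm_nonneg _))
  exact ⟨(c ^ 2) ^ |s / 2|, by positivity, fun z =>
    ⟨polyWeight_le_of_norm_le s hc (h₁ z) (h₂ z), polyWeight_le_of_norm_le s hc (h₂ z) (h₁ z)⟩⟩

theorem polyWeight_eq_of_norm_eq (s : ℝ) {a : EuclideanSpace ℝ ι} {b : EuclideanSpace ℝ κ}
    (h : ‖a‖ = ‖b‖) : polyWeight s a = polyWeight s b := by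
  rw [polyWeight, polyWeight, h]

/-- The weight depends only on the norm, so `(ξ, η)` may be replaced by `(η, -ξ)`, the difference of
the two phase-space points; then Peetre's inequality applies. -/
theorem polyWeight_join_swap_le (s : ℝ) (a b ξ η : EuclideanSpace ℝ ι) :
    polyWeight s (join ξ η) ≤
      2 ^ |s / 2| * polyWeight |s| (join a b) * polyWeight s (join (a + η) (b - ξ)) := by
  have h := polyWeight_add_le s (-join a b) (join (a + η) (b - ξ))
  have e : -join a b + join (a + η) (b - ξ) = join η (-ξ) := by
    rw [neg_add_eq_sub, join_sub_join]; congr 1 <;> abel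
  have e1 : ‖join ξ η‖ = ‖join η (-ξ)‖ := by
    rw [← sq_eq_sq₀ (norm_nonneg _) (norm_nonneg _), norm_join_sq, norm_join_sq, norm_neg, add_comm]
  rw [polyWeight_eq_of_norm_eq s e1, ← e]
  rwa [polyWeight_eq_of_norm_eq |s| (norm_neg (join a b))] at h

/-- The automorphism `(x, y) ↦ (e x, f y)`. -/
def joinMap (e f : EuclideanSpace ℝ ι ≃L[ℝ] EuclideanSpace ℝ ι) :
    EuclideanSpace ℝ (ι ⊕ ι) ≃L[ℝ] EuclideanSpace ℝ (ι ⊕ ι) :=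
  ContinuousLinearEquiv.equivOfInverse
    (inlL.comp ((e : EuclideanSpace ℝ ι →L[ℝ] EuclideanSpace ℝ ι).comp fstL) +
      inrL.comp ((f : EuclideanSpace ℝ ι →L[ℝ] EuclideanSpace ℝ ι).comp sndL))
    (inlL.comp ((e.symm : EuclideanSpace ℝ ι →L[ℝ] EuclideanSpace ℝ ι).comp fstL) +
      inrL.comp ((f.symm : EuclideanSpace ℝ ι →L[ℝ] EuclideanSpace ℝ ι).comp sndL))
    (fun z => by
      change inlL (e.symm (fstL (inlL (e (fstL z)) + inrL (f (sndL z))))) +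
        inrL (f.symm (sndL (inlL (e (fstL z)) + inrL (f (sndL z))))) = z
      simp only [inlL_add_inrL, fstL_join, sndL_join, ContinuousLinearEquiv.symm_apply_apply,
        join_fstL_sndL])
    (fun z => by
      change inlL (e (fstL (inlL (e.symm (fstL z)) + inrL (f.symm (sndL z))))) +
        inrL (f (sndL (inlL (e.symm (fstL z)) + inrL (f.symm (sndL z))))) = z
      simp only [inlL_add_inrL, fstL_join, sndL_join, ContinuousLinearEquiv.apply_symm_apply,
        join_fstL_sndL])

theorem joinMap_join (e f : EuclideanSpace ℝ ι ≃L[ℝ] EuclideanSpace ℝ ι)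
    (x y : EuclideanSpace ℝ ι) : joinMap e f (join x y) = join (e x) (f y) :=
  inlL_add_inrL (e x) (f y)

/-- `(P⁻¹ x, -S'⁻¹ ω)` is the second phase-space point minus an invertible linear image of `(a, b)`.
Peetre's inequality applies to this sum, and the linear maps change the weights only by constants.
-/
theorem exists_polyWeight_shear_le (s : ℝ)
    (S P S' P' : EuclideanSpace ℝ ι ≃L[ℝ] EuclideanSpace ℝ ι) (hSP : ∀ x, P x = S x + x)
    (hSP' : ∀ x, P' x = S' x + x) :
    ∃ C : ℝ, 0 ≤ C ∧ ∀ x ω ξ η : EuclideanSpace ℝ ι, polyWeight s (join x ω) ≤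
      C * polyWeight |s| (join (x - P η) (ω - S' ξ)) *
        polyWeight s (join (x - P η + η) (ω - S' ξ - ξ)) := by
  obtain ⟨C₁, hC₁, h₁⟩ := exists_polyWeight_comp_le s
    (joinMap P (S'.trans (ContinuousLinearEquiv.neg ℝ)))
  obtain ⟨C₂, hC₂, h₂⟩ := exists_polyWeight_comp_le |s|
    (joinMap ((P.symm.trans S).trans (ContinuousLinearEquiv.neg ℝ))
      ((S'.symm.trans P').trans (ContinuousLinearEquiv.neg ℝ)))
  refine ⟨C₁ * (2 ^ |s / 2| * C₂), by positivity, fun x ω ξ η => ?_⟩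
  set a := x - P η with ha
  set b := ω - S' ξ with hb
  have e₁ : S (P.symm a) = a - P.symm a := by
    have := hSP (P.symm a)
    rw [P.apply_symm_apply] at this
    exact (sub_eq_of_eq_add this).symm
  have e₂ : P' (S'.symm b) = b + S'.symm b := by rw [hSP', S'.apply_symm_apply]
  have f₁ : a + η = a - P.symm a + P.symm x := by
    have : P.symm a = P.symm x - η := by rw [ha, map_sub, P.symm_apply_apply]
    rw [this]; abel
  have f₂ : b - ξ = b + S'.symm b - S'.symm ω := by
    have : S'.symm b = S'.symm ω - ξ := by rw [hb, map_sub, S'.symm_apply_apply]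
    rw [this]; abel
  have h3 := polyWeight_add_le s (join (-(S (P.symm a))) (-(P' (S'.symm b))))
    (join (a + η) (b - ξ))
  have e3 : join (-(S (P.symm a))) (-(P' (S'.symm b))) + join (a + η) (b - ξ) =
      join (P.symm x) (-S'.symm ω) := by
    rw [join_add_join, e₁, e₂, f₁, f₂]
    congr 1 <;> abel
  rw [e3] at h3
  have h4 := (h₁ (join (P.symm x) (-S'.symm ω))).1
  rw [joinMap_join, P.apply_symm_apply] at h4
  change polyWeight s (join x (-(S' (-S'.symm ω)))) ≤ _ at h4
  rw [map_neg, neg_neg, S'.apply_symm_apply] at h4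
  have h5 := (h₂ (join a b)).1
  rw [joinMap_join] at h5
  change polyWeight |s| (join (-(S (P.symm a))) (-(P' (S'.symm b)))) ≤ _ at h5
  have hw := (polyWeight_pos s (join (a + η) (b - ξ))).le
  calc polyWeight s (join x ω) ≤ _ := h4
    _ ≤ C₁ * (2 ^ |s / 2| * (C₂ * polyWeight |s| (join a b)) *
        polyWeight s (join (a + η) (b - ξ))) := by
      refine mul_le_mul_of_nonneg_left (h3.trans ?_) hC₁
      gcongr
    _ = _ := by ring

theorem modulationNorm_le_of_weight_le (g : 𝓢(EuclideanSpace ℝ ι, ℂ)) {p q : ℝ} (hp : 0 < p)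
    (hq : 0 < q) {m m' : EuclideanSpace ℝ (ι ⊕ ι) → ℝ} {C : ℝ} (hC : 0 ≤ C)
    (h : ∀ z, m z ≤ C * m' z) (f : 𝓢'(EuclideanSpace ℝ ι, ℂ)) :
    modulationNorm g p q m f ≤ C.toNNReal * modulationNorm g p q m' f := by
  rw [modulationNorm_eq g hp.le, modulationNorm_eq g hp.le,
    ← mixedNorm_const_mul hp hq _ ENNReal.coe_ne_top]
  refine mixedNorm_mono hp.le hq.le fun x ω => ?_
  rw [mul_left_comm]
  refine mul_le_mul_right ((ENNReal.ofReal_le_ofReal (h _)).trans_eq ?_) _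
  rw [ENNReal.ofReal_mul hC]; rfl

theorem amalgamNorm_le_of_weight_le (g : 𝓢(EuclideanSpace ℝ ι, ℂ)) {p q : ℝ} (hp : 0 < p)
    (hq : 0 < q) {w w' : EuclideanSpace ℝ ι → ℝ} {C : ℝ} (hC : 0 ≤ C)
    (h : ∀ z, w z ≤ C * w' z) (f : 𝓢'(EuclideanSpace ℝ ι, ℂ)) :
    amalgamNorm g p q (fun _ => 1) w f ≤ C.toNNReal * amalgamNorm g p q (fun _ => 1) w' f := by
  rw [amalgamNorm_eq g hp hq.le, amalgamNorm_eq g hp hq.le,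
    ← mixedNorm_const_mul hp hq _ ENNReal.coe_ne_top]
  refine mixedNorm_mono hp.le hq.le fun ω x => ?_
  rw [mul_left_comm]
  refine mul_le_mul_right ((ENNReal.ofReal_le_ofReal ?_).trans_eq (ENNReal.ofReal_mul hC)) _
  simpa [tensorWeight] using h x

end WeightComparison

/-! ### Choice of exponents -/

section Exponents

theorem exists_youngExponents {p q p₁ p₂ : ℝ} (hp : 0 < p) (hpq : p ≤ q) (hp₁ : 0 < p₁)
    (hp₂ : 0 < p₂) (hp₁q : p₁ ≤ q) (hp₂q : p₂ ≤ q) (h : 1 / p + 1 / q ≤ 1 / p₁ + 1 / p₂) :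
    ∃ P₁ P₂, YoungExponents p q P₁ P₂ ∧ p₁ ≤ P₁ ∧ p₂ ≤ P₂ := by
  have hq := hp.trans_le hpq
  have ht : 0 < 1 / q := by positivity
  have hw : 1 / q ≤ 1 / p := one_div_le_one_div_of_le hp hpq
  have hu₁ : 1 / q ≤ 1 / p₁ := one_div_le_one_div_of_le hp₁ hp₁q
  have hu₂ : 1 / q ≤ 1 / p₂ := one_div_le_one_div_of_le hp₂ hp₂q
  obtain ⟨U₁, U₂, h1, h2, h3, h4, h5, h6, h7⟩ : ∃ U₁ U₂ : ℝ, 0 < U₁ ∧ 0 < U₂ ∧ U₁ ≤ 1 / p₁ ∧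
      U₂ ≤ 1 / p₂ ∧ U₁ ≤ 1 / p ∧ U₂ ≤ 1 / p ∧ U₁ + U₂ = 1 / p + 1 / q := by
    -- Take `U₁ = min (1/p₁) (1/p)` and let `U₂` be the remainder. In the first case `U₂ ≤ 1/p`
    -- because `p₁ ≤ q`, and `U₂ ≤ 1/p₂` by `h`; in the second `U₂ = 1/q`, which is at most `1/p₂`
    -- because `p₂ ≤ q`.
    rcases le_total (1 / p₁) (1 / p) with h' | h'
    · exact ⟨1 / p₁, 1 / p + 1 / q - 1 / p₁, by linarith, by linarith, le_rfl, by linarith, h',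
        by linarith, by ring⟩
    · exact ⟨1 / p, 1 / q, by linarith, ht, h', hu₂, le_rfl, hw, rfl⟩
  have key : ∀ {U r : ℝ}, 0 < U → 0 < r → U ≤ 1 / r → r ≤ 1 / U := fun hU hr h =>
    (le_one_div hU hr).1 h
  refine ⟨1 / U₁, 1 / U₂, ⟨hp, hpq, key h1 hp h5, key h2 hp h6, ?_⟩, key h1 hp₁ h3, key h2 hp₂ h4⟩
  rw [one_div_one_div, one_div_one_div, h7]

/-- Permits replacing `p` by `min p q`: if `q ≤ p`, the required bound by `2/q` follows from `p₁, p₂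
≤ q` alone. -/
theorem one_div_min_add_le {p q p₁ p₂ : ℝ} (hp₁ : 0 < p₁) (hp₂ : 0 < p₂)
    (hp₁q : p₁ ≤ q) (hp₂q : p₂ ≤ q) (h : 1 / p + 1 / q ≤ 1 / p₁ + 1 / p₂) :
    1 / min p q + 1 / q ≤ 1 / p₁ + 1 / p₂ := by
  rcases le_total p q with h' | h'
  · rwa [min_eq_left h']
  · rw [min_eq_right h']
    exact add_le_add (one_div_le_one_div_of_le hp₁ hp₁q) (one_div_le_one_div_of_le hp₂ hp₂q)

end Exponents

/-! ### Bounds in the adapted window -/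

section WignerBounds

variable {ι : Type*} [Fintype ι]

theorem exists_equiv_of_isUnit {T : EuclideanSpace ℝ ι →L[ℝ] EuclideanSpace ℝ ι} (h : IsUnit T) :
    ∃ e : EuclideanSpace ℝ ι ≃L[ℝ] EuclideanSpace ℝ ι, ∀ x, e x = T x := by
  obtain ⟨u, rfl⟩ := h
  exact ⟨ContinuousLinearEquiv.unitsEquiv ℝ _ u, fun _ => rfl⟩

variable [DecidableEq ι]

/-- The second point is rewritten as the first one shifted by `(η, -ξ)`, the shape required by the
correlation estimates. -/
theorem enorm_stft_matrixWigner (M : Matrix ι ι ℝ) (g₁ g₂ : 𝓢(EuclideanSpace ℝ ι, ℂ))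
    (f₁ f₂ : 𝓢'(EuclideanSpace ℝ ι, ℂ)) (z ζ : EuclideanSpace ℝ (ι ⊕ ι)) :
    ‖stft (wignerWindow M g₁ g₂) (matrixWigner (cohenMatrix M) f₁ f₂) z ζ‖ₑ =
      ENNReal.ofReal |(cohenMatrix M).val.det|⁻¹ *
        (‖stft g₁ f₁ (fstL z - (lowerL M (sndL ζ) + sndL ζ))
            (sndL z - (lowerL M).adjoint (fstL ζ))‖ₑ *
          ‖stft g₂ f₂ (fstL z - (lowerL M (sndL ζ) + sndL ζ) + sndL ζ)
            (sndL z - (lowerL M).adjoint (fstL ζ) - fstL ζ)‖ₑ) := by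
  have h := norm_stft_matrixWigner M g₁ g₂ f₁ f₂ (fstL z) (sndL z) (fstL ζ) (sndL ζ)
  rw [join_fstL_sndL, join_fstL_sndL] at h
  have e : fstL z - (lowerL M (sndL ζ) + sndL ζ) + sndL ζ = fstL z - lowerL M (sndL ζ) := by abel
  rw [e, ← ofReal_norm, h, ENNReal.ofReal_mul (by positivity), ENNReal.ofReal_mul (norm_nonneg _),
    ofReal_norm, ofReal_norm]

theorem mul_ofReal_le {V V₁ V₂ D : ℝ≥0∞} {w w₁ w₂ K : ℝ} (hK : 0 ≤ K) (hw₁ : 0 ≤ w₁)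
    (hV : V = D * (V₁ * V₂)) (hw : w ≤ K * w₁ * w₂) :
    V * ENNReal.ofReal w ≤
      (D * ENNReal.ofReal K) * ((V₁ * ENNReal.ofReal w₁) * (V₂ * ENNReal.ofReal w₂)) := by
  calc V * ENNReal.ofReal w ≤ D * (V₁ * V₂) * ENNReal.ofReal (K * w₁ * w₂) := by
        rw [hV]; gcongr
    _ = _ := by
        rw [ENNReal.ofReal_mul (by positivity), ENNReal.ofReal_mul hK]; ring

theorem exists_modulationNorm_matrixWigner_le (M : Matrix ι ι ℝ) (s : ℝ)
    (g₁ g₂ : 𝓢(EuclideanSpace ℝ ι, ℂ)) {p q P₁ P₂ Q₁ Q₂ : ℝ}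
    (hP : YoungExponents p q P₁ P₂) (hQ : YoungExponents p q Q₁ Q₂) :
    ∃ C : ℝ≥0, ∀ f₁ f₂ : 𝓢'(EuclideanSpace ℝ ι, ℂ),
      modulationNorm (wignerWindow M g₁ g₂) p q (tensorWeight (fun _ => 1) (polyWeight s))
          (matrixWigner (cohenMatrix M) f₁ f₂) ≤
        C * (modulationNorm g₁ P₁ Q₁ (polyWeight |s|) f₁ *
          modulationNorm g₂ P₂ Q₂ (polyWeight s) f₂) := by
  have hp := hP.pos
  have hq := hp.trans_le hP.le
  refine ⟨Real.toNNReal |(cohenMatrix M).val.det|⁻¹ * Real.toNNReal (2 ^ |s / 2|),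
    fun f₁ f₂ => ?_⟩
  rw [modulationNorm_eq _ hp.le, modulationNorm_eq g₁ (hp.le.trans hP.le₁),
    modulationNorm_eq g₂ (hp.le.trans hP.le₂)]
  refine le_trans ?_ (mul_le_mul_right (mixedNorm_translate_le
    (measurable_stft_weight g₁ f₁ (continuous_polyWeight |s|))
    (measurable_stft_weight g₂ f₂ (continuous_polyWeight s)) hP hQ
    (fun η => lowerL M η + η) (lowerL M).adjoint) _)
  rw [← mixedNorm_const_mul hp hq _ ENNReal.coe_ne_top]
  refine mixedNorm_mono hp.le hq.le fun z ζ => ?_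
  refine mul_ofReal_le (by positivity) (polyWeight_pos _ _).le
    (enorm_stft_matrixWigner M g₁ g₂ f₁ f₂ z ζ) ?_
  have := polyWeight_join_swap_le s (fstL z - (lowerL M (sndL ζ) + sndL ζ))
    (sndL z - (lowerL M).adjoint (fstL ζ)) (fstL ζ) (sndL ζ)
  rw [join_fstL_sndL] at this
  simpa only [tensorWeight, sndL_join, one_mul] using this

theorem exists_amalgamNorm_matrixWigner_le {M : Matrix ι ι ℝ} (hM : IsUnit (M - (1 / 2 : ℝ) • 1))
    (hM' : IsUnit (M + (1 / 2 : ℝ) • 1)) (s : ℝ)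
    (g₁ g₂ : 𝓢(EuclideanSpace ℝ ι, ℂ)) {p q P₁ P₂ Q₁ Q₂ : ℝ}
    (hP : YoungExponents p q P₁ P₂) (hQ : YoungExponents p q Q₁ Q₂) :
    ∃ C : ℝ≥0, ∀ f₁ f₂ : 𝓢'(EuclideanSpace ℝ ι, ℂ),
      amalgamNorm (wignerWindow M g₁ g₂) p q (fun _ => 1) (polyWeight s)
          (matrixWigner (cohenMatrix M) f₁ f₂) ≤
        C * (modulationNorm g₁ P₁ Q₁ (polyWeight |s|) f₁ *
          modulationNorm g₂ P₂ Q₂ (polyWeight s) f₂) := by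
  have hp := hP.pos
  have hq := hp.trans_le hP.le
  have hL : IsUnit (lowerL M) := hM.map (Matrix.toEuclideanCLM (𝕜 := ℝ) (n := ι))
  have hL' : IsUnit (lowerL M + 1) := by
    have : lowerL M + 1 = Matrix.toEuclideanCLM (𝕜 := ℝ) (n := ι) (M + (1 / 2 : ℝ) • 1) :=
      ContinuousLinearMap.ext fun x => lowerL_add_self M x
    rw [this]
    exact hM'.map (Matrix.toEuclideanCLM (𝕜 := ℝ) (n := ι))
  -- The frequency variable is sheared by the transposed matrices, so invertibility passes to
  -- adjoints.
  have hA : IsUnit (lowerL M).adjoint := hL.star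
  have hA' : IsUnit ((lowerL M).adjoint + 1) := by
    have h1 : (lowerL M + 1).adjoint = (lowerL M).adjoint + 1 := by
      rw [map_add]
      exact congrArg _ (star_one (EuclideanSpace ℝ ι →L[ℝ] EuclideanSpace ℝ ι))
    rw [← h1]
    exact hL'.star
  obtain ⟨S, hS⟩ := exists_equiv_of_isUnit hL
  obtain ⟨P, hPL⟩ := exists_equiv_of_isUnit hL'
  obtain ⟨S', hS'⟩ := exists_equiv_of_isUnit hA
  obtain ⟨P', hPL'⟩ := exists_equiv_of_isUnit hA'
  have hPx : ∀ x, P x = lowerL M x + x := hPL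
  have hSP : ∀ x, P x = S x + x := fun x => by rw [hPx, hS]
  have hSP' : ∀ x, P' x = S' x + x := fun x => by rw [hPL', hS']; rfl
  obtain ⟨K, hK, hw⟩ := exists_polyWeight_shear_le s S P S' P' hSP hSP'
  obtain ⟨C, hC⟩ := exists_mixedNorm_shear_le hP hQ S P S' P' hSP hSP'
  refine ⟨Real.toNNReal |(cohenMatrix M).val.det|⁻¹ * Real.toNNReal K * C, fun f₁ f₂ => ?_⟩
  rw [amalgamNorm_eq _ hp hq.le, modulationNorm_eq g₁ (hp.le.trans hP.le₁),
    modulationNorm_eq g₂ (hp.le.trans hP.le₂), ENNReal.coe_mul, mul_assoc]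
  refine le_trans ?_ (mul_le_mul_right (hC _ _
    (measurable_stft_weight g₁ f₁ (continuous_polyWeight |s|))
    (measurable_stft_weight g₂ f₂ (continuous_polyWeight s))) _)
  rw [← mixedNorm_const_mul hp hq _ ENNReal.coe_ne_top]
  refine mixedNorm_mono hp.le hq.le fun ζ z => ?_
  have h1 := enorm_stft_matrixWigner M g₁ g₂ f₁ f₂ z ζ
  rw [← hPx, ← hS'] at h1
  refine mul_ofReal_le hK (polyWeight_pos _ _).le h1 ?_
  have := hw (fstL z) (sndL z) (fstL ζ) (sndL ζ)
  rw [join_fstL_sndL] at this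
  simpa only [tensorWeight, fstL_join, mul_one] using this

end WignerBounds

/-! ### Invertibility of the matrices and equivalence of the weights -/

section MatrixFacts

variable {ι : Type*} [Fintype ι] [DecidableEq ι]

theorem isRightRegular_cohenMatrix_iff (M : Matrix ι ι ℝ) :
    IsRightRegular (cohenMatrix M).val ↔
      IsUnit (M - (1 / 2 : ℝ) • 1) ∧ IsUnit (M + (1 / 2 : ℝ) • 1) :=
  and_comm

theorem isUnit_matrixP_iff (M : Matrix ι ι ℝ) :
    IsUnit (matrixP M) ↔ IsUnit (M - (1 / 2 : ℝ) • 1) ∧ IsUnit (M + (1 / 2 : ℝ) • 1) := by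
  rw [matrixP, Matrix.isUnit_fromBlocks_zero₂₁, IsUnit.neg_iff, and_comm]

/-- Since `P_M (I + P_M⁻¹) = P_M + I = diag(-(M - I/2), M + I/2)`, adding the identity only
exchanges the two blocks, up to sign. -/
theorem isUnit_one_add_matrixP_inv {M : Matrix ι ι ℝ} (hM : IsUnit (M - (1 / 2 : ℝ) • 1))
    (hM' : IsUnit (M + (1 / 2 : ℝ) • 1)) : IsUnit (1 + (matrixP M)⁻¹) := by
  have hP := (isUnit_matrixP_iff M).2 ⟨hM, hM'⟩
  have h : (1 / 2 : ℝ) • 1 + (1 / 2 : ℝ) • 1 = (1 : Matrix ι ι ℝ) := by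
    rw [← add_smul]; norm_num
  have h1 : matrixP M + 1 =
      Matrix.fromBlocks (-(M - (1 / 2 : ℝ) • 1)) 0 0 (M + (1 / 2 : ℝ) • 1) := by
    rw [matrixP, ← Matrix.fromBlocks_one, Matrix.fromBlocks_add, add_zero]
    congr 1
    · rw [neg_add_eq_iff_eq_add, ← sub_eq_add_neg, eq_sub_iff_add_eq', sub_add_eq_add_sub,
        sub_eq_iff_eq_add, add_assoc, h]
    · rw [sub_add_eq_add_sub, sub_eq_iff_eq_add, add_assoc, h]
  have h2 : IsUnit (matrixP M + 1) := by
    rw [h1, Matrix.isUnit_fromBlocks_zero₂₁, IsUnit.neg_iff]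
    exact ⟨hM, hM'⟩
  have h3 : matrixP M * (1 + (matrixP M)⁻¹) = matrixP M + 1 := by
    rw [mul_add, mul_one, Matrix.mul_nonsing_inv _ ((Matrix.isUnit_iff_isUnit_det _).1 hP)]
  rw [← h3, hP.mul_left_iff] at h2
  exact h2

theorem constC_pos {M : Matrix ι ι ℝ} (hM : IsUnit (M - (1 / 2 : ℝ) • 1))
    (hM' : IsUnit (M + (1 / 2 : ℝ) • 1)) : 0 < constC M :=
  abs_pos.2 (mul_ne_zero ((Matrix.isUnit_iff_isUnit_det _).1 hM').ne_zero
    ((Matrix.isUnit_iff_isUnit_det _).1 hM).ne_zero)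

theorem exists_polyWeightM_equiv {M : Matrix ι ι ℝ} (hM : IsUnit (M - (1 / 2 : ℝ) • 1))
    (hM' : IsUnit (M + (1 / 2 : ℝ) • 1)) (s : ℝ) :
    ∃ C : ℝ, 0 ≤ C ∧ ∀ z, polyWeightM s M z ≤ C * polyWeight s z ∧
      polyWeight s z ≤ C * polyWeightM s M z := by
  have hu : IsUnit ((1 + (matrixP M)⁻¹)⁻¹) :=
    Matrix.isUnit_nonsing_inv_iff.2 (isUnit_one_add_matrixP_inv hM hM')
  obtain ⟨e, he⟩ := exists_equiv_of_isUnit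
    (hu.map (Matrix.toEuclideanCLM (𝕜 := ℝ) (n := ι ⊕ ι)))
  obtain ⟨C, hC, h⟩ := exists_polyWeight_comp_le s e
  refine ⟨C, hC, fun z => ?_⟩
  have := h z
  rwa [he] at this

end MatrixFacts
end
end MWD

namespace MWD
noncomputable section

/-! ### The two boundedness theorems -/

section Main

variable {ι : Type*} [Fintype ι] [DecidableEq ι]

/-- Chains the four estimates: window of the output, adapted bound, inclusion for each input. The
product `c⁻¹ * c` is inserted so that a prescribed factor `c` can be displayed. -/
theorem mul_mul_mul_le {a x y x' y' : ℝ≥0∞} {C₁ C₂ C₃ C₄ : ℝ≥0} {b c : ℝ≥0∞} (h₁ : a ≤ C₁ * b)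
    (h₂ : b ≤ C₂ * (x * y)) (h₃ : x ≤ C₃ * x') (h₄ : y ≤ C₄ * y') (hc : c * c⁻¹ = 1) :
    a ≤ (C₁ * C₂ * C₃ * C₄ : ℝ≥0) * c⁻¹ * c * x' * y' := by
  calc a ≤ C₁ * (C₂ * ((C₃ * x') * (C₄ * y'))) := by
        refine h₁.trans ?_
        gcongr
        exact h₂.trans (by gcongr)
    _ = (C₁ * C₂ * C₃ * C₄ : ℝ≥0) * (c * c⁻¹) * x' * y' := by rw [hc]; push_cast; ring
    _ = _ := by ring

variable {M : Matrix ι ι ℝ} {p₁ p₂ q₁ q₂ p q : ℝ}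

/-- Boundedness of matrix-Wigner distributions of Cohen type between modulation spaces. -/
theorem exists_modulationNorm_matrixWigner_le_modulationNorm (s : ℝ)
    (hp₁ : 1 ≤ p₁) (hp₂ : 1 ≤ p₂) (hq₁ : 1 ≤ q₁) (hq₂ : 1 ≤ q₂) (hp : 1 ≤ p) (hq : 1 ≤ q)
    (hp₁q : p₁ ≤ q) (hp₂q : p₂ ≤ q) (hq₁q : q₁ ≤ q) (hq₂q : q₂ ≤ q)
    (hpp : 1 / p + 1 / q ≤ 1 / p₁ + 1 / p₂) (hqq : 1 / p + 1 / q ≤ 1 / q₁ + 1 / q₂)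
    {g₁ g₂ : 𝓢(EuclideanSpace ℝ ι, ℂ)} (hg₁ : g₁ ≠ 0) (hg₂ : g₂ ≠ 0)
    (Φ : 𝓢(EuclideanSpace ℝ (ι ⊕ ι), ℂ)) :
    ∃ C : ℝ≥0, ∀ f₁ f₂ : 𝓢'(EuclideanSpace ℝ ι, ℂ),
      modulationNorm Φ p q (tensorWeight (fun _ => 1) (polyWeight s))
          (matrixWigner (cohenMatrix M) f₁ f₂) ≤
        C * modulationNorm g₁ p₁ q₁ (polyWeight |s|) f₁ *
          modulationNorm g₂ p₂ q₂ (polyWeight s) f₂ := by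
  -- The adapted bound is proved with first exponent `min p q`; the passage to `p` is an inclusion,
  -- made together with the change to the window `Φ`.
  have hr : 1 ≤ min p q := le_min hp hq
  obtain ⟨P₁, P₂, hP, hP₁, hP₂⟩ := exists_youngExponents (by linarith) (min_le_right p q)
    (by linarith) (by linarith) hp₁q hp₂q
    (one_div_min_add_le (by linarith) (by linarith) hp₁q hp₂q hpp)
  obtain ⟨Q₁, Q₂, hQ, hQ₁, hQ₂⟩ := exists_youngExponents (by linarith) (min_le_right p q)
    (by linarith) (by linarith) hq₁q hq₂q
    (one_div_min_add_le (by linarith) (by linarith) hq₁q hq₂q hqq)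
  obtain ⟨C₁, h₁⟩ := exists_modulationNorm_le (wignerWindow_ne_zero M hg₁ hg₂) Φ
    (isModerate_one.tensorWeight (isModerate_polyWeight s)) hr hq (min_le_left p q) le_rfl
  obtain ⟨C₂, h₂⟩ := exists_modulationNorm_matrixWigner_le M s g₁ g₂ hP hQ
  obtain ⟨C₃, h₃⟩ := exists_modulationNorm_le hg₁ g₁ (isModerate_polyWeight |s|) hp₁ hq₁ hP₁ hQ₁
  obtain ⟨C₄, h₄⟩ := exists_modulationNorm_le hg₂ g₂ (isModerate_polyWeight s) hp₂ hq₂ hP₂ hQ₂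
  refine ⟨C₁ * C₂ * C₃ * C₄, fun f₁ f₂ => ?_⟩
  have h := mul_mul_mul_le (h₁ _) (h₂ f₁ f₂) (h₃ f₁) (h₄ f₂) (c := 1) (by simp)
  rwa [inv_one, mul_one, mul_one] at h

/-- Boundedness of right-regular matrix-Wigner distributions of Cohen type from modulation spaces to
Wiener amalgam spaces. -/
theorem exists_amalgamNorm_matrixWigner_le_modulationNorm (s : ℝ)
    (hM : IsUnit (M - (1 / 2 : ℝ) • 1)) (hM' : IsUnit (M + (1 / 2 : ℝ) • 1))
    (hp₁ : 1 ≤ p₁) (hp₂ : 1 ≤ p₂) (hq₁ : 1 ≤ q₁) (hq₂ : 1 ≤ q₂) (hp : 1 ≤ p) (hq : 1 ≤ q)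
    (hp₁q : p₁ ≤ q) (hp₂q : p₂ ≤ q) (hq₁q : q₁ ≤ q) (hq₂q : q₂ ≤ q)
    (hpp : 1 / p + 1 / q ≤ 1 / p₁ + 1 / p₂) (hqq : 1 / p + 1 / q ≤ 1 / q₁ + 1 / q₂)
    {g₁ g₂ : 𝓢(EuclideanSpace ℝ ι, ℂ)} (hg₁ : g₁ ≠ 0) (hg₂ : g₂ ≠ 0)
    (Φ : 𝓢(EuclideanSpace ℝ (ι ⊕ ι), ℂ)) :
    ∃ C : ℝ≥0, ∀ f₁ f₂ : 𝓢'(EuclideanSpace ℝ ι, ℂ),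
      amalgamNorm Φ p q (fun _ => 1) (polyWeightM s M) (matrixWigner (cohenMatrix M) f₁ f₂) ≤
        C * ENNReal.ofReal (constC M ^ (1 / q - 1 / p)) *
          modulationNorm g₁ p₁ q₁ (polyWeight |s|) f₁ *
          modulationNorm g₂ p₂ q₂ (polyWeightM s M) f₂ := by
  have hr : 1 ≤ min p q := le_min hp hq
  obtain ⟨P₁, P₂, hP, hP₁, hP₂⟩ := exists_youngExponents (by linarith) (min_le_right p q)
    (by linarith) (by linarith) hp₁q hp₂q
    (one_div_min_add_le (by linarith) (by linarith) hp₁q hp₂q hpp)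
  obtain ⟨Q₁, Q₂, hQ, hQ₁, hQ₂⟩ := exists_youngExponents (by linarith) (min_le_right p q)
    (by linarith) (by linarith) hq₁q hq₂q
    (one_div_min_add_le (by linarith) (by linarith) hq₁q hq₂q hqq)
  obtain ⟨K, hK, hw⟩ := exists_polyWeightM_equiv hM hM' s
  obtain ⟨C₁, h₁⟩ := exists_amalgamNorm_le (wignerWindow_ne_zero M hg₁ hg₂) Φ
    (isModerate_polyWeight s) hr hq (min_le_left p q) le_rfl
  obtain ⟨C₂, h₂⟩ := exists_amalgamNorm_matrixWigner_le hM hM' s g₁ g₂ hP hQ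
  obtain ⟨C₃, h₃⟩ := exists_modulationNorm_le hg₁ g₁ (isModerate_polyWeight |s|) hp₁ hq₁ hP₁ hQ₁
  obtain ⟨C₄, h₄⟩ := exists_modulationNorm_le hg₂ g₂ (isModerate_polyWeight s) hp₂ hq₂ hP₂ hQ₂
  have hc : 0 < constC M ^ (1 / q - 1 / p) := Real.rpow_pos_of_pos (constC_pos hM hM') _
  set c := ENNReal.ofReal (constC M ^ (1 / q - 1 / p)) with hcdef
  have hc0 : c ≠ 0 := by rw [hcdef, ne_eq, ENNReal.ofReal_eq_zero, not_le]; exact hc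
  have hct : c ≠ ∞ := ENNReal.ofReal_ne_top
  -- The factors `K` replace `v_s^M` by `v_s` on both sides. The factor `c⁻¹` offsets the displayed
  -- power of `C_M`, which is legitimate because the constant may depend on `M` and the exponents.
  refine ⟨K.toNNReal * C₁ * C₂ * C₃ * (C₄ * K.toNNReal) * (c⁻¹).toNNReal, fun f₁ f₂ => ?_⟩
  rw [ENNReal.coe_mul _ (c⁻¹).toNNReal, ENNReal.coe_toNNReal (ENNReal.inv_ne_top.2 hc0)]
  refine mul_mul_mul_le (b := amalgamNorm (wignerWindow M g₁ g₂) (min p q) q (fun _ => 1)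
    (polyWeight s) (matrixWigner (cohenMatrix M) f₁ f₂)) ?_ (h₂ f₁ f₂) (h₃ f₁) ?_
    (ENNReal.mul_inv_cancel hc0 hct)
  · rw [ENNReal.coe_mul, mul_assoc]
    exact (amalgamNorm_le_of_weight_le Φ (by linarith) (by linarith) hK (fun z => (hw z).1) _).trans
      (mul_le_mul_right (h₁ _) _)
  · rw [ENNReal.coe_mul, mul_assoc]
    exact (h₄ f₂).trans (mul_le_mul_right (modulationNorm_le_of_weight_le g₂ (by linarith)
      (by linarith) hK (fun z => (hw z).2) f₂) _)

end Main
end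
end MWD

theorem mainTheorem5 (d : ℕ) (M : Matrix (Fin d) (Fin d) ℝ) (s p₁ p₂ q₁ q₂ p q : ℝ)
    (hp₁ : 1 ≤ p₁) (hp₂ : 1 ≤ p₂) (hq₁ : 1 ≤ q₁) (hq₂ : 1 ≤ q₂) (hp : 1 ≤ p) (hq : 1 ≤ q)
    (hp₁q : p₁ ≤ q) (hp₂q : p₂ ≤ q) (hq₁q : q₁ ≤ q) (hq₂q : q₂ ≤ q)
    (hpp : 1 / p + 1 / q ≤ 1 / p₁ + 1 / p₂) (hqq : 1 / p + 1 / q ≤ 1 / q₁ + 1 / q₂)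
    (g₁ g₂ : 𝓢(EuclideanSpace ℝ (Fin d), ℂ)) (hg₁ : g₁ ≠ 0) (hg₂ : g₂ ≠ 0)
    (Φ : 𝓢(EuclideanSpace ℝ (Fin d ⊕ Fin d), ℂ)) (hΦ : Φ ≠ 0) :
    (∃ C : ℝ≥0, ∀ f₁ f₂ : 𝓢'(EuclideanSpace ℝ (Fin d), ℂ),
      MWD.MemModulation g₁ p₁ q₁ (MWD.polyWeight |s|) f₁ →
      MWD.MemModulation g₂ p₂ q₂ (MWD.polyWeight s) f₂ →
      MWD.MemModulation Φ p q (MWD.tensorWeight (fun _ => 1) (MWD.polyWeight s))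
          (MWD.matrixWigner (MWD.cohenMatrix M) f₁ f₂) ∧
        MWD.modulationNorm Φ p q (MWD.tensorWeight (fun _ => 1) (MWD.polyWeight s))
            (MWD.matrixWigner (MWD.cohenMatrix M) f₁ f₂) ≤
          C * MWD.modulationNorm g₁ p₁ q₁ (MWD.polyWeight |s|) f₁ *
            MWD.modulationNorm g₂ p₂ q₂ (MWD.polyWeight s) f₂) ∧
    ((IsUnit (M - (1 / 2 : ℝ) • 1) ∧ IsUnit (M + (1 / 2 : ℝ) • 1)) ↔
      MWD.IsRightRegular (MWD.cohenMatrix M).val) ∧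
    ((IsUnit (M - (1 / 2 : ℝ) • 1) ∧ IsUnit (M + (1 / 2 : ℝ) • 1)) ↔
      IsUnit (MWD.matrixP M)) ∧
    (IsUnit (M - (1 / 2 : ℝ) • 1) → IsUnit (M + (1 / 2 : ℝ) • 1) →
      IsUnit (1 + (MWD.matrixP M)⁻¹) ∧ 0 < MWD.constC M ∧
      ∃ C : ℝ≥0, ∀ f₁ f₂ : 𝓢'(EuclideanSpace ℝ (Fin d), ℂ),
        MWD.MemModulation g₁ p₁ q₁ (MWD.polyWeight |s|) f₁ →
        MWD.MemModulation g₂ p₂ q₂ (MWD.polyWeightM s M) f₂ →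
        MWD.MemAmalgam Φ p q (fun _ => 1) (MWD.polyWeightM s M)
            (MWD.matrixWigner (MWD.cohenMatrix M) f₁ f₂) ∧
          MWD.amalgamNorm Φ p q (fun _ => 1) (MWD.polyWeightM s M)
              (MWD.matrixWigner (MWD.cohenMatrix M) f₁ f₂) ≤
            C * ENNReal.ofReal (MWD.constC M ^ (1 / q - 1 / p)) *
              MWD.modulationNorm g₁ p₁ q₁ (MWD.polyWeight |s|) f₁ *
              MWD.modulationNorm g₂ p₂ q₂ (MWD.polyWeightM s M) f₂) := by
  refine ⟨?_, (MWD.isRightRegular_cohenMatrix_iff M).symm, (MWD.isUnit_matrixP_iff M).symm,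
    fun hM hM' => ⟨MWD.isUnit_one_add_matrixP_inv hM hM', MWD.constC_pos hM hM', ?_⟩⟩
  · obtain ⟨C, hC⟩ := MWD.exists_modulationNorm_matrixWigner_le_modulationNorm (M := M) s hp₁ hp₂
      hq₁ hq₂ hp hq hp₁q hp₂q hq₁q hq₂q hpp hqq hg₁ hg₂ Φ
    exact ⟨C, fun f₁ f₂ h₁ h₂ => ⟨(hC f₁ f₂).trans_lt
      (ENNReal.mul_lt_top (ENNReal.mul_lt_top ENNReal.coe_lt_top h₁) h₂), hC f₁ f₂⟩⟩
  · obtain ⟨C, hC⟩ := MWD.exists_amalgamNorm_matrixWigner_le_modulationNorm s hM hM' hp₁ hp₂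
      hq₁ hq₂ hp hq hp₁q hp₂q hq₁q hq₂q hpp hqq hg₁ hg₂ Φ
    exact ⟨C, fun f₁ f₂ h₁ h₂ => ⟨(hC f₁ f₂).trans_lt (ENNReal.mul_lt_top (ENNReal.mul_lt_top
      (ENNReal.mul_lt_top ENNReal.coe_lt_top ENNReal.ofReal_lt_top) h₁) h₂), hC f₁ f₂⟩⟩
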